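/- Write $\dot{\mathbb R}=\mathbb R\setminus\{0\}$. For an open interval $I$ let $\operatorname{AC}(I)$ be the set of functions $f$ on $I$ for which there is $g\in L^1_{\mathrm{loc}}(I)$ with $f(y)-f(x)=\int_x^y g(s)\,ds$ for all $x,y\in I$, and let $\operatorname{AC}(\dot{\mathbb R})$ be the set of $f:\dot{\mathbb R}\to\mathbb C$ whose restrictions to $(-\infty,0)$ and $(0,\infty)$ are in $\operatorname{AC}$. For $T\in(0,\infty]$ let $\operatorname{AC}_{1,2}$ be the set of $\Psi:(0,T)\times\dot{\mathbb R}\to\mathbb C$ with $\Psi(\cdot,x)\in\operatorname{AC}((0,T))$ for all $x\in\dot{\mathbb R}$ and $\Psi(t,\cdot),\Psi_x(t,\cdot)\in\operatorname{AC}(\dot{\mathbb R})$ for all $t\in(0,T)$. Let $V:(0,T)\times\dot{\mathbb R}\to\mathbb C$ and $M,N\in\mathbb C^{2\times2}$. We say that $u:\dot{\mathbb R}\to\mathbb C$ satisfies the transmission condition if $$M\begin{pmatrix}u(0^+)\\u(0^-)\end{pmatrix}=N\begin{pmatrix}u'(0^+)\\-u'(0^-)\end{pmatrix},$$ where the limits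 $u(0^\pm)$ are required to exist if $(M,N)\neq(0,0)$, the limits $u'(0^\pm)$ are required to exist if $N\ne0$, and the condition is empty if $M=N=0$. A solution of the Cauchy problem with initial condition $F:\dot{\mathbb R}\to\mathbb C$ is a $\Psi\in\operatorname{AC}_{1,2}$ such that $i\Psi_t=-\Psi_{xx}+V\Psi$ for almost every $(t,x)\in(0,T)\times\dot{\mathbb R}$, $\Psi(t,\cdot)$ satisfies the transmission condition for every $t\in(0,T)$, and $\lim_{t\to0^+}\Psi(t,x)=F(x)$ for every $x\in\dot{\mathbb R}$. **Assumption on $G$.** Let $\alpha\in(0,\frac\pi2)$ and let $S_\alpha$ be the set of $z\in\mathbb C\setminus\{0\}$ having an argument in $[0,\alpha]\cup[\pi,\pi+\alpha]$. Let $G:(0,T)\times\dot{\mathbb R}\times\dot{\mathbb R}\to\mathbb C$ admit an extension $G:(0,T)\times\dot{\mathbb R}\times S_\alpha\to\mathbb C$ such that for all $t,x$ the map $G(t,x,\cdot)$ is continuous on $S_\alpha$ and holomorphic on $\operatorname{int}(S_\alpha)$, and suppose: (i) For every $z\in S_\alpha$, $G(\cdot,\cdot,z)\in\operatorname{AC}_{1,2}$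 and $iG_t=-G_{xx}+VG$ for almost every $(t,x)\in(0,T)\times\dot{\mathbb R}$; for every $y\in\dot{\mathbb R}$ and $t\in(0,T)$, $G(t,\cdot,y)$ satisfies the transmission condition. (ii) For every $x\in\dot{\mathbb R}$ there is $x_0>|x|$ such that $\lim_{t\to0^+}\int_{-x_0}^{x_0}G(t,x,y)\varphi(y)\,dy=\varphi(x)$ for all $\varphi\in C^\infty([-x_0,x_0])$. (iii) There are $a\in\operatorname{AC}((0,T))$ with $a>0$ and $\lim_{t\to0^+}a(t)=\infty$, $p\in(0,2)$, and continuous $A_j,B_j:(0,T)\times\dot{\mathbb R}\to[0,\infty)$, $j=0,1,2$, such that $\widetilde G$, defined by $G(t,x,z)=e^{ia(t)(z-x)^2}\widetilde G(t,x,z)$, satisfies for all $t\in(0,T)$, $x\in\dot{\mathbb R}$, $z\in S_\alpha$ $$|\widetilde G|\le A_0(t,x)e^{B_0(t,x)|z|^p},\qquad |\widetilde G_x|\le A_1(t,x)e^{B_1(t,x)|z|^p},$$ and moreover $|\widetilde G_{xx}|\le A_2(t,x)e^{B_2(t,x)|z|^p}$ for all $t,z$ and almost every $x$, and $|\widetilde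 G_t|\le A_2(t,x)e^{B_2(t,x)|z|^p}$ for all $x,z$ and almost every $t$. For every $x\in\dot{\mathbb R}$, $A_0(t,x)/\sqrt{a(t)}$ and $B_0(t,x)$ are bounded as $t\to0^+$. For every $t\in(0,T)$: if $(M,N)\ne(0,0)$, then $A_0(t,\cdot),B_0(t,\cdot)$ are bounded as $x\to0^\pm$; if $N\neq0$, then also $A_1(t,\cdot),B_1(t,\cdot)$ are bounded as $x\to0^\pm$. **Initial conditions.** For $q>0$ let $\mathcal A_q(\mathbb C)$ be the set of entire $F$ for which there are $A,B\ge0$ with $|F(z)|\le Ae^{B|z|^q}$ for all $z\in\mathbb C$. Say $F_n\to F$ in $\mathcal A_q(\mathbb C)$ if there is $B\ge0$ with $\lim_{n\to\infty}\sup_{z\in\mathbb C}|F_n(z)-F(z)|e^{-B|z|^q}=0$. **Theorem.** Let $G$ satisfy the assumption above, let $q\in(0,2)$ and $F\in\mathcal A_q(\mathbb C)$. Then for all $t\in(0,T)$, $x\in\dot{\mathbb R}$ the limit $$\Psi(t,x;F):=\lim_{\varepsilon\to0^+}\int_{\mathbb R}e^{-\varepsilon y^2}G(t,x,y)F(y)\,dy$$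 exists, the integrals being absolutely convergent for every $\varepsilon>0$, and $\Psi(\cdot,\cdot;F)\in\operatorname{AC}_{1,2}$ is a solution of the Cauchy problem with initial condition $F|_{\dot{\mathbb R}}$. Moreover, if $F_n\in\mathcal A_q(\mathbb C)$ and $F_n\to F$ in $\mathcal A_q(\mathbb C)$, then for every fixed $t\in(0,T)$, $\Psi(t,x;F_n)\to\Psi(t,x;F)$ as $n\to\infty$, uniformly for $x$ in compact subsets of $\dot{\mathbb R}$. -/

import Mathlib

open Set Filter Topology MeasureTheory
open scoped ENNReal ContDiff

noncomputable section

namespace GreenSchroedinger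

/-- The time interval `(0, T)` for `T ∈ (0, ∞]`. -/
def timeInterval (T : EReal) : Set ℝ := {t : ℝ | 0 < t ∧ (t : EReal) < T}

/-- The punctured line `ℝ \ {0}`. -/
def dotReal : Set ℝ := {0}ᶜ

/-- The closed double sector, without the origin, of all `z ≠ 0` that have an argument in
`[0, α] ∪ [π, π + α]`. -/
def doubleSector (α : ℝ) : Set ℂ :=
  {z : ℂ | z ≠ 0 ∧ ∃ θ ∈ Icc 0 α ∪ Icc Real.pi (Real.pi + α),
    z = (‖z‖ : ℂ) * Complex.exp ((θ : ℂ) * Complex.I)}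

/-- (Locally) absolutely continuous functions on an open interval `I`: the integral functions of
locally integrable functions. -/
def IsAC {E : Type*} [NormedAddCommGroup E] [NormedSpace ℝ E] (f : ℝ → E) (I : Set ℝ) : Prop :=
  ∃ g : ℝ → E, LocallyIntegrableOn g I ∧ ∀ x ∈ I, ∀ y ∈ I, f y - f x = ∫ s in x..y, g s

/-- Absolutely continuous functions on the punctured line. -/
def IsACDot (f : ℝ → ℂ) : Prop := IsAC f (Iio 0) ∧ IsAC f (Ioi 0)

/-- The space `AC_{1,2}((0,T) × (ℝ \ {0}))`. -/
structure MemAC12 (T : EReal) (Ψ : ℝ → ℝ → ℂ) : Prop where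
  time : ∀ x ∈ dotReal, IsAC (fun t => Ψ t x) (timeInterval T)
  space : ∀ t ∈ timeInterval T, IsACDot (Ψ t)
  differentiable : ∀ t ∈ timeInterval T, ∀ x ∈ dotReal, DifferentiableAt ℝ (Ψ t) x
  space_deriv : ∀ t ∈ timeInterval T, IsACDot (deriv (Ψ t))

/-- The equation `i Ψ_t = -Ψ_xx + V Ψ` at almost every `(t, x) ∈ (0,T) × (ℝ \ {0})`. -/
def SatisfiesSchroedinger (T : EReal) (V Ψ : ℝ → ℝ → ℂ) : Prop :=
  ∀ᵐ P : ℝ × ℝ, P.1 ∈ timeInterval T → P.2 ∈ dotReal →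
    Complex.I * deriv (fun t => Ψ t P.2) P.1
      = - deriv (deriv (Ψ P.1)) P.2 + V P.1 P.2 * Ψ P.1 P.2

/-- The condition `M (u(0⁺), u(0⁻)) = N (u'(0⁺), -u'(0⁻))` with the one-sided limits of `u` and
`u'` at `0`. The limits that occur are required to exist: those of `u` unless `M = N = 0`, and
those of `u'` if `N ≠ 0`; for `M = N = 0` the condition is empty. -/
def SatisfiesTransmission (M N : Matrix (Fin 2) (Fin 2) ℂ) (u : ℝ → ℂ) : Prop :=
  ∃ up um dp dm : ℂ,
    (M ≠ 0 ∨ N ≠ 0 → Tendsto u (𝓝[>] 0) (𝓝 up) ∧ Tendsto u (𝓝[<] 0) (𝓝 um)) ∧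
    (N ≠ 0 → Tendsto (deriv u) (𝓝[>] 0) (𝓝 dp) ∧ Tendsto (deriv u) (𝓝[<] 0) (𝓝 dm)) ∧
    M.mulVec ![up, um] = N.mulVec ![dp, -dm]

/-- `Ψ ∈ AC_{1,2}` solves the Cauchy problem with potential `V`, transmission matrices `M`, `N`
and initial condition `F`. -/
structure IsCauchySolution (T : EReal) (V : ℝ → ℝ → ℂ) (M N : Matrix (Fin 2) (Fin 2) ℂ)
    (F : ℝ → ℂ) (Ψ : ℝ → ℝ → ℂ) : Prop where
  mem : MemAC12 T Ψ
  schroedinger : SatisfiesSchroedinger T V Ψ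
  transmission : ∀ t ∈ timeInterval T, SatisfiesTransmission M N (Ψ t)
  initial : ∀ x ∈ dotReal, Tendsto (fun t => Ψ t x) (𝓝[>] 0) (𝓝 (F x))

/-- The assumption on the Green's function `G`. Here `Gext` is the continuation of `G` to the
double sector of angle `α`, `a` the coefficient of the Gaussian factor, `Gt` the remaining factor
`G̃`, and `p`, `A 0, A 1, A 2`, `B 0, B 1, B 2` are the data of its exponential bounds. The
derivatives `G̃_xx` and `G̃_t` of absolutely continuous functions exist only almost everywhere in
the variable of differentiation, and their bounds are required almost everywhere there. -/
structure GreenAssumption (T : EReal) (V : ℝ → ℝ → ℂ) (M N : Matrix (Fin 2) (Fin 2) ℂ)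
    (G : ℝ → ℝ → ℝ → ℂ) (α : ℝ) (Gext : ℝ → ℝ → ℂ → ℂ) (a : ℝ → ℝ) (Gt : ℝ → ℝ → ℂ → ℂ)
    (p : ℝ) (A B : Fin 3 → ℝ → ℝ → ℝ) : Prop where
  angle : α ∈ Ioo 0 (Real.pi / 2)
  extends_G : ∀ t ∈ timeInterval T, ∀ x ∈ dotReal, ∀ y ∈ dotReal, Gext t x (y : ℂ) = G t x y
  continuousOn : ∀ t ∈ timeInterval T, ∀ x ∈ dotReal, ContinuousOn (Gext t x) (doubleSector α)
  holomorphic : ∀ t ∈ timeInterval T, ∀ x ∈ dotReal,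
    DifferentiableOn ℂ (Gext t x) (interior (doubleSector α))
  -- (i) Schroedinger equation and transmission condition
  mem : ∀ z ∈ doubleSector α, MemAC12 T (fun t x => Gext t x z)
  schroedinger : ∀ z ∈ doubleSector α, SatisfiesSchroedinger T V (fun t x => Gext t x z)
  transmission : ∀ y ∈ dotReal, ∀ t ∈ timeInterval T,
    SatisfiesTransmission M N (fun x => G t x y)
  -- (ii) initial condition
  initial : ∀ x ∈ dotReal, ∃ x₀ : ℝ, |x| < x₀ ∧ ∀ φ : ℝ → ℂ, ContDiffOn ℝ ∞ φ (Icc (-x₀) x₀) →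
    Tendsto (fun t => ∫ y in (-x₀)..x₀, G t x y * φ y) (𝓝[>] 0) (𝓝 (φ x))
  -- (iii) Gaussian factorisation and exponential bounds
  a_ac : IsAC a (timeInterval T)
  a_pos : ∀ t ∈ timeInterval T, 0 < a t
  a_lim : Tendsto a (𝓝[>] 0) atTop
  decomposition : ∀ t ∈ timeInterval T, ∀ x ∈ dotReal, ∀ z ∈ doubleSector α,
    Gext t x z = Complex.exp (Complex.I * (a t : ℂ) * (z - (x : ℂ)) ^ 2) * Gt t x z
  order : p ∈ Ioo (0 : ℝ) 2
  A_nonneg : ∀ j, ∀ t ∈ timeInterval T, ∀ x ∈ dotReal, 0 ≤ A j t x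
  B_nonneg : ∀ j, ∀ t ∈ timeInterval T, ∀ x ∈ dotReal, 0 ≤ B j t x
  A_continuous : ∀ j, ContinuousOn (fun P : ℝ × ℝ => A j P.1 P.2) (timeInterval T ×ˢ dotReal)
  B_continuous : ∀ j, ContinuousOn (fun P : ℝ × ℝ => B j P.1 P.2) (timeInterval T ×ˢ dotReal)
  bound : ∀ t ∈ timeInterval T, ∀ x ∈ dotReal, ∀ z ∈ doubleSector α,
    ‖Gt t x z‖ ≤ A 0 t x * Real.exp (B 0 t x * ‖z‖ ^ p)
  bound_x : ∀ t ∈ timeInterval T, ∀ x ∈ dotReal, ∀ z ∈ doubleSector α,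
    ‖deriv (fun ξ => Gt t ξ z) x‖ ≤ A 1 t x * Real.exp (B 1 t x * ‖z‖ ^ p)
  bound_xx : ∀ t ∈ timeInterval T, ∀ z ∈ doubleSector α, ∀ᵐ x : ℝ, x ∈ dotReal →
    ‖deriv (deriv (fun ξ => Gt t ξ z)) x‖ ≤ A 2 t x * Real.exp (B 2 t x * ‖z‖ ^ p)
  bound_t : ∀ x ∈ dotReal, ∀ z ∈ doubleSector α, ∀ᵐ t : ℝ, t ∈ timeInterval T →
    ‖deriv (fun τ => Gt τ x z) t‖ ≤ A 2 t x * Real.exp (B 2 t x * ‖z‖ ^ p)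
  A_bounded_time : ∀ x ∈ dotReal,
    IsBoundedUnder (· ≤ ·) (𝓝[>] 0) (fun t => A 0 t x / √(a t))
  B_bounded_time : ∀ x ∈ dotReal, IsBoundedUnder (· ≤ ·) (𝓝[>] 0) (fun t => B 0 t x)
  bounded_zero : M ≠ 0 ∨ N ≠ 0 → ∀ t ∈ timeInterval T,
    IsBoundedUnder (· ≤ ·) (𝓝[≠] 0) (A 0 t) ∧ IsBoundedUnder (· ≤ ·) (𝓝[≠] 0) (B 0 t)
  bounded_zero_x : N ≠ 0 → ∀ t ∈ timeInterval T,
    IsBoundedUnder (· ≤ ·) (𝓝[≠] 0) (A 1 t) ∧ IsBoundedUnder (· ≤ ·) (𝓝[≠] 0) (B 1 t)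

/-- The space `𝒜_q(ℂ)` of entire functions with exponential growth of order `q`. -/
def expGrowth (q : ℝ) : Set (ℂ → ℂ) :=
  {F | Differentiable ℂ F ∧
    ∃ A B : ℝ, 0 ≤ A ∧ 0 ≤ B ∧ ∀ z : ℂ, ‖F z‖ ≤ A * Real.exp (B * ‖z‖ ^ q)}

/-- Convergence in `𝒜_q(ℂ)`; the supremum is taken in `[0, ∞]`. -/
def ConvergesExpGrowth (q : ℝ) (Fn : ℕ → ℂ → ℂ) (F : ℂ → ℂ) : Prop :=
  ∃ B : ℝ, 0 ≤ B ∧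
    Tendsto (fun n => ⨆ z : ℂ, ENNReal.ofReal (‖Fn n z - F z‖ * Real.exp (-B * ‖z‖ ^ q)))
      atTop (𝓝 0)

/-- The integrand `e^{-ε y²} G(t,x,y) F(y)` of the regularised integral. -/
def regIntegrand (G : ℝ → ℝ → ℝ → ℂ) (F : ℂ → ℂ) (t x ε y : ℝ) : ℂ :=
  (Real.exp (-ε * y ^ 2) : ℂ) * G t x y * F (y : ℂ)

/-- The wave function `Ψ(t,x;F) = lim_{ε → 0⁺} ∫ e^{-ε y²} G(t,x,y) F(y) dy`. -/
def waveFunction (G : ℝ → ℝ → ℝ → ℂ) (F : ℂ → ℂ) (t x : ℝ) : ℂ :=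
  limUnder (𝓝[>] (0 : ℝ)) (fun ε => ∫ y : ℝ, regIntegrand G F t x ε y)

end GreenSchroedinger

end

/-! On the real line the phase `exp(i a (y - x)^2)` has modulus one, so the integrand may grow and
the integral need not converge absolutely. On the line `z = y e^{iθ}` with `0 < θ ≤ α` the modulus
of the phase is `exp(-a y^2 sin 2θ + 2 a x y sin θ)`. This Gaussian decay absorbs the exponentials
of order `p, q < 2` that bound `G̃` and `F`.

For `ε > 0` the factor `e^{-ε z^2}` decays on all angles `0 ≤ θ ≤ α/2`, because `2θ ≤ α < π/2`.
Cauchy's theorem therefore turns the regularised real integral into the integral over the line of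
angle `α/2` (`SectorGaussian.integral_eq`). There the Gaussian bound is independent of `ε`, and
dominated convergence allows `ε → 0`. So `Ψ` is the absolutely convergent integral of `kern` with `ε
= 0` and `θ = α/2` (`waveFunction_eq`), and every claim is proved for that integral.

Regularity and the equation follow by differentiation under the integral sign. The uniform Gaussian
bounds `exists_kern_bounds_uniform` provide the domination, and Fubini gives absolute continuity
(`isAC_integral`). Since `V` is not assumed measurable, exchanging null sets in the equation needs
`ae_ae_eq_mul_of_forall_ae`.

The transmission condition is known only for real `y`, so one has to return to the real line. For
fixed `ε` the one-sided limits at `x = 0` pass under the regularised real integral, and the linear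
condition survives integration. On the rotated line, regularisation changes the integral by an error
that tends to zero uniformly near `x = 0`, so the limits in `x` and `ε` may be exchanged
(`exists_limits`).

The initial condition is assumed only on a compact interval `[-s, s]` with `s > |x|`. One integrates
over this interval and then along rotated rays starting at `±s`. The rays lie away from the centre
of the Gaussian and contribute `O(A_0 / a) = O(a^{-1/2})`, which vanishes as `t → 0⁺`. Continuous
dependence on `F` follows from linearity and the uniformity in `F` of the kernel bounds. -/

namespace GreenSchroedinger

/-! ### Absolutely continuous functions on open intervals -/

section AbsolutelyContinuous

/-- A property that holds almost everywhere on every compact subinterval of an open interval holds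
almost everywhere on the interval. -/
theorem ae_mem_of_forall_Icc {I : Set ℝ} (hI : IsOpen I) {P : ℝ → Prop}
    (h : ∀ c ∈ I, ∀ d ∈ I, c < d → ∀ᵐ s : ℝ, s ∈ Ioo c d → P s) :
    ∀ᵐ s : ℝ, s ∈ I → P s := by
  -- Rational endpoints leave only countably many null sets to discard.
  have h' : ∀ᵐ s : ℝ, ∀ r : ℚ × ℚ, (r.1 : ℝ) ∈ I → (r.2 : ℝ) ∈ I → s ∈ Ioo (r.1 : ℝ) r.2 → P s := by
    rw [ae_all_iff]
    intro r
    by_cases h1 : (r.1 : ℝ) ∈ I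
    · by_cases h2 : (r.2 : ℝ) ∈ I
      · by_cases h3 : (r.1 : ℝ) < r.2
        · filter_upwards [h _ h1 _ h2 h3] with s hs _ _ h4 using hs h4
        · exact Eventually.of_forall fun s _ _ h4 => absurd (h4.1.trans h4.2) h3
      · exact Eventually.of_forall fun s _ h4 => absurd h4 h2
    · exact Eventually.of_forall fun s h4 => absurd h4 h1
  filter_upwards [h'] with s hs hsI
  obtain ⟨δ, hδ, hball⟩ := Metric.isOpen_iff.1 hI s hsI
  obtain ⟨r1, hr1, hr1'⟩ := exists_rat_btwn (show s - δ < s by linarith)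
  obtain ⟨r2, hr2, hr2'⟩ := exists_rat_btwn (show s < s + δ by linarith)
  refine hs (r1, r2) (hball ?_) (hball ?_) ⟨hr1', hr2⟩
  · rw [Metric.mem_ball, Real.dist_eq, abs_lt]; constructor <;> linarith
  · rw [Metric.mem_ball, Real.dist_eq, abs_lt]; constructor <;> linarith

/-- A function that is integrable on the compact subintervals of an open interval is locally
integrable there. -/
theorem locallyIntegrableOn_of_forall_Icc {E : Type*} [NormedAddCommGroup E] {I : Set ℝ}
    (hI : IsOpen I) {g : ℝ → E}
    (h : ∀ c ∈ I, ∀ d ∈ I, c < d → IntegrableOn g (Icc c d)) : LocallyIntegrableOn g I := by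
  intro s hs
  obtain ⟨δ, hδ, hball⟩ := Metric.isOpen_iff.1 hI s hs
  refine ⟨Icc (s - δ / 2) (s + δ / 2), mem_nhdsWithin_of_mem_nhds
    (Icc_mem_nhds (by linarith) (by linarith)), h _ (hball ?_) _ (hball ?_) (by linarith)⟩
  · rw [Metric.mem_ball, Real.dist_eq, abs_lt]; constructor <;> linarith
  · rw [Metric.mem_ball, Real.dist_eq, abs_lt]; constructor <;> linarith

variable {E : Type*} [NormedAddCommGroup E] [NormedSpace ℝ E] {f g : ℝ → E} {I : Set ℝ}

theorem intervalIntegrable_of_locallyIntegrableOn {E : Type*} [NormedAddCommGroup E]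
    {g : ℝ → E} {I : Set ℝ} (hI' : I.OrdConnected)
    (hg : LocallyIntegrableOn g I) {c d : ℝ} (hc : c ∈ I) (hd : d ∈ I) :
    IntervalIntegrable g volume c d :=
  intervalIntegrable_iff.2 ((hg.integrableOn_compact_subset (hI'.uIcc_subset hc hd)
    isCompact_uIcc).mono_set uIoc_subset_uIcc)

theorem IsAC.congr {f₁ f₂ : ℝ → E} (h : IsAC f₁ I) (he : ∀ x ∈ I, f₁ x = f₂ x) : IsAC f₂ I := by
  obtain ⟨g, hg, hfg⟩ := h
  exact ⟨g, hg, fun x hx y hy => by rw [← he x hx, ← he y hy, hfg x hx y hy]⟩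

theorem isAC_const (c : E) : IsAC (fun _ : ℝ => c) I :=
  ⟨fun _ => 0, (locallyIntegrable_const 0).locallyIntegrableOn _, by simp⟩

theorem IsAC.const_mul {f : ℝ → ℂ} (h : IsAC f I) (c : ℂ) : IsAC (fun s => c * f s) I := by
  obtain ⟨g, hg, hfg⟩ := h
  refine ⟨fun s => c * g s, ?_, fun x hx y hy => ?_⟩
  · intro x hx
    obtain ⟨s, hs, hs'⟩ := hg x hx
    exact ⟨s, hs, hs'.const_mul c⟩
  · rw [intervalIntegral.integral_const_mul, ← hfg x hx y hy]; ring

theorem IsAC.continuousOn (h : IsAC f I) (hI : IsOpen I) (hI' : I.OrdConnected) :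
    ContinuousOn f I := by
  obtain ⟨g, hg, hfg⟩ := h
  intro s hs
  obtain ⟨δ, hδ, hball⟩ := Metric.isOpen_iff.1 hI s hs
  have hc : s - δ / 2 ∈ I := hball (by
    rw [Metric.mem_ball, Real.dist_eq, abs_lt]; constructor <;> linarith)
  have hd : s + δ / 2 ∈ I := hball (by
    rw [Metric.mem_ball, Real.dist_eq, abs_lt]; constructor <;> linarith)
  have hInt := intervalIntegrable_of_locallyIntegrableOn hI' hg hc hd
  have hle : s - δ / 2 ≤ s + δ / 2 := by linarith
  have hcont := intervalIntegral.continuousOn_primitive_interval' hInt left_mem_uIcc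
  rw [uIcc_of_le hle] at hcont
  have hnhds : Icc (s - δ / 2) (s + δ / 2) ∈ 𝓝 s := Icc_mem_nhds (by linarith) (by linarith)
  have h1 : ContinuousAt (fun r => f (s - δ / 2) + ∫ u in (s - δ / 2)..r, g u) s :=
    continuousAt_const.add (hcont.continuousAt hnhds)
  refine (h1.congr ?_).continuousWithinAt
  filter_upwards [hnhds] with r hr
  rw [← hfg _ hc r (hI'.out hc hd hr)]
  abel

variable [CompleteSpace E]

/-- An absolutely continuous function is almost everywhere differentiable, and its derivative is
almost everywhere equal to the density. -/
theorem ae_hasDerivAt_of_locallyIntegrableOn (hI : IsOpen I) (hI' : I.OrdConnected)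
    (hg : LocallyIntegrableOn g I) (hfg : ∀ x ∈ I, ∀ y ∈ I, f y - f x = ∫ s in x..y, g s) :
    ∀ᵐ s : ℝ, s ∈ I → HasDerivAt f (g s) s := by
  refine ae_mem_of_forall_Icc hI fun c hc d hd hcd => ?_
  have hInt := intervalIntegrable_of_locallyIntegrableOn hI' hg hc hd
  filter_upwards [hInt.ae_hasDerivAt_integral] with s hs hsI
  rw [uIcc_of_le hcd.le] at hs
  have := hs (Ioo_subset_Icc_self hsI) c (left_mem_Icc.2 hcd.le)
  refine (this.const_add (f c)).congr_of_eventuallyEq ?_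
  filter_upwards [Ioo_mem_nhds hsI.1 hsI.2] with r hr
  rw [← hfg c hc r (hI'.out hc hd (Ioo_subset_Icc_self hr))]
  abel

theorem IsAC.ae_differentiableAt (h : IsAC f I) (hI : IsOpen I) (hI' : I.OrdConnected) :
    ∀ᵐ s : ℝ, s ∈ I → DifferentiableAt ℝ f s := by
  obtain ⟨g, hg, hfg⟩ := h
  filter_upwards [ae_hasDerivAt_of_locallyIntegrableOn hI hI' hg hfg] with s hs hsI
    using (hs hsI).differentiableAt

theorem IsAC.locallyIntegrableOn_deriv (h : IsAC f I) (hI : IsOpen I) (hI' : I.OrdConnected) :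
    LocallyIntegrableOn (deriv f) I := by
  obtain ⟨g, hg, hfg⟩ := h
  refine locallyIntegrableOn_of_forall_Icc hI fun c hc d hd _ => ?_
  have hsub : Icc c d ⊆ I := hI'.out hc hd
  refine (hg.integrableOn_compact_subset hsub isCompact_Icc).congr_fun_ae ?_
  refine (ae_restrict_iff' measurableSet_Icc).2 ?_
  filter_upwards [ae_hasDerivAt_of_locallyIntegrableOn hI hI' hg hfg] with s hs hsI
    using (hs (hsub hsI)).deriv.symm

theorem IsAC.integral_deriv (h : IsAC f I) (hI : IsOpen I) (hI' : I.OrdConnected) {c d : ℝ}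
    (hc : c ∈ I) (hd : d ∈ I) : f d - f c = ∫ s in c..d, deriv f s := by
  obtain ⟨g, hg, hfg⟩ := h
  rw [hfg c hc d hd]
  refine intervalIntegral.integral_congr_ae ?_
  filter_upwards [ae_hasDerivAt_of_locallyIntegrableOn hI hI' hg hfg] with s hs hsI
    using (hs (hI'.uIcc_subset hc hd (uIoc_subset_uIcc hsI))).deriv.symm

end AbsolutelyContinuous

/-! ### Joint measurability of functions continuous in one variable, and of their derivatives -/

section Measurability

variable {P : Type*} [MeasurableSpace P] {f : P → ℝ → ℂ} {U : Set ℝ}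

/-- A function that is measurable in the parameter and continuous in the real variable on an open
set is jointly measurable. -/
theorem measurable_indicator_of_continuousOn (hU : IsOpen U)
    (hm : ∀ s ∈ U, Measurable fun p => f p s) (hc : ∀ p, ContinuousOn (f p) U) :
    Measurable fun r : P × ℝ => U.indicator (f r.1) r.2 := by
  have h1 : Measurable (Function.uncurry fun (s : U) (p : P) => f p s) :=
    measurable_uncurry_of_continuous_of_measurable
      (fun p => (hc p).domRestrict) (fun s => hm s s.2)
  have hS : MeasurableSet {r : P × ℝ | r.2 ∈ U} := measurable_snd hU.measurableSet
  refine measurable_of_restrict_of_restrict_compl hS ?_ ?_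
  · have h2 : Measurable fun r : {r : P × ℝ | r.2 ∈ U} => ((⟨r.1.2, r.2⟩ : U), r.1.1) :=
      ((measurable_snd.comp measurable_subtype_coe).subtype_mk).prodMk
        (measurable_fst.comp measurable_subtype_coe)
    convert h1.comp h2 using 1
    funext r
    exact indicator_of_mem (show r.1.2 ∈ U from r.2) _
  · convert measurable_const (a := (0 : ℂ)) using 1
    funext r
    exact indicator_of_notMem (show r.1.2 ∉ U from r.2) _

/-- For a function that is continuous near a point, differentiability can be tested on rational
increments. -/
theorem hasDerivAt_iff_tendsto_rat {g : ℝ → ℂ} (hU : IsOpen U) (hg : ContinuousOn g U)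
    {s : ℝ} (hs : s ∈ U) {L : ℂ} :
    HasDerivAt g L s ↔ Tendsto (fun h : ℚ => (h : ℝ)⁻¹ • (g (s + h) - g s))
      (comap ((↑) : ℚ → ℝ) (𝓝[≠] 0)) (𝓝 L) := by
  rw [hasDerivAt_iff_tendsto_slope_zero]
  refine ⟨fun h => h.comp tendsto_comap, fun h => ?_⟩
  rw [Metric.tendsto_nhds] at h ⊢
  intro ε hε
  have h1 := h (ε / 2) (half_pos hε)
  rw [eventually_comap, eventually_nhdsWithin_iff, Metric.eventually_nhds_iff] at h1
  obtain ⟨δ, hδ, h1⟩ := h1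
  obtain ⟨δ', hδ', hball⟩ := Metric.isOpen_iff.1 hU s hs
  rw [eventually_nhdsWithin_iff, Metric.eventually_nhds_iff]
  refine ⟨min δ δ', lt_min hδ hδ', fun h hh hne => ?_⟩
  -- The difference quotient is continuous in the increment on this punctured ball and the rationals
  -- are dense in it. A bound on rational increments thus extends to all, with the closed ball of
  -- radius `ε / 2` leaving room for strict inequality.
  set O : Set ℝ := Metric.ball 0 (min δ δ') ∩ {0}ᶜ with hO
  have hOo : IsOpen O := Metric.isOpen_ball.inter isOpen_compl_singleton
  have hcont : ContinuousOn (fun h : ℝ => h⁻¹ • (g (s + h) - g s)) O := by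
    refine (continuousOn_inv₀.mono inter_subset_right).smul (ContinuousOn.sub ?_ continuousOn_const)
    refine hg.comp (by fun_prop) fun r hr => hball ?_
    have := hr.1
    rw [Metric.mem_ball, dist_zero_right] at this
    rw [Metric.mem_ball, dist_eq_norm, add_sub_cancel_left]
    exact this.trans_le (min_le_right _ _)
  have hmem : h ∈ O := ⟨hh, hne⟩
  have hcl : h ∈ closure (O ∩ range ((↑) : ℚ → ℝ)) :=
    Rat.denseRange_cast.open_subset_closure_inter hOo hmem
  have hcl2 := ((hcont h hmem).mono (inter_subset_left (t := range ((↑) : ℚ → ℝ)))).mem_closure_image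
    hcl
  have hsub : (fun h : ℝ => h⁻¹ • (g (s + h) - g s)) '' (O ∩ range ((↑) : ℚ → ℝ))
      ⊆ Metric.closedBall L (ε / 2) := by
    rintro _ ⟨_, ⟨hr, r, rfl⟩, rfl⟩
    exact (h1 (lt_of_lt_of_le hr.1 (min_le_left _ _)) hr.2 r rfl).le
  have := closure_minimal hsub Metric.isClosed_closedBall hcl2
  exact lt_of_le_of_lt this (half_lt_self hε)

/-- The derivative of a function that is measurable in the parameter and continuous in the real
variable is jointly measurable. -/
theorem measurable_indicator_deriv (hU : IsOpen U)
    (hm : ∀ s ∈ U, Measurable fun p => f p s) (hc : ∀ p, ContinuousOn (f p) U) :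
    Measurable fun r : P × ℝ => U.indicator (deriv (f r.1)) r.2 := by
  classical
  have h0 := measurable_indicator_of_continuousOn hU hm hc
  set l : Filter ℚ := comap ((↑) : ℚ → ℝ) (𝓝[≠] 0) with hl
  have hne : l.NeBot := by
    rw [hl, comap_neBot_iff]
    intro t ht
    obtain ⟨O, hO, h0O, hsub⟩ := mem_nhdsWithin.1 ht
    obtain ⟨δ, hδ, hball⟩ := Metric.isOpen_iff.1 hO 0 h0O
    obtain ⟨r, hr, hr'⟩ := exists_rat_btwn hδ
    exact ⟨r, hsub ⟨hball (by
      rwa [Metric.mem_ball, Real.dist_eq, sub_zero, abs_of_pos hr]), hr.ne'⟩⟩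
  let Q : ℚ → P × ℝ → ℂ := fun h r =>
    (h : ℝ)⁻¹ • (U.indicator (f r.1) (r.2 + h) - U.indicator (f r.1) r.2)
  have hQ : ∀ h, Measurable (Q h) := fun h => by
    have h1 := h0.comp (measurable_fst.prodMk (measurable_snd.add_const (h : ℝ)))
    exact (h1.sub h0).const_smul (h : ℝ)⁻¹
  have hS : MeasurableSet {r : P × ℝ | r.2 ∈ U} := measurable_snd hU.measurableSet
  -- `D` is the convergence set of countably many measurable quotients, hence measurable; inside `U`
  -- it is exactly the set of differentiability.
  set D : Set (P × ℝ) := {r | ∃ c, Tendsto (Q · r) l (𝓝 c)} with hD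
  have hDm : MeasurableSet D := MeasureTheory.measurableSet_exists_tendsto hQ
  have key : ∀ r : P × ℝ, r.2 ∈ U → ∀ L, HasDerivAt (f r.1) L r.2 ↔ Tendsto (Q · r) l (𝓝 L) := by
    intro r hr L
    have he : f r.1 =ᶠ[𝓝 r.2] U.indicator (f r.1) := by
      filter_upwards [hU.mem_nhds hr] with s hs using (indicator_of_mem hs _).symm
    rw [he.hasDerivAt_iff]
    refine hasDerivAt_iff_tendsto_rat hU ?_ hr
    exact (hc r.1).congr fun s hs => indicator_of_mem hs _
  have hSD := hS.inter hDm
  refine measurable_of_restrict_of_restrict_compl hSD ?_ ?_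
  · refine measurable_of_tendsto_metrizable' l (f := fun h (r : ↥({r : P × ℝ | r.2 ∈ U} ∩ D)) => Q h r)
      (fun h => (hQ h).comp measurable_subtype_coe) ?_
    rw [tendsto_pi_nhds]
    rintro ⟨r, hr, c, hrc⟩
    have : (({r : P × ℝ | r.2 ∈ U} ∩ D).domRestrict fun r => U.indicator (deriv (f r.1)) r.2)
      ⟨r, hr, c, hrc⟩ = c := by
      rw [domRestrict_apply, indicator_of_mem (show r.2 ∈ U from hr)]
      exact ((key r hr c).2 hrc).deriv
    rw [this]
    exact hrc
  -- Off `D` the derivative takes its default value `0`, so the function vanishes outside the good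
  -- set.
  · convert measurable_const (a := (0 : ℂ)) using 1
    funext r
    rw [domRestrict_apply]
    by_cases hr : r.1.2 ∈ U
    · rw [indicator_of_mem hr, deriv_zero_of_not_differentiableAt]
      intro hd
      exact r.2 ⟨hr, _, (key r.1 hr _).1 hd.hasDerivAt⟩
    · rw [indicator_of_notMem hr]

theorem measurable_deriv_of_measurable_left (hU : IsOpen U)
    (hm : ∀ s ∈ U, Measurable fun p => f p s) (hc : ∀ p, ContinuousOn (f p) U) {s : ℝ}
    (hs : s ∈ U) : Measurable fun p => deriv (f p) s := by
  have := (measurable_indicator_deriv hU hm hc).comp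
    (measurable_id.prodMk (measurable_const (a := s)))
  convert this using 1
  funext p
  exact (indicator_of_mem hs _).symm

end Measurability

/-! ### Differentiation under the integral sign for absolutely continuous integrands -/

/-- Integrals of absolutely continuous functions depending on a parameter are absolutely
continuous, and can be differentiated almost everywhere under the integral sign. -/
theorem isAC_integral {I : Set ℝ} (hI : IsOpen I) (hI' : I.OrdConnected) {f : ℝ → ℝ → ℂ}
    (hm : ∀ s ∈ I, Measurable fun y => f y s) (hAC : ∀ y, IsAC (f y) I)
    (hInt : ∀ s ∈ I, Integrable fun y => f y s)
    (hdom : ∀ c ∈ I, ∀ d ∈ I, c < d → ∃ m b : ℝ → ℝ, IntegrableOn m (Icc c d) ∧ Integrable b ∧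
      ∀ y, ∀ᵐ s : ℝ, s ∈ Icc c d → ‖deriv (f y) s‖ ≤ m s * b y) :
    IsAC (fun s => ∫ y, f y s) I ∧ ∀ᵐ s : ℝ, s ∈ I → Integrable (fun y => deriv (f y) s) ∧
      HasDerivAt (fun s => ∫ y, f y s) (∫ y, deriv (f y) s) s := by
  have hc : ∀ y, ContinuousOn (f y) I := fun y => (hAC y).continuousOn hI hI'
  have hmeas := measurable_indicator_deriv hI hm hc
  have hprod : ∀ c ∈ I, ∀ d ∈ I, c < d →
      Integrable (Function.uncurry fun y s => deriv (f y) s)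
        ((volume : Measure ℝ).prod (volume.restrict (Icc c d))) := by
    intro c hcI d hdI hcd
    obtain ⟨m, b, hmI, hb, hbd⟩ := hdom c hcI d hdI hcd
    have hsub : Icc c d ⊆ I := hI'.out hcI hdI
    have hsm : AEStronglyMeasurable (Function.uncurry fun y s => deriv (f y) s)
        ((volume : Measure ℝ).prod (volume.restrict (Icc c d))) := by
      refine hmeas.aestronglyMeasurable.congr ?_
      have : ∀ᵐ s ∂(volume.restrict (Icc c d)), s ∈ I :=
        (ae_restrict_mem measurableSet_Icc).mono fun s hs => hsub hs
      have h2 := (Measure.quasiMeasurePreserving_snd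
        (μ := (volume : Measure ℝ)) (ν := volume.restrict (Icc c d))).ae this
      filter_upwards [h2] with r hr using indicator_of_mem hr _
    have hbd' : ∀ y, ∀ᵐ s ∂(volume.restrict (Icc c d)), ‖deriv (f y) s‖ ≤ m s * b y :=
      fun y => (ae_restrict_iff' measurableSet_Icc).2 (hbd y)
    have hy : ∀ y, Integrable (deriv (f y)) (volume.restrict (Icc c d)) := fun y =>
      ((hAC y).locallyIntegrableOn_deriv hI hI').integrableOn_compact_subset hsub isCompact_Icc
    -- The exceptional null set of `s` depends on `y`, so the majorant is not applied pointwise on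
    -- the product: one integrates the norm in `s` first, which leaves a multiple of `b y`.
    rw [integrable_prod_iff hsm]
    refine ⟨Eventually.of_forall hy, ?_⟩
    refine (hb.const_mul (∫ s in Icc c d, m s)).mono' hsm.norm.integral_prod_right' ?_
    refine Eventually.of_forall fun y => ?_
    rw [Real.norm_of_nonneg (integral_nonneg fun _ => norm_nonneg _), ← integral_mul_const]
    exact integral_mono_ae (hy y).norm (hmI.mul_const _) (hbd' y)
  have hgint : ∀ c ∈ I, ∀ d ∈ I, c < d →
      IntegrableOn (fun s => ∫ y, deriv (f y) s) (Icc c d) := fun c hcI d hdI hcd =>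
    (hprod c hcI d hdI hcd).integral_prod_right
  have hgl : LocallyIntegrableOn (fun s => ∫ y, deriv (f y) s) I :=
    locallyIntegrableOn_of_forall_Icc hI hgint
  have hle : ∀ c ∈ I, ∀ d ∈ I, c < d →
      (∫ y, f y d) - (∫ y, f y c) = ∫ s in c..d, ∫ y, deriv (f y) s := by
    intro c hcI d hdI hcd
    rw [← integral_sub (hInt d hdI) (hInt c hcI), intervalIntegral.integral_of_le hcd.le,
      ← integral_Icc_eq_integral_Ioc,
      ← integral_integral_swap (hprod c hcI d hdI hcd)]
    congr 1
    funext y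
    rw [(hAC y).integral_deriv hI hI' hcI hdI, intervalIntegral.integral_of_le hcd.le,
      ← integral_Icc_eq_integral_Ioc]
  have heq : ∀ c ∈ I, ∀ d ∈ I,
      (∫ y, f y d) - (∫ y, f y c) = ∫ s in c..d, ∫ y, deriv (f y) s := by
    intro c hcI d hdI
    rcases lt_trichotomy c d with h | h | h
    · exact hle c hcI d hdI h
    · subst h; simp
    · rw [intervalIntegral.integral_symm, ← hle d hdI c hcI h]; abel
  refine ⟨⟨_, hgl, heq⟩, ?_⟩
  have hae : ∀ᵐ s : ℝ, s ∈ I → Integrable (fun y => deriv (f y) s) := by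
    refine ae_mem_of_forall_Icc hI fun c hcI d hdI hcd => ?_
    have := (hprod c hcI d hdI hcd).prod_left_ae
    rw [ae_restrict_iff' measurableSet_Icc] at this
    filter_upwards [this] with s hs hsI using hs (Ioo_subset_Icc_self hsI)
  filter_upwards [hae, ae_hasDerivAt_of_locallyIntegrableOn hI hI' hgl heq] with s h1 h2 hs
    using ⟨h1 hs, h2 hs⟩

/-! ### Gaussians against exponentials of order below two -/

section Elementary

/-- Powers below the second are dominated by any multiple of the square. -/
theorem exists_mul_rpow_le {p : ℝ} (hp : p ∈ Ioo (0 : ℝ) 2) {B δ : ℝ} (hB : 0 ≤ B) (hδ : 0 < δ) :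
    ∃ C : ℝ, 0 ≤ C ∧ ∀ r : ℝ, 0 ≤ r → B * r ^ p ≤ δ * r ^ 2 + C := by
  -- `R` is the radius where `B r^p = δ r^2`. Below it the constant `B R^p` suffices, above it the
  -- square wins.
  set R : ℝ := (B / δ) ^ (1 / (2 - p)) with hR
  have h2p : 0 < 2 - p := by linarith [hp.2]
  have hR0 : 0 ≤ R := by positivity
  have hRp : R ^ (2 - p) = B / δ := by
    rw [hR, ← Real.rpow_mul (by positivity), one_div_mul_cancel h2p.ne', Real.rpow_one]
  refine ⟨B * R ^ p, by positivity, fun r hr => ?_⟩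
  rcases le_total r R with h | h
  · have : B * r ^ p ≤ B * R ^ p :=
      mul_le_mul_of_nonneg_left (Real.rpow_le_rpow hr h hp.1.le) hB
    have := mul_nonneg hδ.le (sq_nonneg r)
    linarith
  · rcases hr.eq_or_lt with h0 | h0
    · rw [← h0, Real.zero_rpow hp.1.ne']
      have : 0 ≤ B * R ^ p := by positivity
      nlinarith
    · have h1 : B / δ ≤ r ^ (2 - p) := hRp ▸ Real.rpow_le_rpow hR0 h h2p.le
      have h2 : B ≤ δ * r ^ (2 - p) := by
        rw [div_le_iff₀ hδ] at h1; linarith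
      have h3 : r ^ (2 - p) * r ^ p = r ^ 2 := by
        rw [← Real.rpow_add h0, sub_add_cancel, Real.rpow_two]
      have h4 : B * r ^ p ≤ δ * r ^ (2 - p) * r ^ p :=
        mul_le_mul_of_nonneg_right h2 (by positivity)
      have : 0 ≤ B * R ^ p := by positivity
      rw [mul_assoc, h3] at h4
      linarith

/-- A Gaussian absorbs exponentials of order below two. -/
theorem exists_exp_le_gaussian {p q : ℝ} (hp : p ∈ Ioo (0 : ℝ) 2) (hq : q ∈ Ioo (0 : ℝ) 2)
    {c L B B' s : ℝ} (hc : 0 < c) (hB : 0 ≤ B) (hB' : 0 ≤ B') :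
    ∃ C : ℝ, 0 < C ∧ ∀ r : ℝ, 0 ≤ r → 0 ≤ s + r →
      Real.exp (-c * r ^ 2 + L * r + B * (s + r) ^ p + B' * (s + r) ^ q)
        ≤ C * Real.exp (-(c / 2) * r ^ 2) := by
  -- Budget for the quadratic term: `c/12` for the linear term and, since `(s + r)^2 ≤ 2 s^2 + 2
  -- r^2`, `c/6` for each power. The sum `5c/12` stays below the available `c/2`; the leftover `s^2`
  -- terms total `c/3 * s^2`, and completing the square for `L * r` costs `3 L^2 / c`.
  have hc12 : 0 < c / 12 := by positivity
  obtain ⟨C₁, -, h₁⟩ := exists_mul_rpow_le hp hB hc12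
  obtain ⟨C₂, -, h₂⟩ := exists_mul_rpow_le hq hB' hc12
  refine ⟨Real.exp (3 * L ^ 2 / c + C₁ + C₂ + c / 3 * s ^ 2), Real.exp_pos _, fun r _ hsr => ?_⟩
  rw [← Real.exp_add, Real.exp_le_exp]
  have e1 := h₁ (s + r) hsr
  have e2 := h₂ (s + r) hsr
  have e3 : L * r ≤ c / 12 * r ^ 2 + 3 * L ^ 2 / c := by
    have : 0 ≤ (c * r - 6 * L) ^ 2 / (12 * c) := by positivity
    have e : (c * r - 6 * L) ^ 2 / (12 * c) = c / 12 * r ^ 2 + 3 * L ^ 2 / c - L * r := by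
      field_simp; ring
    linarith
  have e4 : (s + r) ^ 2 ≤ 2 * s ^ 2 + 2 * r ^ 2 := by nlinarith [sq_nonneg (s - r)]
  have e5 : c / 12 * (s + r) ^ 2 ≤ c / 12 * (2 * s ^ 2 + 2 * r ^ 2) :=
    mul_le_mul_of_nonneg_left e4 hc12.le
  have := mul_nonneg hc.le (sq_nonneg r)
  nlinarith

end Elementary

/-! ### Geometry of the double sector -/

section Sector

/-- The right half of the double sector. -/
def sectorCone (α : ℝ) : Set ℂ :=
  {z | z ≠ 0 ∧ 0 ≤ z.im ∧ z.im * Real.cos α ≤ z.re * Real.sin α}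

/-- The open right half of the double sector. -/
def openSectorCone (α : ℝ) : Set ℂ :=
  {z | 0 < z.im ∧ z.im * Real.cos α < z.re * Real.sin α}

variable {α : ℝ} {z : ℂ}

/-- The second inequality of the cone says `sin (arg z - α) ≤ 0`, which together with `0 ≤ arg z ≤
π` forces `arg z ≤ α`. Negation adds `π` to the argument, so the other half of the double sector is
handled by reflection. -/
theorem mem_doubleSector_of_mem_sectorCone (hα : α ∈ Ioo 0 (Real.pi / 2))
    (hz : z ∈ sectorCone α) : z ∈ doubleSector α ∧ -z ∈ doubleSector α := by
  obtain ⟨hz0, him, hre⟩ := hz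
  have hn : 0 < ‖z‖ := norm_pos_iff.2 hz0
  have hsin := Real.sin_pos_of_pos_of_lt_pi hα.1 (by linarith [hα.2, Real.pi_pos])
  have harg0 : 0 ≤ z.arg := Complex.arg_nonneg_iff.2 him
  have hargpi := Complex.arg_le_pi z
  have harg : z.arg ≤ α := by
    by_contra hlt
    push Not at hlt
    have h1 : 0 < Real.sin (z.arg - α) :=
      Real.sin_pos_of_pos_of_lt_pi (by linarith) (by linarith [hα.1])
    rw [Real.sin_sub, Complex.sin_arg, Complex.cos_arg hz0] at h1
    have h2 : z.im / ‖z‖ * Real.cos α - z.re / ‖z‖ * Real.sin α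
        = (z.im * Real.cos α - z.re * Real.sin α) / ‖z‖ := by ring
    rw [h2, div_pos_iff_of_pos_right hn] at h1
    linarith
  have hpol : z = (‖z‖ : ℂ) * Complex.exp ((z.arg : ℂ) * Complex.I) :=
    (Complex.norm_mul_exp_arg_mul_I z).symm
  refine ⟨⟨hz0, z.arg, Or.inl ⟨harg0, harg⟩, hpol⟩, neg_ne_zero.2 hz0, Real.pi + z.arg,
    Or.inr ⟨by linarith, by linarith⟩, ?_⟩
  push_cast
  rw [norm_neg, add_mul, Complex.exp_add, Complex.exp_pi_mul_I]
  linear_combination -hpol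

theorem openSectorCone_subset : openSectorCone α ⊆ sectorCone α := fun z hz =>
  ⟨fun h => by simp [h, openSectorCone] at hz, hz.1.le, hz.2.le⟩

theorem isOpen_openSectorCone : IsOpen (openSectorCone α) :=
  (isOpen_lt continuous_const Complex.continuous_im).inter
    (isOpen_lt (Complex.continuous_im.mul continuous_const) (Complex.continuous_re.mul continuous_const))

theorem mem_interior_of_mem_openSectorCone (hα : α ∈ Ioo 0 (Real.pi / 2))
    (hz : z ∈ openSectorCone α) :
    z ∈ interior (doubleSector α) ∧ -z ∈ interior (doubleSector α) := by
  constructor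
  · exact mem_interior.2 ⟨_, fun w hw => (mem_doubleSector_of_mem_sectorCone hα
      (openSectorCone_subset hw)).1, isOpen_openSectorCone, hz⟩
  · refine mem_interior.2 ⟨-openSectorCone α, fun w hw => ?_, isOpen_openSectorCone.neg, by simpa⟩
    have := (mem_doubleSector_of_mem_sectorCone hα (openSectorCone_subset hw)).2
    simpa using this

theorem ray_re (s r θ : ℝ) :
    ((s : ℂ) + r * Complex.exp (θ * Complex.I)).re = s + r * Real.cos θ := by
  simp [Complex.exp_re, Complex.exp_im]

theorem ray_im (s r θ : ℝ) :
    ((s : ℂ) + r * Complex.exp (θ * Complex.I)).im = r * Real.sin θ := by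
  simp [Complex.exp_re, Complex.exp_im]

/-- The slack in the cone inequality is `r sin (α - θ) + s sin α`, which is why translating a ray to
the right keeps it in the cone. -/
theorem ray_mem_sectorCone (hα : α ∈ Ioo 0 (Real.pi / 2)) {s r θ : ℝ} (hs : 0 ≤ s) (hr : 0 ≤ r)
    (hsr : 0 < s ∨ 0 < r) (hθ : θ ∈ Icc 0 α) :
    (s : ℂ) + r * Complex.exp (θ * Complex.I) ∈ sectorCone α := by
  have hcos : 0 < Real.cos θ := Real.cos_pos_of_mem_Ioo
    ⟨by linarith [hθ.1, Real.pi_pos], by linarith [hθ.2, hα.2]⟩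
  have hsin : 0 ≤ Real.sin θ := Real.sin_nonneg_of_nonneg_of_le_pi hθ.1
    (by linarith [hθ.2, hα.2, Real.pi_pos])
  have hsinα := Real.sin_pos_of_pos_of_lt_pi hα.1 (by linarith [hα.2, Real.pi_pos])
  have hsub : 0 ≤ Real.sin (α - θ) := Real.sin_nonneg_of_nonneg_of_le_pi (by linarith [hθ.2])
    (by linarith [hθ.1, hα.2, Real.pi_pos])
  rw [Real.sin_sub] at hsub
  refine ⟨fun h => ?_, ?_, ?_⟩
  · have := congrArg Complex.re h
    rw [ray_re, Complex.zero_re] at this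
    rcases hsr with h' | h'
    · nlinarith [mul_nonneg hr hcos.le]
    · nlinarith [mul_pos h' hcos]
  · rw [ray_im]; positivity
  · rw [ray_im, ray_re]
    nlinarith [mul_nonneg hr hsub, mul_nonneg hs hsinα.le]

theorem ray_mem_openSectorCone (hα : α ∈ Ioo 0 (Real.pi / 2)) {s r θ : ℝ} (hs : 0 ≤ s)
    (hr : 0 < r) (hθ : θ ∈ Ioo 0 α) :
    (s : ℂ) + r * Complex.exp (θ * Complex.I) ∈ openSectorCone α := by
  have hsin : 0 < Real.sin θ := Real.sin_pos_of_pos_of_lt_pi hθ.1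
    (by linarith [hθ.2, hα.2, Real.pi_pos])
  have hsinα := Real.sin_pos_of_pos_of_lt_pi hα.1 (by linarith [hα.2, Real.pi_pos])
  have hsub : 0 < Real.sin (α - θ) := Real.sin_pos_of_pos_of_lt_pi (by linarith [hθ.2])
    (by linarith [hθ.1, hα.2, Real.pi_pos])
  rw [Real.sin_sub] at hsub
  constructor
  · rw [ray_im]; positivity
  · rw [ray_im, ray_re]
    nlinarith [mul_pos hr hsub, mul_nonneg hs hsinα.le]

end Sector

/-! ### Rotation of a half-line by Cauchy's theorem -/

section Rotation

theorem integrableOn_Ioi_of_gaussian_bound {g : ℝ → ℂ} (hg : ContinuousOn g (Ioi 0)) {C c : ℝ}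
    (hc : 0 < c) (hb : ∀ r : ℝ, 0 < r → ‖g r‖ ≤ C * Real.exp (-c * r ^ 2)) :
    IntegrableOn g (Ioi 0) := by
  refine Integrable.mono' ((integrable_exp_neg_mul_sq hc).const_mul C).integrableOn
    (hg.aestronglyMeasurable measurableSet_Ioi) ?_
  exact (ae_restrict_iff' measurableSet_Ioi).2 (Eventually.of_forall fun r hr => hb r hr)

theorem range_exp_eq_Ioi : Real.exp '' univ = Ioi 0 := by
  rw [image_univ, Real.range_exp]

/-- The substitution `r = e^u` maps the half-line onto the whole line, where symmetric intervals
exhaust the integral. -/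
theorem tendsto_intervalIntegral_exp {g : ℝ → ℂ} (hg : IntegrableOn g (Ioi 0)) :
    Tendsto (fun n : ℕ => ∫ u in (-n : ℝ)..n, Real.exp u • g (Real.exp u)) atTop
      (𝓝 (∫ r in Ioi 0, g r)) := by
  have hInt : Integrable (fun u : ℝ => Real.exp u • g (Real.exp u)) := by
    rw [← integrableOn_univ]
    have := (integrableOn_image_iff_integrableOn_abs_deriv_smul MeasurableSet.univ
      (fun x _ => (Real.hasDerivAt_exp x).hasDerivWithinAt) Real.exp_injective.injOn g).1
      (range_exp_eq_Ioi ▸ hg)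
    simpa [abs_of_pos (Real.exp_pos _)] using this
  have heq : ∫ r in Ioi 0, g r = ∫ u : ℝ, Real.exp u • g (Real.exp u) := by
    have := integral_image_eq_integral_abs_deriv_smul MeasurableSet.univ
      (fun x _ => (Real.hasDerivAt_exp x).hasDerivWithinAt) Real.exp_injective.injOn g
    rw [range_exp_eq_Ioi] at this
    rw [this]
    simp [abs_of_pos (Real.exp_pos _)]
  rw [heq]
  exact intervalIntegral_tendsto_integral hInt
    (tendsto_neg_atTop_atBot.comp tendsto_natCast_atTop_atTop) tendsto_natCast_atTop_atTop

/-- Rotation of the half-line of integration by an angle `β`, for a function with Gaussian decay in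
the sector. -/
theorem integral_Ioi_eq_integral_rotated {h : ℂ → ℂ} {β : ℝ} (hβ : 0 < β)
    (hcont : ContinuousOn h {z | ∃ r : ℝ, 0 < r ∧ ∃ θ ∈ Icc 0 β,
      z = r * Complex.exp (θ * Complex.I)})
    (hdiff : ∀ r : ℝ, 0 < r → ∀ θ ∈ Ioo 0 β,
      DifferentiableAt ℂ h (r * Complex.exp (θ * Complex.I)))
    {C c : ℝ} (hc : 0 < c) (hb : ∀ r : ℝ, 0 < r → ∀ θ ∈ Icc 0 β,
      ‖h (r * Complex.exp (θ * Complex.I))‖ ≤ C * Real.exp (-c * r ^ 2)) :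
    ∫ r in Ioi (0 : ℝ), h r
      = ∫ r in Ioi (0 : ℝ), Complex.exp (β * Complex.I) * h (r * Complex.exp (β * Complex.I)) := by
  have hC : 0 ≤ C := by
    have := (norm_nonneg _).trans (hb 1 one_pos 0 ⟨le_rfl, hβ.le⟩)
    exact nonneg_of_mul_nonneg_left this (Real.exp_pos _)
  let g : ℝ → ℝ → ℂ := fun θ r =>
    Complex.exp (θ * Complex.I) * h (r * Complex.exp (θ * Complex.I))
  have hgint : ∀ θ ∈ Icc 0 β, IntegrableOn (g θ) (Ioi 0) := fun θ hθ => by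
    refine integrableOn_Ioi_of_gaussian_bound (C := C) ?_ hc fun r hr => ?_
    · refine continuousOn_const.mul (hcont.comp (by fun_prop) fun r hr => ⟨r, hr, θ, hθ, rfl⟩)
    · rw [norm_mul, Complex.norm_exp_ofReal_mul_I, one_mul]
      exact hb r hr θ hθ
  -- In logarithmic coordinates `w = u + iθ` the sector becomes the strip `0 ≤ Im w ≤ β`. Cauchy's
  -- theorem on the rectangles `[-n, n] × [0, β]` then avoids the vertex, where `h` need not be
  -- defined meaningfully.
  let H : ℂ → ℂ := fun w => Complex.exp w * h (Complex.exp w)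
  have hexp : ∀ u θ : ℝ, Complex.exp (u + θ * Complex.I)
      = (Real.exp u : ℂ) * Complex.exp (θ * Complex.I) := fun u θ => by
    rw [Complex.exp_add, Complex.ofReal_exp]
  have hH : ∀ u θ : ℝ, H (u + θ * Complex.I) = Real.exp u • g θ (Real.exp u) := fun u θ => by
    simp only [H, g, hexp, Complex.real_smul]
    ring
  have hexp' : ∀ w : ℂ, Complex.exp w
      = (Real.exp w.re : ℂ) * Complex.exp (w.im * Complex.I) := fun w => by
    rw [← hexp, Complex.re_add_im]
  have hrect : ∀ n : ℕ, (∫ u in (-n : ℝ)..n, Real.exp u • g 0 (Real.exp u))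
      - (∫ u in (-n : ℝ)..n, Real.exp u • g β (Real.exp u))
      + Complex.I • (∫ θ in (0 : ℝ)..β, H ((n : ℝ) + θ * Complex.I))
      - Complex.I • (∫ θ in (0 : ℝ)..β, H ((-n : ℝ) + θ * Complex.I)) = 0 := by
    intro n
    have := Complex.integral_boundary_rect_eq_zero_of_continuousOn_of_differentiableOn H
      (⟨-n, 0⟩ : ℂ) ⟨n, β⟩ ?_ ?_
    · simpa only [hH] using this
    · refine Complex.continuous_exp.continuousOn.mul
        (hcont.comp Complex.continuous_exp.continuousOn fun w hw => ?_)
      rw [Complex.mem_reProdIm] at hw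
      refine ⟨Real.exp w.re, Real.exp_pos _, w.im, ?_, hexp' w⟩
      simpa [uIcc_of_le hβ.le] using hw.2
    · intro w hw
      rw [Complex.mem_reProdIm] at hw
      have him : w.im ∈ Ioo 0 β := by simpa [min_eq_left hβ.le, max_eq_right hβ.le] using hw.2
      have h1 := hdiff (Real.exp w.re) (Real.exp_pos _) w.im him
      rw [← hexp' w] at h1
      exact (Complex.differentiableAt_exp.mul
        (h1.comp w Complex.differentiableAt_exp)).differentiableWithinAt
  have hside : ∀ u : ℝ, ‖∫ θ in (0 : ℝ)..β, H (u + θ * Complex.I)‖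
      ≤ Real.exp u * (C * Real.exp (-c * Real.exp u ^ 2)) * β := by
    intro u
    have := intervalIntegral.norm_integral_le_of_norm_le_const (a := 0) (b := β)
      (f := fun θ : ℝ => H (u + θ * Complex.I))
      (C := Real.exp u * (C * Real.exp (-c * Real.exp u ^ 2))) fun θ hθ => by
        rw [uIoc_of_le hβ.le] at hθ
        rw [hH, norm_smul, Real.norm_of_nonneg (Real.exp_pos _).le, norm_mul,
          Complex.norm_exp_ofReal_mul_I, one_mul]
        exact mul_le_mul_of_nonneg_left (hb _ (Real.exp_pos _) θ (Ioc_subset_Icc_self hθ))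
          (Real.exp_pos _).le
    rwa [sub_zero, abs_of_pos hβ] at this
  -- From `exp(-c x^2) ≤ 1 / (c x^2)`: with `x = e^n` the right side of the rectangle is
  -- `O(e^{-n})`. On the left side the Jacobian `e^{-n}` alone suffices, as `h` is bounded by `C`.
  have hsmall : ∀ x : ℝ, 0 < x → x * (C * Real.exp (-c * x ^ 2)) * β ≤ C * β / c * x⁻¹ := by
    intro x hx
    have h1 : Real.exp (-c * x ^ 2) ≤ (c * x ^ 2)⁻¹ := by
      rw [neg_mul, Real.exp_neg]
      exact inv_anti₀ (by positivity) ((le_add_of_nonneg_right zero_le_one).trans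
        (Real.add_one_le_exp _))
    calc x * (C * Real.exp (-c * x ^ 2)) * β ≤ x * (C * (c * x ^ 2)⁻¹) * β := by gcongr
      _ = C * β / c * x⁻¹ := by field_simp
  have hright : Tendsto (fun n : ℕ => ∫ θ in (0 : ℝ)..β, H ((n : ℝ) + θ * Complex.I)) atTop
      (𝓝 0) := by
    refine squeeze_zero_norm (fun n => (hside n).trans (hsmall _ (Real.exp_pos _))) ?_
    have : Tendsto (fun n : ℕ => (Real.exp (n : ℝ))⁻¹) atTop (𝓝 0) :=
      tendsto_inv_atTop_zero.comp (Real.tendsto_exp_atTop.comp tendsto_natCast_atTop_atTop)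
    simpa using this.const_mul (C * β / c)
  have hleft : Tendsto (fun n : ℕ => ∫ θ in (0 : ℝ)..β, H ((-n : ℝ) + θ * Complex.I)) atTop
      (𝓝 0) := by
    refine squeeze_zero_norm (a := fun n : ℕ => Real.exp (-n : ℝ) * C * β) (fun n => ?_) ?_
    · have := hside (-n)
      push_cast at this ⊢
      refine this.trans ?_
      have h1 : Real.exp (-c * Real.exp (-n) ^ 2) ≤ 1 := by
        rw [Real.exp_le_one_iff, neg_mul, neg_nonpos]; positivity
      have : C * Real.exp (-c * Real.exp (-n) ^ 2) ≤ C := mul_le_of_le_one_right hC h1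
      gcongr
    · have : Tendsto (fun n : ℕ => Real.exp (-n : ℝ)) atTop (𝓝 0) :=
        Real.tendsto_exp_neg_atTop_nhds_zero.comp tendsto_natCast_atTop_atTop
      simpa using (this.mul_const C).mul_const β
  have hlim := (((tendsto_intervalIntegral_exp (hgint 0 ⟨le_rfl, hβ.le⟩)).sub
    (tendsto_intervalIntegral_exp (hgint β ⟨hβ.le, le_rfl⟩))).add
    (hright.const_smul Complex.I)).sub (hleft.const_smul Complex.I)
  have h0 := tendsto_nhds_unique hlim ((tendsto_const_nhds (x := (0 : ℂ))).congr
    fun n => (hrect n).symm)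
  rw [smul_zero, add_zero, sub_zero, sub_eq_zero] at h0
  simpa [g] using h0

end Rotation

/-! ### Regularised integrals over rays in the sector -/

section Ray

/-- A function that is continuous on the closed and holomorphic on the open right half of the double
sector, and is bounded there by a Gaussian factor centred at `ξ` and exponentials of order `p`
and `q`. -/
structure SectorGaussian (α : ℝ) (f : ℂ → ℂ) (a ξ A B p B' q : ℝ) : Prop where
  cont : ContinuousOn f (sectorCone α)
  diff : DifferentiableOn ℂ f (openSectorCone α)
  bound : ∀ z ∈ sectorCone α, ‖f z‖ ≤ A * Real.exp (-a * ((z - ξ) ^ 2).im + B * ‖z‖ ^ p + B' * ‖z‖ ^ q)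

theorem norm_exp_neg_mul_sq (ε : ℝ) (z : ℂ) :
    ‖Complex.exp (-(ε : ℂ) * z ^ 2)‖ = Real.exp (-ε * (z ^ 2).re) := by
  rw [Complex.norm_exp]
  congr 1
  simp [Complex.mul_re]

theorem norm_exp_I_mul_sq (a : ℝ) (w : ℂ) :
    ‖Complex.exp (Complex.I * (a : ℂ) * w ^ 2)‖ = Real.exp (-a * (w ^ 2).im) := by
  rw [Complex.norm_exp]
  congr 1
  simp [Complex.mul_re, Complex.mul_im]

theorem sq_ray_re (s r θ : ℝ) : (((s : ℂ) + r * Complex.exp (θ * Complex.I)) ^ 2).re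
    = s ^ 2 + 2 * s * r * Real.cos θ + r ^ 2 * Real.cos (2 * θ) := by
  rw [sq, Complex.mul_re, ray_re, ray_im, Real.cos_two_mul]
  nlinarith [Real.sin_sq_add_cos_sq θ]

theorem sq_ray_sub_im (s r θ ξ : ℝ) : (((s : ℂ) + r * Complex.exp (θ * Complex.I) - ξ) ^ 2).im
    = 2 * (s - ξ) * r * Real.sin θ + r ^ 2 * Real.sin (2 * θ) := by
  have : (s : ℂ) + r * Complex.exp (θ * Complex.I) - ξ
      = ((s - ξ : ℝ) : ℂ) + r * Complex.exp (θ * Complex.I) := by push_cast; ring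
  rw [this, sq, Complex.mul_im, ray_re, ray_im, Real.sin_two_mul]
  ring

theorem norm_ray_le {s r θ : ℝ} (hs : 0 ≤ s) (hr : 0 ≤ r) :
    ‖(s : ℂ) + r * Complex.exp (θ * Complex.I)‖ ≤ s + r := by
  refine (norm_add_le _ _).trans ?_
  rw [norm_mul, Complex.norm_exp_ofReal_mul_I, mul_one, Complex.norm_real, Complex.norm_real,
    Real.norm_of_nonneg hs, Real.norm_of_nonneg hr]

variable {α a ξ A B p B' q : ℝ} {f : ℂ → ℂ}

/-- Expanding the squares along `s + r e^{iθ}` gives the quadratic rate `ε cos 2θ + a sin 2θ`. The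
remaining terms from `ε` have a favourable sign and are dropped; the cross term of the phase is at
most `2 a |s - ξ| r`. -/
theorem SectorGaussian.norm_le (hf : SectorGaussian α f a ξ A B p B' q)
    (hα : α ∈ Ioo 0 (Real.pi / 2)) (ha : 0 ≤ a) (hB : 0 ≤ B) (hB' : 0 ≤ B') (hA : 0 ≤ A)
    (hp : 0 ≤ p) (hq : 0 ≤ q)
    {s r θ ε c : ℝ} (hs : 0 ≤ s) (hr : 0 < r) (hθ : θ ∈ Icc 0 (α / 2)) (hε : 0 ≤ ε)
    (hc : c ≤ ε * Real.cos (2 * θ) + a * Real.sin (2 * θ)) :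
    ‖Complex.exp (-(ε : ℂ) * ((s : ℂ) + r * Complex.exp (θ * Complex.I)) ^ 2)
      * f ((s : ℂ) + r * Complex.exp (θ * Complex.I))‖
      ≤ A * Real.exp (-c * r ^ 2 + 2 * a * |s - ξ| * r + B * (s + r) ^ p + B' * (s + r) ^ q) := by
  have hz := ray_mem_sectorCone hα hs hr.le (Or.inr hr) ⟨hθ.1, by linarith [hθ.2, hα.1]⟩
  have hcos : 0 ≤ Real.cos θ := Real.cos_nonneg_of_mem_Icc
    ⟨by linarith [hθ.1, Real.pi_pos], by linarith [hθ.2, hα.1, hα.2]⟩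
  rw [norm_mul, norm_exp_neg_mul_sq, sq_ray_re]
  refine (mul_le_mul_of_nonneg_left (hf.bound _ hz) (Real.exp_pos _).le).trans ?_
  rw [mul_left_comm, ← Real.exp_add]
  refine mul_le_mul_of_nonneg_left (Real.exp_le_exp.2 ?_) hA
  rw [sq_ray_sub_im]
  have hn := norm_ray_le (θ := θ) hs hr.le
  have h1 : B * ‖(s : ℂ) + r * Complex.exp (θ * Complex.I)‖ ^ p ≤ B * (s + r) ^ p :=
    mul_le_mul_of_nonneg_left (Real.rpow_le_rpow (norm_nonneg _) hn hp) hB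
  have h2 : B' * ‖(s : ℂ) + r * Complex.exp (θ * Complex.I)‖ ^ q ≤ B' * (s + r) ^ q :=
    mul_le_mul_of_nonneg_left (Real.rpow_le_rpow (norm_nonneg _) hn hq) hB'
  have h3 : 0 ≤ ε * (s ^ 2 + 2 * s * r * Real.cos θ) := by positivity
  have h4 : -(2 * a * |s - ξ| * r) ≤ a * (2 * (s - ξ) * r * Real.sin θ) := by
    have e1 : |(s - ξ) * Real.sin θ| ≤ |s - ξ| := by
      rw [abs_mul]; exact mul_le_of_le_one_right (abs_nonneg _) (Real.abs_sin_le_one _)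
    have e2 := neg_abs_le ((s - ξ) * Real.sin θ)
    have e3 : 0 ≤ 2 * a * r := by positivity
    nlinarith [mul_le_mul_of_nonneg_left (e2.trans' (neg_le_neg e1)) e3]
  have h5 : c * r ^ 2 ≤ (ε * Real.cos (2 * θ) + a * Real.sin (2 * θ)) * r ^ 2 :=
    mul_le_mul_of_nonneg_right hc (sq_nonneg _)
  nlinarith

/-- The integral over a real half-line with Gaussian regularisation equals the integral over the
half-line rotated by half the opening angle of the sector. -/
theorem SectorGaussian.integral_eq (hf : SectorGaussian α f a ξ A B p B' q)
    (hα : α ∈ Ioo 0 (Real.pi / 2)) (ha : 0 ≤ a) (hB : 0 ≤ B) (hB' : 0 ≤ B') (hA : 0 ≤ A)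
    (hp : p ∈ Ioo (0 : ℝ) 2) (hq : q ∈ Ioo (0 : ℝ) 2) {s ε : ℝ} (hs : 0 ≤ s) (hε : 0 < ε) :
    ∫ r in Ioi (0 : ℝ), Complex.exp (-(ε : ℂ) * ((s : ℂ) + r) ^ 2) * f ((s : ℂ) + r)
      = ∫ r in Ioi (0 : ℝ), Complex.exp ((α / 2 : ℝ) * Complex.I) *
        (Complex.exp (-(ε : ℂ) * ((s : ℂ) + r * Complex.exp ((α / 2 : ℝ) * Complex.I)) ^ 2)
          * f ((s : ℂ) + r * Complex.exp ((α / 2 : ℝ) * Complex.I))) := by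
  have hcosα : 0 < Real.cos α := Real.cos_pos_of_mem_Ioo
    ⟨by linarith [hα.1, Real.pi_pos], hα.2⟩
  -- This rate serves all angles `θ ∈ [0, α/2]` at once, since `cos 2θ ≥ cos α > 0`. At `θ = 0` only
  -- the regularisation provides decay, hence the factor `ε`.
  have hc : 0 < ε * Real.cos α := by positivity
  obtain ⟨C, hC, hbd⟩ := exists_exp_le_gaussian (L := 2 * a * |s - ξ|) (s := s) hp hq hc hB hB'
  refine integral_Ioi_eq_integral_rotated (h := fun w => Complex.exp (-(ε : ℂ) * ((s : ℂ) + w) ^ 2)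
    * f ((s : ℂ) + w)) (C := A * C) (half_pos hα.1) ?_ ?_ (half_pos hc) ?_
  · refine ContinuousOn.mul (by fun_prop) (hf.cont.comp (by fun_prop) ?_)
    rintro _ ⟨r, hr, θ, hθ, rfl⟩
    exact ray_mem_sectorCone hα hs hr.le (Or.inr hr) ⟨hθ.1, by linarith [hθ.2, hα.1]⟩
  · intro r hr θ hθ
    have hz := ray_mem_openSectorCone hα hs hr (θ := θ) ⟨hθ.1, by linarith [hθ.2, hα.1]⟩
    have h1 := hf.diff.differentiableAt (isOpen_openSectorCone.mem_nhds hz)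
    refine DifferentiableAt.mul (by fun_prop) ?_
    exact h1.comp ((r : ℂ) * Complex.exp (θ * Complex.I)) (by fun_prop)
  · intro r hr θ hθ
    have hcos : Real.cos α ≤ Real.cos (2 * θ) := Real.cos_le_cos_of_nonneg_of_le_pi
      (by linarith [hθ.1]) (by linarith [hα.2, Real.pi_pos]) (by linarith [hθ.2])
    have hsin : 0 ≤ Real.sin (2 * θ) := Real.sin_nonneg_of_nonneg_of_le_pi (by linarith [hθ.1])
      (by linarith [hα.2, Real.pi_pos, hθ.2])
    have hle : ε * Real.cos α ≤ ε * Real.cos (2 * θ) + a * Real.sin (2 * θ) := by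
      nlinarith [mul_nonneg ha hsin, mul_le_mul_of_nonneg_left hcos hε.le]
    refine (hf.norm_le hα ha hB hB' hA hp.1.le hq.1.le hs hr hθ hε.le hle).trans ?_
    rw [mul_assoc A C]
    exact mul_le_mul_of_nonneg_left (hbd r hr.le (by positivity)) hA

/-- After rotation by `α/2` the phase alone decays at rate `a sin α`, independently of `ε`, so
dominated convergence applies on the rotated ray although it might fail on the real one. -/
theorem SectorGaussian.tendsto_integral (hf : SectorGaussian α f a ξ A B p B' q)
    (hα : α ∈ Ioo 0 (Real.pi / 2)) (ha : 0 < a) (hB : 0 ≤ B) (hB' : 0 ≤ B') (hA : 0 ≤ A)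
    (hp : p ∈ Ioo (0 : ℝ) 2) (hq : q ∈ Ioo (0 : ℝ) 2) {s : ℝ} (hs : 0 ≤ s) :
    Tendsto (fun ε : ℝ => ∫ r in Ioi (0 : ℝ),
        Complex.exp (-(ε : ℂ) * ((s : ℂ) + r) ^ 2) * f ((s : ℂ) + r)) (𝓝[>] 0)
      (𝓝 (∫ r in Ioi (0 : ℝ), Complex.exp ((α / 2 : ℝ) * Complex.I) *
          f ((s : ℂ) + r * Complex.exp ((α / 2 : ℝ) * Complex.I)))) := by
  have hsinα := Real.sin_pos_of_pos_of_lt_pi hα.1 (by linarith [hα.2, Real.pi_pos])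
  have hcosα : 0 < Real.cos α := Real.cos_pos_of_mem_Ioo
    ⟨by linarith [hα.1, Real.pi_pos], hα.2⟩
  have hc : 0 < a * Real.sin α := by positivity
  have hθ : α / 2 ∈ Icc 0 (α / 2) := ⟨(half_pos hα.1).le, le_rfl⟩
  obtain ⟨C, hC, hbd⟩ := exists_exp_le_gaussian (L := 2 * a * |s - ξ|) (s := s) hp hq hc hB hB'
  have hev : ∀ᶠ ε : ℝ in 𝓝[>] 0, 0 < ε := self_mem_nhdsWithin
  refine (tendsto_congr' (hev.mono fun ε hε =>
    hf.integral_eq hα ha.le hB hB' hA hp hq hs hε)).2 ?_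
  have hfc : ContinuousOn (fun r : ℝ => f ((s : ℂ) + r * Complex.exp ((α / 2 : ℝ) * Complex.I)))
      (Ioi 0) := hf.cont.comp (by fun_prop) fun r hr =>
    ray_mem_sectorCone hα hs (le_of_lt hr) (Or.inr hr) ⟨hθ.1, by linarith [hθ.2, hα.1]⟩
  refine tendsto_integral_filter_of_dominated_convergence
    (fun r => A * (C * Real.exp (-(a * Real.sin α / 2) * r ^ 2))) ?_ ?_ ?_ ?_
  · refine Eventually.of_forall fun ε => ContinuousOn.aestronglyMeasurable ?_ measurableSet_Ioi
    exact continuousOn_const.mul (ContinuousOn.mul (by fun_prop) hfc)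
  · filter_upwards [hev] with ε hε
    refine (ae_restrict_iff' measurableSet_Ioi).2 (Eventually.of_forall fun r hr => ?_)
    have hle : a * Real.sin α ≤ ε * Real.cos (2 * (α / 2)) + a * Real.sin (2 * (α / 2)) := by
      rw [mul_div_cancel₀ _ two_ne_zero]
      nlinarith [mul_pos hε hcosα]
    rw [norm_mul, Complex.norm_exp_ofReal_mul_I, one_mul]
    refine (hf.norm_le hα ha.le hB hB' hA hp.1.le hq.1.le hs hr hθ hε.le hle).trans ?_
    exact mul_le_mul_of_nonneg_left (hbd r (le_of_lt hr) (add_nonneg hs (le_of_lt hr))) hA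
  · exact (((integrable_exp_neg_mul_sq (half_pos hc)).const_mul C).const_mul A).integrableOn
  · refine Eventually.of_forall fun r => ?_
    have h1 : Tendsto (fun ε : ℝ => Complex.exp (-(ε : ℂ) *
        ((s : ℂ) + r * Complex.exp ((α / 2 : ℝ) * Complex.I)) ^ 2)) (𝓝[>] 0) (𝓝 1) := by
      have : Continuous fun ε : ℝ => Complex.exp (-(ε : ℂ) *
        ((s : ℂ) + r * Complex.exp ((α / 2 : ℝ) * Complex.I)) ^ 2) := by fun_prop
      simpa using (this.tendsto 0).mono_left nhdsWithin_le_nhds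
    simpa using (h1.mul_const (f ((s : ℂ) + r * Complex.exp ((α / 2 : ℝ) * Complex.I)))).const_mul
      (Complex.exp ((α / 2 : ℝ) * Complex.I))

end Ray

/-! ### The time interval and the punctured line -/

theorem isOpen_timeInterval (T : EReal) : IsOpen (timeInterval T) :=
  (isOpen_lt continuous_const continuous_id).inter
    (isOpen_lt continuous_coe_real_ereal continuous_const)

theorem ordConnected_timeInterval (T : EReal) : (timeInterval T).OrdConnected :=
  ⟨fun _ hs _ ht _ hr => ⟨hs.1.trans_le hr.1, lt_of_le_of_lt (EReal.coe_le_coe_iff.2 hr.2) ht.2⟩⟩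

theorem isOpen_dotReal : IsOpen dotReal := isOpen_compl_singleton

theorem IsACDot.continuousOn {f : ℝ → ℂ} (h : IsACDot f) : ContinuousOn f dotReal := by
  intro x hx
  rcases lt_or_gt_of_ne (show x ≠ 0 from hx) with h' | h'
  · exact ((h.1.continuousOn isOpen_Iio ordConnected_Iio).continuousAt
      (isOpen_Iio.mem_nhds h')).continuousWithinAt
  · exact ((h.2.continuousOn isOpen_Ioi ordConnected_Ioi).continuousAt
      (isOpen_Ioi.mem_nhds h')).continuousWithinAt

theorem IsACDot.ae_differentiableAt {f : ℝ → ℂ} (h : IsACDot f) :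
    ∀ᵐ x : ℝ, x ∈ dotReal → DifferentiableAt ℝ f x := by
  filter_upwards [h.1.ae_differentiableAt isOpen_Iio ordConnected_Iio,
    h.2.ae_differentiableAt isOpen_Ioi ordConnected_Ioi] with x h1 h2 hx
  rcases lt_or_gt_of_ne (show x ≠ 0 from hx) with h' | h'
  exacts [h1 h', h2 h']

/-! ### The integrand on a rotated line -/

section Kernel

/-- The point with parameter `y` on the line through the origin with angle `θ`. -/
noncomputable def contour (θ y : ℝ) : ℂ := y * Complex.exp (θ * Complex.I)

/-- The factor `e^{iθ} e^{-ε z²} F(z)`, `z = y e^{iθ}`, of the rotated integrand. -/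
noncomputable def weight (F : ℂ → ℂ) (ε θ y : ℝ) : ℂ :=
  -- The origin is not in the double sector, so nothing is known about the Green's function there.
  -- The value `0` makes the integrand vanish at `y = 0`, and measurability, regularity and bounds
  -- then hold for every `y`.
  if y = 0 then 0 else Complex.exp (θ * Complex.I) *
    (Complex.exp (-(ε : ℂ) * contour θ y ^ 2) * F (contour θ y))

/-- The integrand on the line with angle `θ` with Gaussian regularisation. -/
noncomputable def kern (Gext : ℝ → ℝ → ℂ → ℂ) (F : ℂ → ℂ) (ε θ t x y : ℝ) : ℂ :=
  weight F ε θ y * Gext t x (contour θ y)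

theorem norm_contour (θ y : ℝ) : ‖contour θ y‖ = |y| := by
  rw [contour, norm_mul, Complex.norm_exp_ofReal_mul_I, mul_one, Complex.norm_real, Real.norm_eq_abs]

theorem contour_neg (θ y : ℝ) : contour θ (-y) = -contour θ y := by
  simp [contour]

theorem continuous_contour (θ : ℝ) : Continuous (contour θ) := by
  unfold contour; fun_prop

theorem sq_contour_re (θ y : ℝ) : (contour θ y ^ 2).re = y ^ 2 * Real.cos (2 * θ) := by
  have := sq_ray_re 0 y θ
  simpa [contour] using this

theorem sq_contour_sub_im (θ y x : ℝ) : ((contour θ y - x) ^ 2).im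
    = y ^ 2 * Real.sin (2 * θ) - 2 * x * y * Real.sin θ := by
  have := sq_ray_sub_im 0 y θ x
  rw [Complex.ofReal_zero, zero_add] at this
  rw [contour, this]
  ring

theorem contour_mem_doubleSector {α : ℝ} (hα : α ∈ Ioo 0 (Real.pi / 2)) {θ y : ℝ}
    (hθ : θ ∈ Icc 0 α) (hy : y ≠ 0) : contour θ y ∈ doubleSector α := by
  have key : ∀ r : ℝ, 0 < r → contour θ r ∈ sectorCone α := fun r hr => by
    have := ray_mem_sectorCone hα le_rfl hr.le (Or.inr hr) hθ
    rwa [Complex.ofReal_zero, zero_add] at this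
  rcases lt_or_gt_of_ne hy with h | h
  · have := (mem_doubleSector_of_mem_sectorCone hα (key (-y) (by linarith))).2
    rwa [contour_neg, neg_neg] at this
  · exact (mem_doubleSector_of_mem_sectorCone hα (key y h)).1

theorem norm_contour_sub_le (θ y x : ℝ) : ‖contour θ y - x‖ ≤ |y| + |x| := by
  refine (norm_sub_le _ _).trans ?_
  rw [norm_contour, Complex.norm_real, Real.norm_eq_abs]

theorem continuousOn_weight {F : ℂ → ℂ} (hF : Continuous F) (ε θ : ℝ) :
    ContinuousOn (weight F ε θ) dotReal := by
  have : ContinuousOn (fun y => Complex.exp (θ * Complex.I) *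
      (Complex.exp (-(ε : ℂ) * contour θ y ^ 2) * F (contour θ y))) dotReal := by
    have := continuous_contour θ
    fun_prop
  exact this.congr fun y hy => if_neg hy

/-- The regularisation and the phase combine to the rate `ε cos 2θ + a sin 2θ`, which covers both
uses: `θ = 0` with `ε > 0`, and `θ = α/2` with `ε = 0`. The linear term comes from centring the
phase at `x`. -/
theorem norm_weight_mul_exp_le {F : ℂ → ℂ} {AF BF q : ℝ} (hAF : 0 ≤ AF)
    (hFb : ∀ z, ‖F z‖ ≤ AF * Real.exp (BF * ‖z‖ ^ q)) {ε θ a x y c : ℝ} (ha : 0 ≤ a)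
    (hc : c ≤ ε * Real.cos (2 * θ) + a * Real.sin (2 * θ)) :
    ‖weight F ε θ y‖ * ‖Complex.exp (Complex.I * (a : ℂ) * (contour θ y - x) ^ 2)‖
      ≤ AF * Real.exp (-c * y ^ 2 + 2 * a * |x| * |y| + BF * |y| ^ q) := by
  have hpos := Real.exp_pos (-c * y ^ 2 + 2 * a * |x| * |y| + BF * |y| ^ q)
  by_cases hy : y = 0
  · rw [weight, if_pos hy, norm_zero, zero_mul]
    positivity
  · rw [weight, if_neg hy, norm_mul, norm_mul, Complex.norm_exp_ofReal_mul_I, one_mul,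
      norm_exp_neg_mul_sq, norm_exp_I_mul_sq, sq_contour_re, sq_contour_sub_im]
    have h1 := hFb (contour θ y)
    rw [norm_contour] at h1
    calc _ ≤ Real.exp (-ε * (y ^ 2 * Real.cos (2 * θ))) * (AF * Real.exp (BF * |y| ^ q))
          * Real.exp (-a * (y ^ 2 * Real.sin (2 * θ) - 2 * x * y * Real.sin θ)) := by gcongr
      _ = AF * Real.exp (-ε * (y ^ 2 * Real.cos (2 * θ)) + BF * |y| ^ q +
          -a * (y ^ 2 * Real.sin (2 * θ) - 2 * x * y * Real.sin θ)) := by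
        rw [Real.exp_add, Real.exp_add]; ring
      _ ≤ _ := by
        refine mul_le_mul_of_nonneg_left (Real.exp_le_exp.2 ?_) hAF
        have h2 : x * y * Real.sin θ ≤ |x| * |y| := by
          refine (le_abs_self _).trans ?_
          rw [abs_mul, abs_mul]
          exact mul_le_of_le_one_right (by positivity) (Real.abs_sin_le_one _)
        have h3 := mul_le_mul_of_nonneg_left h2 ha
        have h4 := mul_le_mul_of_nonneg_right hc (sq_nonneg y)
        nlinarith

/-- A common Gaussian bound for the integrand and its derivatives. -/
theorem exists_gaussian_dominating {p q AF BF c X R C₀ B₀ : ℝ} (hp : p ∈ Ioo (0 : ℝ) 2)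
    (hq : q ∈ Ioo (0 : ℝ) 2) (hAF : 0 ≤ AF) (hBF : 0 ≤ BF) (hc : 0 < c) (hX : 0 ≤ X) (hR : 0 ≤ R)
    (hC₀ : 0 ≤ C₀) (hB₀ : 0 ≤ B₀) :
    ∃ C : ℝ, 0 ≤ C ∧ ∀ a x y : ℝ, 0 ≤ a → a ≤ R → |x| ≤ X →
      AF * Real.exp (-c * y ^ 2 + 2 * a * |x| * |y| + BF * |y| ^ q) *
        (((1 + R) * (1 + X) * (1 + |y|)) ^ 2 * (C₀ * Real.exp (B₀ * |y| ^ p)))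
        ≤ C * Real.exp (-(c / 2) * y ^ 2) := by
  -- The summand `2` in `L` pays for the polynomial factor, via `(1 + |y|)^2 ≤ e^{2|y|}`.
  obtain ⟨C, hC, hbd⟩ := exists_exp_le_gaussian (L := 2 * R * X + 2) (s := 0) hp hq hc hB₀ hBF
  refine ⟨AF * C₀ * ((1 + R) * (1 + X)) ^ 2 * C, by positivity, fun a x y ha haR hx => ?_⟩
  have h1 := hbd |y| (abs_nonneg y) (by positivity)
  rw [zero_add, sq_abs] at h1
  have h2 : (1 + |y|) ^ 2 ≤ Real.exp (2 * |y|) := by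
    rw [two_mul, Real.exp_add, ← sq]
    have := Real.add_one_le_exp |y|
    gcongr
    linarith
  have h3 : 2 * a * |x| * |y| ≤ 2 * R * X * |y| := by gcongr
  calc _ ≤ AF * Real.exp (-c * y ^ 2 + 2 * R * X * |y| + BF * |y| ^ q) *
        ((((1 + R) * (1 + X)) ^ 2 * Real.exp (2 * |y|)) * (C₀ * Real.exp (B₀ * |y| ^ p))) := by
        rw [mul_pow ((1 + R) * (1 + X))]; gcongr
    _ = AF * C₀ * ((1 + R) * (1 + X)) ^ 2 *
        Real.exp (-c * y ^ 2 + (2 * R * X + 2) * |y| + B₀ * |y| ^ p + BF * |y| ^ q) := by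
        have : -c * y ^ 2 + (2 * R * X + 2) * |y| + B₀ * |y| ^ p + BF * |y| ^ q
          = (-c * y ^ 2 + 2 * R * X * |y| + BF * |y| ^ q) + 2 * |y| + B₀ * |y| ^ p := by ring
        rw [this, Real.exp_add _ (B₀ * |y| ^ p), Real.exp_add _ (2 * |y|)]
        ring
    _ ≤ _ := by
        rw [mul_assoc _ C]
        exact mul_le_mul_of_nonneg_left h1 (by positivity)

end Kernel

/-! ### Derivatives of the Green's function through its Gaussian factorisation -/

section GreenDerivatives

variable {T : EReal} {V : ℝ → ℝ → ℂ} {M N : Matrix (Fin 2) (Fin 2) ℂ} {G : ℝ → ℝ → ℝ → ℂ}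
  {α : ℝ} {Gext : ℝ → ℝ → ℂ → ℂ} {a : ℝ → ℝ} {Gt : ℝ → ℝ → ℂ → ℂ} {p : ℝ}
  {A B : Fin 3 → ℝ → ℝ → ℝ}

theorem hasDerivAt_exp_phase (c : ℝ) (z : ℂ) (x : ℝ) :
    HasDerivAt (fun ξ : ℝ => Complex.exp (Complex.I * (c : ℂ) * (z - ξ) ^ 2))
      (Complex.exp (Complex.I * (c : ℂ) * (z - x) ^ 2) * (-2 * Complex.I * c * (z - x))) x := by
  have h1 : HasDerivAt (fun ξ : ℝ => z - (ξ : ℂ)) (-1) x := by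
    simpa using (Complex.ofRealCLM.hasDerivAt (x := x)).const_sub z
  have h2 := ((h1.pow 2).const_mul (Complex.I * (c : ℂ))).cexp
  refine h2.congr_deriv ?_
  simp only [Pi.pow_apply]
  push_cast
  ring

theorem exp_neg_phase_mul (c : ℝ) (w : ℂ) :
    Complex.exp (Complex.I * ((-c : ℝ) : ℂ) * w) * Complex.exp (Complex.I * (c : ℂ) * w) = 1 := by
  rw [← Complex.exp_add, Complex.ofReal_neg, mul_neg, neg_mul, neg_add_cancel, Complex.exp_zero]

/-- Regularity is assumed for `G` only; it passes to `G̃` by multiplying with the inverse phase. -/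
theorem GreenAssumption.differentiableAt_factor (hG : GreenAssumption T V M N G α Gext a Gt p A B)
    {t x : ℝ} {z : ℂ} (ht : t ∈ timeInterval T) (hx : x ∈ dotReal) (hz : z ∈ doubleSector α) :
    DifferentiableAt ℝ (fun ξ => Gt t ξ z) x := by
  have h1 := (hG.mem z hz).differentiable t ht x hx
  have h2 := (hasDerivAt_exp_phase (-a t) z x).differentiableAt.mul h1
  refine h2.congr_of_eventuallyEq ?_
  filter_upwards [isOpen_dotReal.mem_nhds hx] with ξ hξ
  rw [Pi.mul_apply, hG.decomposition t ht ξ hξ z hz, ← mul_assoc, exp_neg_phase_mul, one_mul]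

theorem GreenAssumption.deriv_eq (hG : GreenAssumption T V M N G α Gext a Gt p A B)
    {t x : ℝ} {z : ℂ} (ht : t ∈ timeInterval T) (hx : x ∈ dotReal) (hz : z ∈ doubleSector α) :
    deriv (fun ξ => Gext t ξ z) x = Complex.exp (Complex.I * (a t : ℂ) * (z - x) ^ 2) *
      (deriv (fun ξ => Gt t ξ z) x + -2 * Complex.I * a t * (z - x) * Gt t x z) := by
  have h1 := (hasDerivAt_exp_phase (a t) z x).mul
    (hG.differentiableAt_factor ht hx hz).hasDerivAt
  have h2 : (fun ξ => Gext t ξ z) =ᶠ[𝓝 x]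
      (fun ξ : ℝ => Complex.exp (Complex.I * (a t : ℂ) * (z - ξ) ^ 2)) * fun ξ => Gt t ξ z := by
    filter_upwards [isOpen_dotReal.mem_nhds hx] with ξ hξ
    exact hG.decomposition t ht ξ hξ z hz
  rw [h2.deriv_eq, h1.deriv]
  ring

theorem GreenAssumption.deriv_deriv_eq (hG : GreenAssumption T V M N G α Gext a Gt p A B)
    {t x : ℝ} {z : ℂ} (ht : t ∈ timeInterval T) (hx : x ∈ dotReal) (hz : z ∈ doubleSector α)
    (hd : DifferentiableAt ℝ (deriv fun ξ => Gext t ξ z) x) :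
    deriv (deriv fun ξ => Gext t ξ z) x = Complex.exp (Complex.I * (a t : ℂ) * (z - x) ^ 2) *
      (deriv (deriv fun ξ => Gt t ξ z) x
        + 2 * (-2 * Complex.I * a t * (z - x)) * deriv (fun ξ => Gt t ξ z) x
        + (-2 * Complex.I * a t * (z - x)) ^ 2 * Gt t x z + 2 * Complex.I * a t * Gt t x z) := by
  have hGt := (hG.differentiableAt_factor ht hx hz)
  have hlin : HasDerivAt (fun ξ : ℝ => -2 * Complex.I * a t * (z - ξ)) (2 * Complex.I * a t) x := by
    have h1 : HasDerivAt (fun ξ : ℝ => z - (ξ : ℂ)) (-1) x := by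
      simpa using (Complex.ofRealCLM.hasDerivAt (x := x)).const_sub z
    refine (h1.const_mul (-2 * Complex.I * a t)).congr_deriv ?_
    ring
  -- Solving the first-derivative formula for `G̃_x` expresses it through `G_x` and `G̃`, both
  -- differentiable at `x`.
  have hd' : DifferentiableAt ℝ (deriv fun ξ => Gt t ξ z) x := by
    have h2 := ((hasDerivAt_exp_phase (-a t) z x).differentiableAt.mul hd).sub
      (hlin.differentiableAt.mul hGt)
    refine h2.congr_of_eventuallyEq ?_
    filter_upwards [isOpen_dotReal.mem_nhds hx] with ξ hξ
    rw [Pi.sub_apply, Pi.mul_apply, Pi.mul_apply, hG.deriv_eq ht hξ hz, ← mul_assoc,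
      exp_neg_phase_mul]
    ring
  have h3 : (deriv fun ξ => Gext t ξ z) =ᶠ[𝓝 x]
      (fun ξ : ℝ => Complex.exp (Complex.I * (a t : ℂ) * (z - ξ) ^ 2)) *
        ((deriv fun ξ => Gt t ξ z) + (fun ξ : ℝ => -2 * Complex.I * a t * (z - ξ)) *
          fun ξ => Gt t ξ z) := by
    filter_upwards [isOpen_dotReal.mem_nhds hx] with ξ hξ
    rw [hG.deriv_eq ht hξ hz]
    rfl
  have h4 := (hasDerivAt_exp_phase (a t) z x).mul
    (hd'.hasDerivAt.add (hlin.mul hGt.hasDerivAt))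
  rw [h3.deriv_eq, h4.deriv]
  simp only [Pi.add_apply, Pi.mul_apply]
  ring

theorem GreenAssumption.deriv_time_eq (hG : GreenAssumption T V M N G α Gext a Gt p A B)
    {t x : ℝ} {z : ℂ} (ht : t ∈ timeInterval T) (hx : x ∈ dotReal) (hz : z ∈ doubleSector α)
    (hd : DifferentiableAt ℝ (fun τ => Gext τ x z) t) (ha : DifferentiableAt ℝ a t) :
    deriv (fun τ => Gext τ x z) t = Complex.exp (Complex.I * (a t : ℂ) * (z - x) ^ 2) *
      (deriv (fun τ => Gt τ x z) t + Complex.I * ((deriv a t : ℝ) : ℂ) * (z - x) ^ 2 * Gt t x z) := by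
  have hphase : ∀ s : ℂ, HasDerivAt (fun τ : ℝ => Complex.exp (s * (a τ : ℂ) * (z - x) ^ 2))
      (Complex.exp (s * (a t : ℂ) * (z - x) ^ 2) * (s * ((deriv a t : ℝ) : ℂ) * (z - x) ^ 2)) t :=
    fun s => ((ha.hasDerivAt.ofReal_comp.const_mul s).mul_const ((z - x) ^ 2)).cexp
  have hnear := (isOpen_timeInterval T).mem_nhds ht
  have hGt : DifferentiableAt ℝ (fun τ => Gt τ x z) t := by
    refine ((hphase (-Complex.I)).differentiableAt.mul hd).congr_of_eventuallyEq ?_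
    filter_upwards [hnear] with τ hτ
    rw [Pi.mul_apply, hG.decomposition τ hτ x hx z hz, ← mul_assoc, ← Complex.exp_add, neg_mul,
      neg_mul, neg_add_cancel, Complex.exp_zero, one_mul]
  have h2 : (fun τ => Gext τ x z) =ᶠ[𝓝 t]
      (fun τ : ℝ => Complex.exp (Complex.I * (a τ : ℂ) * (z - x) ^ 2)) * fun τ => Gt τ x z := by
    filter_upwards [hnear] with τ hτ
    exact hG.decomposition τ hτ x hx z hz
  rw [h2.deriv_eq, ((hphase Complex.I).mul hGt.hasDerivAt).deriv]
  ring

end GreenDerivatives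

/-! ### Gaussian bounds for the integrand and its derivatives -/

section KernelBounds

variable {T : EReal} {V : ℝ → ℝ → ℂ} {M N : Matrix (Fin 2) (Fin 2) ℂ} {G : ℝ → ℝ → ℝ → ℂ}
  {α : ℝ} {Gext : ℝ → ℝ → ℂ → ℂ} {a : ℝ → ℝ} {Gt : ℝ → ℝ → ℂ → ℂ} {p : ℝ}
  {A B : Fin 3 → ℝ → ℝ → ℝ} {F : ℂ → ℂ} {q AF BF : ℝ}

theorem deriv_kern (ε θ t x y : ℝ) : deriv (fun ξ => kern Gext F ε θ t ξ y) x
    = weight F ε θ y * deriv (fun ξ => Gext t ξ (contour θ y)) x :=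
  deriv_const_mul_field _

theorem deriv_deriv_kern (ε θ t x y : ℝ) : deriv (deriv fun ξ => kern Gext F ε θ t ξ y) x
    = weight F ε θ y * deriv (deriv fun ξ => Gext t ξ (contour θ y)) x := by
  have : (deriv fun ξ => kern Gext F ε θ t ξ y)
      = fun x => weight F ε θ y * deriv (fun ξ => Gext t ξ (contour θ y)) x :=
    funext fun x => deriv_kern ε θ t x y
  rw [this, deriv_const_mul_field]

theorem deriv_time_kern (ε θ t x y : ℝ) : deriv (fun τ => kern Gext F ε θ τ x y) t
    = weight F ε θ y * deriv (fun τ => Gext τ x (contour θ y)) t :=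
  deriv_const_mul_field _

theorem weight_zero (ε θ : ℝ) : weight F ε θ 0 = 0 := if_pos rfl

theorem kern_zero (ε θ t x : ℝ) : kern Gext F ε θ t x 0 = 0 := by
  rw [kern, weight_zero, zero_mul]

/-- Gaussian bounds for the integrand and its derivatives, uniform in the initial condition. -/
theorem GreenAssumption.exists_kern_bounds_uniform (hG : GreenAssumption T V M N G α Gext a Gt p A B)
    (hq : q ∈ Ioo (0 : ℝ) 2) (hAF : 0 ≤ AF) (hBF : 0 ≤ BF) {c K : ℝ} (hc : 0 < c) (hK : 0 ≤ K) :
    ∃ C : ℝ, 0 ≤ C ∧ ∀ F : ℂ → ℂ, (∀ z, ‖F z‖ ≤ AF * Real.exp (BF * ‖z‖ ^ q)) → ∀ ε θ t x : ℝ, θ ∈ Icc 0 α → t ∈ timeInterval T → x ∈ dotReal →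
      |x| ≤ K → a t ≤ K → c ≤ ε * Real.cos (2 * θ) + a t * Real.sin (2 * θ) →
      A 0 t x ≤ K → B 0 t x ≤ K →
      (∀ y, ‖kern Gext F ε θ t x y‖ ≤ C * Real.exp (-(c / 2) * y ^ 2)) ∧
      (A 1 t x ≤ K → B 1 t x ≤ K →
        (∀ y, ‖deriv (fun ξ => kern Gext F ε θ t ξ y) x‖ ≤ C * Real.exp (-(c / 2) * y ^ 2)) ∧
        (A 2 t x ≤ K → B 2 t x ≤ K → ∀ y,
          DifferentiableAt ℝ (deriv fun ξ => Gext t ξ (contour θ y)) x →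
          ‖deriv (deriv fun ξ => Gt t ξ (contour θ y)) x‖
            ≤ A 2 t x * Real.exp (B 2 t x * ‖contour θ y‖ ^ p) →
          ‖deriv (deriv fun ξ => kern Gext F ε θ t ξ y) x‖
            ≤ C * Real.exp (-(c / 2) * y ^ 2))) ∧
      (A 2 t x ≤ K → B 2 t x ≤ K → ∀ y,
        DifferentiableAt ℝ (fun τ => Gext τ x (contour θ y)) t → DifferentiableAt ℝ a t →
        ‖deriv (fun τ => Gt τ x (contour θ y)) t‖
          ≤ A 2 t x * Real.exp (B 2 t x * ‖contour θ y‖ ^ p) →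
        ‖deriv (fun τ => kern Gext F ε θ τ x y) t‖
          ≤ (1 + |deriv a t|) * (C * Real.exp (-(c / 2) * y ^ 2))) := by
  obtain ⟨C, hC, hbd⟩ := exists_gaussian_dominating (X := K) (R := K) (C₀ := K) (B₀ := K)
    hG.order hq hAF hBF hc hK hK hK hK
  -- The worst case is the second space derivative, whose four terms contribute `1 + 4 + 4 + 2 = 11`
  -- multiples of the common majorant.
  refine ⟨11 * C, by positivity, fun F hFb ε θ t x hθ ht hx hxK haK hcγ hA0 hB0 => ?_⟩
  have ha := (hG.a_pos t ht).le
  have hz : ∀ {y : ℝ}, y ≠ 0 → contour θ y ∈ doubleSector α := fun hy =>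
    contour_mem_doubleSector hG.angle hθ hy
  -- `Q` majorises `1`, `a`, `|z - x|` and `a |z - x|` simultaneously, so every polynomial factor
  -- produced by differentiating the phase is a multiple of `Q^2`.
  let Q : ℝ → ℝ := fun y => (1 + K) * (1 + K) * (1 + |y|)
  let D : ℝ → ℝ := fun y => K * Real.exp (K * |y| ^ p)
  have hD : ∀ y, 0 ≤ D y := fun y => by positivity
  have hle : ∀ j y, A j t x ≤ K → B j t x ≤ K →
      A j t x * Real.exp (B j t x * ‖contour θ y‖ ^ p) ≤ D y := by
    intro j y h1 h2
    rw [norm_contour]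
    change _ ≤ K * Real.exp (K * |y| ^ p)
    gcongr
  have h1Q : ∀ y, 1 ≤ Q y := fun y => by
    have := abs_nonneg y
    have h1 : 1 ≤ (1 + K) * (1 + K) := by nlinarith
    have h2 : 1 ≤ 1 + |y| := by linarith
    exact one_le_mul_of_one_le_of_one_le h1 h2
  have hKQ : ∀ y, (1 + K) * (|y| + |x|) ≤ Q y := fun y => by
    have : |y| + |x| ≤ (1 + K) * (1 + |y|) := by nlinarith [abs_nonneg y, abs_nonneg x]
    calc (1 + K) * (|y| + |x|) ≤ (1 + K) * ((1 + K) * (1 + |y|)) := by gcongr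
      _ = Q y := by simp only [Q]; ring
  have haQ : ∀ y, a t ≤ Q y := fun y => by
    have : 1 + K ≤ (1 + K) * ((1 + K) * (1 + |y|)) := by
      refine le_mul_of_one_le_right (by linarith) ?_
      nlinarith [abs_nonneg y]
    calc a t ≤ 1 + K := by linarith
      _ ≤ _ := this
      _ = Q y := by simp only [Q]; ring
  have hsQ : ∀ y, |y| + |x| ≤ Q y := fun y =>
    (le_mul_of_one_le_left (by positivity) (by linarith)).trans (hKQ y)
  have hasQ : ∀ y, a t * (|y| + |x|) ≤ Q y := fun y =>
    (mul_le_mul_of_nonneg_right (by linarith) (by positivity)).trans (hKQ y)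
  -- Each of the four bounds reduces to estimating the bracket left after extracting the phase by `k
  -- Q^2 D`.
  have main : ∀ (y k : ℝ) (w : ℂ), 0 ≤ k → (y ≠ 0 → ‖w‖ ≤
      ‖Complex.exp (Complex.I * (a t : ℂ) * (contour θ y - x) ^ 2)‖ * (k * (Q y ^ 2 * D y))) →
      ‖weight F ε θ y * w‖ ≤ k * (C * Real.exp (-(c / 2) * y ^ 2)) := by
    intro y k w hk hw
    by_cases hy : y = 0
    · subst hy
      rw [weight_zero, zero_mul, norm_zero]
      positivity
    · rw [norm_mul]
      calc ‖weight F ε θ y‖ * ‖w‖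
          ≤ ‖weight F ε θ y‖ * (‖Complex.exp (Complex.I * (a t : ℂ) * (contour θ y - x) ^ 2)‖
            * (k * (Q y ^ 2 * D y))) := by gcongr; exact hw hy
        _ = k * (‖weight F ε θ y‖ * ‖Complex.exp (Complex.I * (a t : ℂ) * (contour θ y - x) ^ 2)‖
            * (Q y ^ 2 * D y)) := by ring
        _ ≤ k * (AF * Real.exp (-c * y ^ 2 + 2 * a t * |x| * |y| + BF * |y| ^ q)
            * (Q y ^ 2 * D y)) := by
          refine mul_le_mul_of_nonneg_left (mul_le_mul_of_nonneg_right
            (norm_weight_mul_exp_le hAF hFb ha hcγ) (mul_nonneg (sq_nonneg _) (hD y))) hk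
        _ ≤ _ := mul_le_mul_of_nonneg_left (hbd (a t) x y ha haK hxK) hk
  have hGt : ∀ y, y ≠ 0 → ‖Gt t x (contour θ y)‖ ≤ D y := fun y hy =>
    (hG.bound t ht x hx _ (hz hy)).trans (hle 0 y hA0 hB0)
  have hlin : ∀ y, ‖-2 * Complex.I * a t * (contour θ y - x)‖ ≤ 2 * Q y := fun y => by
    rw [norm_mul, norm_mul, norm_mul, norm_neg, Complex.norm_I, Complex.norm_ofNat,
      Complex.norm_real, Real.norm_of_nonneg ha, mul_one, mul_assoc]
    have := norm_contour_sub_le θ y x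
    have h2 : a t * ‖contour θ y - x‖ ≤ a t * (|y| + |x|) := by gcongr
    linarith [hasQ y]
  have hQ2 : ∀ y, Q y ≤ Q y ^ 2 := fun y => by nlinarith [h1Q y]
  refine ⟨fun y => ?_, fun hA1 hB1 => ⟨fun y => ?_, fun hA2 hB2 y hd hb => ?_⟩,
    fun hA2 hB2 y hd hda hb => ?_⟩
  · refine (main y 1 _ zero_le_one fun hy => ?_).trans ?_
    · rw [hG.decomposition t ht x hx _ (hz hy), norm_mul]
      gcongr
      have := hGt y hy
      nlinarith [hQ2 y, h1Q y, hD y, mul_nonneg (hD y) (sub_nonneg.2 (hQ2 y)),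
        mul_nonneg (hD y) (sub_nonneg.2 (h1Q y))]
    · have : 0 ≤ C * Real.exp (-(c / 2) * y ^ 2) := by positivity
      linarith
  · rw [deriv_kern]
    refine (main y 3 _ (by norm_num) fun hy => ?_).trans ?_
    · rw [hG.deriv_eq ht hx (hz hy), norm_mul]
      gcongr
      refine (norm_add_le _ _).trans ?_
      rw [norm_mul]
      have h1 := (hG.bound_x t ht x hx _ (hz hy)).trans (hle 1 y hA1 hB1)
      have h2 := mul_le_mul (hlin y) (hGt y hy) (norm_nonneg _) (by linarith [h1Q y])
      nlinarith [hQ2 y, h1Q y, hD y, mul_nonneg (hD y) (sub_nonneg.2 (hQ2 y)),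
        mul_nonneg (hD y) (sub_nonneg.2 (h1Q y))]
    · have : 0 ≤ C * Real.exp (-(c / 2) * y ^ 2) := by positivity
      linarith
  · rw [deriv_deriv_kern]
    refine (main y 11 _ (by norm_num) fun hy => ?_).trans (by rw [mul_assoc])
    rw [hG.deriv_deriv_eq ht hx (hz hy) hd, norm_mul]
    gcongr
    have h0 := hGt y hy
    have h1 := (hG.bound_x t ht x hx _ (hz hy)).trans (hle 1 y hA1 hB1)
    have h2 := hb.trans (hle 2 y hA2 hB2)
    have hQ0 : 0 ≤ Q y := by linarith [h1Q y]
    have e1 : ‖2 * (-2 * Complex.I * a t * (contour θ y - x)) *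
        deriv (fun ξ => Gt t ξ (contour θ y)) x‖ ≤ 2 * (2 * Q y) * D y := by
      rw [norm_mul, norm_mul, Complex.norm_ofNat]
      have := hlin y
      gcongr
    have e2 : ‖(-2 * Complex.I * a t * (contour θ y - x)) ^ 2 * Gt t x (contour θ y)‖
        ≤ (2 * Q y) ^ 2 * D y := by
      rw [norm_mul, norm_pow]
      have := hlin y
      gcongr
    have e3 : ‖2 * Complex.I * a t * Gt t x (contour θ y)‖ ≤ 2 * Q y * D y := by
      rw [norm_mul, norm_mul, norm_mul, Complex.norm_I, Complex.norm_ofNat, Complex.norm_real,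
        Real.norm_of_nonneg ha, mul_one]
      have := haQ y
      gcongr
    have e4 := norm_add₄_le (a := deriv (deriv fun ξ => Gt t ξ (contour θ y)) x)
      (b := 2 * (-2 * Complex.I * a t * (contour θ y - x)) * deriv (fun ξ => Gt t ξ (contour θ y)) x)
      (c := (-2 * Complex.I * a t * (contour θ y - x)) ^ 2 * Gt t x (contour θ y))
      (d := 2 * Complex.I * a t * Gt t x (contour θ y))
    nlinarith [mul_nonneg (hD y) (sub_nonneg.2 (hQ2 y)),
        mul_nonneg (hD y) (sub_nonneg.2 (h1Q y))]
  · rw [deriv_time_kern]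
    refine (main y (1 + |deriv a t|) _ (by positivity) fun hy => ?_).trans ?_
    · rw [hG.deriv_time_eq ht hx (hz hy) hd hda, norm_mul]
      gcongr
      refine (norm_add_le _ _).trans ?_
      have h0 := hGt y hy
      have h2 := hb.trans (hle 2 y hA2 hB2)
      have e1 : ‖Complex.I * ((deriv a t : ℝ) : ℂ) * (contour θ y - x) ^ 2 *
          Gt t x (contour θ y)‖ ≤ |deriv a t| * Q y ^ 2 * D y := by
        rw [norm_mul, norm_mul, norm_mul, norm_pow, Complex.norm_I, one_mul, Complex.norm_real,
          Real.norm_eq_abs]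
        have := (norm_contour_sub_le θ y x).trans (hsQ y)
        gcongr
      nlinarith [mul_nonneg (hD y) (sub_nonneg.2 (hQ2 y)),
        mul_nonneg (hD y) (sub_nonneg.2 (h1Q y))]
    · have : 0 ≤ C * Real.exp (-(c / 2) * y ^ 2) := by positivity
      have h3 : C * Real.exp (-(c / 2) * y ^ 2) ≤ 11 * C * Real.exp (-(c / 2) * y ^ 2) := by
        linarith
      gcongr

/-- Gaussian bounds for the integrand and its derivatives. -/
theorem GreenAssumption.exists_kern_bounds (hG : GreenAssumption T V M N G α Gext a Gt p A B)
    (hq : q ∈ Ioo (0 : ℝ) 2) (hAF : 0 ≤ AF) (hBF : 0 ≤ BF)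
    (hFb : ∀ z, ‖F z‖ ≤ AF * Real.exp (BF * ‖z‖ ^ q)) {c K : ℝ} (hc : 0 < c) (hK : 0 ≤ K) :
    ∃ C : ℝ, 0 ≤ C ∧ ∀ ε θ t x : ℝ, θ ∈ Icc 0 α → t ∈ timeInterval T → x ∈ dotReal →
      |x| ≤ K → a t ≤ K → c ≤ ε * Real.cos (2 * θ) + a t * Real.sin (2 * θ) →
      A 0 t x ≤ K → B 0 t x ≤ K →
      (∀ y, ‖kern Gext F ε θ t x y‖ ≤ C * Real.exp (-(c / 2) * y ^ 2)) ∧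
      (A 1 t x ≤ K → B 1 t x ≤ K →
        (∀ y, ‖deriv (fun ξ => kern Gext F ε θ t ξ y) x‖ ≤ C * Real.exp (-(c / 2) * y ^ 2)) ∧
        (A 2 t x ≤ K → B 2 t x ≤ K → ∀ y,
          DifferentiableAt ℝ (deriv fun ξ => Gext t ξ (contour θ y)) x →
          ‖deriv (deriv fun ξ => Gt t ξ (contour θ y)) x‖
            ≤ A 2 t x * Real.exp (B 2 t x * ‖contour θ y‖ ^ p) →
          ‖deriv (deriv fun ξ => kern Gext F ε θ t ξ y) x‖
            ≤ C * Real.exp (-(c / 2) * y ^ 2))) ∧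
      (A 2 t x ≤ K → B 2 t x ≤ K → ∀ y,
        DifferentiableAt ℝ (fun τ => Gext τ x (contour θ y)) t → DifferentiableAt ℝ a t →
        ‖deriv (fun τ => Gt τ x (contour θ y)) t‖
          ≤ A 2 t x * Real.exp (B 2 t x * ‖contour θ y‖ ^ p) →
        ‖deriv (fun τ => kern Gext F ε θ τ x y) t‖
          ≤ (1 + |deriv a t|) * (C * Real.exp (-(c / 2) * y ^ 2))) := by
  obtain ⟨C, hC, h⟩ := hG.exists_kern_bounds_uniform hq hAF hBF hc hK
  exact ⟨C, hC, h F hFb⟩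

theorem GreenAssumption.continuousOn_a (hG : GreenAssumption T V M N G α Gext a Gt p A B) :
    ContinuousOn a (timeInterval T) :=
  hG.a_ac.continuousOn (isOpen_timeInterval T) (ordConnected_timeInterval T)

theorem exists_forall_le_of_continuousOn {K : Set ℝ} (hK : IsCompact K) {f : ℝ → ℝ}
    (hf : ContinuousOn f K) : ∃ C : ℝ, 0 ≤ C ∧ ∀ x ∈ K, f x ≤ C := by
  obtain ⟨C, hC⟩ := hK.exists_bound_of_continuousOn hf
  exact ⟨max C 0, le_max_right _ _, fun x hx =>
    ((le_abs_self _).trans (hC x hx)).trans (le_max_left _ _)⟩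

/-- A single `K` for all data on a compact set makes the constant in the kernel bounds uniform
there. -/
theorem GreenAssumption.exists_bound_space (hG : GreenAssumption T V M N G α Gext a Gt p A B)
    {t : ℝ} (ht : t ∈ timeInterval T) {S : Set ℝ} (hS : IsCompact S) (hSd : S ⊆ dotReal) :
    ∃ K : ℝ, 0 ≤ K ∧ a t ≤ K ∧ ∀ x ∈ S, |x| ≤ K ∧ ∀ j, A j t x ≤ K ∧ B j t x ≤ K := by
  have hmap : MapsTo (fun x : ℝ => (t, x)) S (timeInterval T ×ˢ dotReal) :=
    fun x hx => ⟨ht, hSd hx⟩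
  have h1 : ∀ j, ∃ C : ℝ, 0 ≤ C ∧ ∀ x ∈ S, A j t x ≤ C := fun j =>
    exists_forall_le_of_continuousOn hS ((hG.A_continuous j).comp (by fun_prop) hmap)
  have h2 : ∀ j, ∃ C : ℝ, 0 ≤ C ∧ ∀ x ∈ S, B j t x ≤ C := fun j =>
    exists_forall_le_of_continuousOn hS ((hG.B_continuous j).comp (by fun_prop) hmap)
  choose C₁ hC₁ hb₁ using h1
  choose C₂ hC₂ hb₂ using h2
  obtain ⟨C₃, hC₃, hb₃⟩ := exists_forall_le_of_continuousOn hS (f := fun x => |x|) (by fun_prop)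
  have ha := (hG.a_pos t ht).le
  have hs1 : ∀ j, C₁ j ≤ ∑ i, C₁ i := fun j =>
    Finset.single_le_sum (fun i _ => hC₁ i) (Finset.mem_univ j)
  have hs2 : ∀ j, C₂ j ≤ ∑ i, C₂ i := fun j =>
    Finset.single_le_sum (fun i _ => hC₂ i) (Finset.mem_univ j)
  have p1 : 0 ≤ ∑ i, C₁ i := Finset.sum_nonneg fun i _ => hC₁ i
  have p2 : 0 ≤ ∑ i, C₂ i := Finset.sum_nonneg fun i _ => hC₂ i
  refine ⟨∑ i, C₁ i + ∑ i, C₂ i + C₃ + a t, by positivity, by linarith, fun x hx =>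
    ⟨by linarith [hb₃ x hx], fun j => ⟨?_, ?_⟩⟩⟩
  · linarith [hb₁ j x hx, hs1 j]
  · linarith [hb₂ j x hx, hs2 j]

theorem GreenAssumption.exists_bound_time (hG : GreenAssumption T V M N G α Gext a Gt p A B)
    {x : ℝ} (hx : x ∈ dotReal) {S : Set ℝ} (hS : IsCompact S) (hSI : S ⊆ timeInterval T) :
    ∃ K : ℝ, 0 ≤ K ∧ |x| ≤ K ∧ ∀ t ∈ S, a t ≤ K ∧ ∀ j, A j t x ≤ K ∧ B j t x ≤ K := by
  have hmap : MapsTo (fun t : ℝ => (t, x)) S (timeInterval T ×ˢ dotReal) :=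
    fun t ht => ⟨hSI ht, hx⟩
  have h1 : ∀ j, ∃ C : ℝ, 0 ≤ C ∧ ∀ t ∈ S, A j t x ≤ C := fun j =>
    exists_forall_le_of_continuousOn hS ((hG.A_continuous j).comp
      (f := fun t : ℝ => (t, x)) (by fun_prop) hmap)
  have h2 : ∀ j, ∃ C : ℝ, 0 ≤ C ∧ ∀ t ∈ S, B j t x ≤ C := fun j =>
    exists_forall_le_of_continuousOn hS ((hG.B_continuous j).comp
      (f := fun t : ℝ => (t, x)) (by fun_prop) hmap)
  choose C₁ hC₁ hb₁ using h1
  choose C₂ hC₂ hb₂ using h2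
  obtain ⟨C₃, hC₃, hb₃⟩ := exists_forall_le_of_continuousOn hS (hG.continuousOn_a.mono hSI)
  have hs1 : ∀ j, C₁ j ≤ ∑ i, C₁ i := fun j =>
    Finset.single_le_sum (fun i _ => hC₁ i) (Finset.mem_univ j)
  have hs2 : ∀ j, C₂ j ≤ ∑ i, C₂ i := fun j =>
    Finset.single_le_sum (fun i _ => hC₂ i) (Finset.mem_univ j)
  have p1 : 0 ≤ ∑ i, C₁ i := Finset.sum_nonneg fun i _ => hC₁ i
  have p2 : 0 ≤ ∑ i, C₂ i := Finset.sum_nonneg fun i _ => hC₂ i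
  have p3 := abs_nonneg x
  refine ⟨∑ i, C₁ i + ∑ i, C₂ i + C₃ + |x|, by positivity, by linarith, fun t ht =>
    ⟨by linarith [hb₃ t ht], fun j => ⟨?_, ?_⟩⟩⟩
  · linarith [hb₁ j t ht, hs1 j]
  · linarith [hb₂ j t ht, hs2 j]

end KernelBounds

/-! ### Regularity of the integral over a rotated line -/

section KernelIntegrals

variable {T : EReal} {V : ℝ → ℝ → ℂ} {M N : Matrix (Fin 2) (Fin 2) ℂ} {G : ℝ → ℝ → ℝ → ℂ}
  {α : ℝ} {Gext : ℝ → ℝ → ℂ → ℂ} {a : ℝ → ℝ} {Gt : ℝ → ℝ → ℂ → ℂ} {p : ℝ}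
  {A B : Fin 3 → ℝ → ℝ → ℝ} {F : ℂ → ℂ} {q AF BF : ℝ}

theorem GreenAssumption.continuousOn_kern (hG : GreenAssumption T V M N G α Gext a Gt p A B)
    (hF : Continuous F) (ε : ℝ) {θ t x : ℝ} (hθ : θ ∈ Icc 0 α) (ht : t ∈ timeInterval T)
    (hx : x ∈ dotReal) : ContinuousOn (kern Gext F ε θ t x) dotReal :=
  (continuousOn_weight hF ε θ).mul ((hG.continuousOn t ht x hx).comp
    (continuous_contour θ).continuousOn fun _ hy => contour_mem_doubleSector hG.angle hθ hy)

theorem GreenAssumption.measurable_kern (hG : GreenAssumption T V M N G α Gext a Gt p A B)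
    (hF : Continuous F) (ε : ℝ) {θ t x : ℝ} (hθ : θ ∈ Icc 0 α) (ht : t ∈ timeInterval T)
    (hx : x ∈ dotReal) : Measurable (kern Gext F ε θ t x) :=
  measurable_of_continuousOn_compl_singleton 0 (hG.continuousOn_kern hF ε hθ ht hx)

theorem GreenAssumption.differentiableAt_kern (hG : GreenAssumption T V M N G α Gext a Gt p A B)
    (ε : ℝ) {θ t x : ℝ} (hθ : θ ∈ Icc 0 α) (ht : t ∈ timeInterval T)
    (hx : x ∈ dotReal) (y : ℝ) : DifferentiableAt ℝ (fun ξ => kern Gext F ε θ t ξ y) x := by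
  by_cases hy : y = 0
  · subst hy
    simp only [kern_zero]
    exact differentiableAt_const _
  · exact ((hG.mem _ (contour_mem_doubleSector hG.angle hθ hy)).differentiable t ht x hx).const_mul _

theorem GreenAssumption.continuousOn_kern_space
    (hG : GreenAssumption T V M N G α Gext a Gt p A B) (ε : ℝ) {θ t : ℝ} (hθ : θ ∈ Icc 0 α)
    (ht : t ∈ timeInterval T) (y : ℝ) : ContinuousOn (fun ξ => kern Gext F ε θ t ξ y) dotReal :=
  fun _ hx => (hG.differentiableAt_kern ε hθ ht hx y).continuousAt.continuousWithinAt

theorem GreenAssumption.measurable_deriv_kern (hG : GreenAssumption T V M N G α Gext a Gt p A B)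
    (hF : Continuous F) (ε : ℝ) {θ t x : ℝ} (hθ : θ ∈ Icc 0 α) (ht : t ∈ timeInterval T)
    (hx : x ∈ dotReal) : Measurable fun y => deriv (fun ξ => kern Gext F ε θ t ξ y) x :=
  measurable_deriv_of_measurable_left (f := fun y ξ => kern Gext F ε θ t ξ y) isOpen_dotReal
    (fun _ hs => hG.measurable_kern hF ε hθ ht hs)
    (fun y => hG.continuousOn_kern_space ε hθ ht y) hx

theorem GreenAssumption.isAC_kern_time (hG : GreenAssumption T V M N G α Gext a Gt p A B)
    (ε : ℝ) {θ x : ℝ} (hθ : θ ∈ Icc 0 α) (hx : x ∈ dotReal) (y : ℝ) :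
    IsAC (fun τ => kern Gext F ε θ τ x y) (timeInterval T) := by
  by_cases hy : y = 0
  · subst hy
    simp only [kern_zero]
    exact isAC_const 0
  · exact ((hG.mem _ (contour_mem_doubleSector hG.angle hθ hy)).time x hx).const_mul _

theorem GreenAssumption.isACDot_deriv_kern (hG : GreenAssumption T V M N G α Gext a Gt p A B)
    (ε : ℝ) {θ t : ℝ} (hθ : θ ∈ Icc 0 α) (ht : t ∈ timeInterval T) (y : ℝ) :
    IsACDot (deriv fun ξ => kern Gext F ε θ t ξ y) := by
  by_cases hy : y = 0
  · subst hy
    simp only [kern_zero, deriv_const']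
    exact ⟨isAC_const 0, isAC_const 0⟩
  · have h := (hG.mem _ (contour_mem_doubleSector hG.angle hθ hy)).space_deriv t ht
    exact ⟨(h.1.const_mul (weight F ε θ y)).congr fun x _ => (deriv_kern ε θ t x y).symm,
      (h.2.const_mul (weight F ε θ y)).congr fun x _ => (deriv_kern ε θ t x y).symm⟩

theorem GreenAssumption.integrable_kern (hG : GreenAssumption T V M N G α Gext a Gt p A B)
    (hq : q ∈ Ioo (0 : ℝ) 2) (hAF : 0 ≤ AF) (hBF : 0 ≤ BF) (hF : Continuous F)
    (hFb : ∀ z, ‖F z‖ ≤ AF * Real.exp (BF * ‖z‖ ^ q)) {ε θ t x : ℝ} (hθ : θ ∈ Icc 0 α)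
    (ht : t ∈ timeInterval T) (hx : x ∈ dotReal)
    (hγ : 0 < ε * Real.cos (2 * θ) + a t * Real.sin (2 * θ)) :
    Integrable (kern Gext F ε θ t x) := by
  obtain ⟨K, hK, haK, hb⟩ := hG.exists_bound_space ht (isCompact_singleton (x := x))
    (singleton_subset_iff.2 hx)
  obtain ⟨hxK, hAB⟩ := hb x rfl
  obtain ⟨C, hC, hbd⟩ := hG.exists_kern_bounds hq hAF hBF hFb hγ hK
  have h1 := (hbd ε θ t x hθ ht hx hxK haK le_rfl (hAB 0).1 (hAB 0).2).1
  exact ((integrable_exp_neg_mul_sq (half_pos hγ)).const_mul C).mono'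
    (hG.measurable_kern hF ε hθ ht hx).aestronglyMeasurable (Eventually.of_forall h1)

/-- Differentiation in space under the integral sign. -/
theorem GreenAssumption.hasDerivAt_integral_kern
    (hG : GreenAssumption T V M N G α Gext a Gt p A B)
    (hq : q ∈ Ioo (0 : ℝ) 2) (hAF : 0 ≤ AF) (hBF : 0 ≤ BF) (hF : Continuous F)
    (hFb : ∀ z, ‖F z‖ ≤ AF * Real.exp (BF * ‖z‖ ^ q)) {ε θ t x : ℝ} (hθ : θ ∈ Icc 0 α)
    (ht : t ∈ timeInterval T) (hx : x ∈ dotReal)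
    (hγ : 0 < ε * Real.cos (2 * θ) + a t * Real.sin (2 * θ)) :
    Integrable (fun y => deriv (fun ξ => kern Gext F ε θ t ξ y) x) ∧
    HasDerivAt (fun ξ => ∫ y, kern Gext F ε θ t ξ y)
      (∫ y, deriv (fun ξ => kern Gext F ε θ t ξ y) x) x := by
  obtain ⟨δ, hδ, hball⟩ := Metric.nhds_basis_closedBall.mem_iff.1 (isOpen_dotReal.mem_nhds hx)
  obtain ⟨K, hK, haK, hb⟩ := hG.exists_bound_space ht (isCompact_closedBall x δ) hball
  obtain ⟨C, hC, hbd⟩ := hG.exists_kern_bounds hq hAF hBF hFb hγ hK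
  refine hasDerivAt_integral_of_dominated_loc_of_deriv_le
    (F := fun ξ y => kern Gext F ε θ t ξ y)
    (F' := fun x y => deriv (fun ξ => kern Gext F ε θ t ξ y) x)
    (bound := fun y => C * Real.exp (-((ε * Real.cos (2 * θ) + a t * Real.sin (2 * θ)) / 2) * y ^ 2))
    (Metric.closedBall_mem_nhds x hδ) ?_ (hG.integrable_kern hq hAF hBF hF hFb hθ ht hx hγ)
    (hG.measurable_deriv_kern hF ε hθ ht hx).aestronglyMeasurable ?_
    ((integrable_exp_neg_mul_sq (half_pos hγ)).const_mul C) ?_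
  · filter_upwards [isOpen_dotReal.mem_nhds hx] with ξ hξ
    exact (hG.measurable_kern hF ε hθ ht hξ).aestronglyMeasurable
  · refine Eventually.of_forall fun y ξ hξ => ?_
    obtain ⟨hxK, hAB⟩ := hb ξ hξ
    exact ((hbd ε θ t ξ hθ ht (hball hξ) hxK haK le_rfl (hAB 0).1 (hAB 0).2).2.1
      (hAB 1).1 (hAB 1).2).1 y
  · exact Eventually.of_forall fun y ξ hξ =>
      (hG.differentiableAt_kern ε hθ ht (hball hξ) y).hasDerivAt

/-- The derivative in space of the integral is absolutely continuous, and can be differentiated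
almost everywhere under the integral sign. -/
theorem GreenAssumption.isACDot_deriv_integral
    (hG : GreenAssumption T V M N G α Gext a Gt p A B)
    (hq : q ∈ Ioo (0 : ℝ) 2) (hAF : 0 ≤ AF) (hBF : 0 ≤ BF) (hF : Continuous F)
    (hFb : ∀ z, ‖F z‖ ≤ AF * Real.exp (BF * ‖z‖ ^ q)) {ε θ t : ℝ} (hθ : θ ∈ Icc 0 α)
    (ht : t ∈ timeInterval T) (hγ : 0 < ε * Real.cos (2 * θ) + a t * Real.sin (2 * θ)) :
    IsACDot (deriv fun ξ => ∫ y, kern Gext F ε θ t ξ y) ∧ ∀ᵐ x : ℝ, x ∈ dotReal →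
      Integrable (fun y => deriv (deriv fun ξ => kern Gext F ε θ t ξ y) x) ∧
      deriv (deriv fun ξ => ∫ y, kern Gext F ε θ t ξ y) x
        = ∫ y, deriv (deriv fun ξ => kern Gext F ε θ t ξ y) x := by
  have hd := fun x (hx : x ∈ dotReal) =>
    hG.hasDerivAt_integral_kern hq hAF hBF hF hFb hθ ht hx hγ
  have key : ∀ I : Set ℝ, IsOpen I → I.OrdConnected → I ⊆ dotReal →
      (∀ y, IsAC (deriv fun ξ => kern Gext F ε θ t ξ y) I) →
      IsAC (fun x => ∫ y, deriv (fun ξ => kern Gext F ε θ t ξ y) x) I ∧ ∀ᵐ x : ℝ, x ∈ I →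
        Integrable (fun y => deriv (deriv fun ξ => kern Gext F ε θ t ξ y) x) ∧
        HasDerivAt (fun x => ∫ y, deriv (fun ξ => kern Gext F ε θ t ξ y) x)
          (∫ y, deriv (deriv fun ξ => kern Gext F ε θ t ξ y) x) x := by
    intro I hI hI' hsub hAC
    refine isAC_integral hI hI' (f := fun y => deriv fun ξ => kern Gext F ε θ t ξ y)
      (fun s hs => hG.measurable_deriv_kern hF ε hθ ht (hsub hs)) hAC
      (fun s hs => (hd s (hsub hs)).1) ?_
    intro c hc d hd _
    have hcd : Icc c d ⊆ dotReal := (hI'.out hc hd).trans hsub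
    obtain ⟨K, hK, haK, hb⟩ := hG.exists_bound_space ht isCompact_Icc hcd
    obtain ⟨C, hC, hbd⟩ := hG.exists_kern_bounds hq hAF hBF hFb hγ hK
    refine ⟨fun _ => 1, _, integrableOn_const (by simp),
      (integrable_exp_neg_mul_sq (half_pos hγ)).const_mul C, fun y => ?_⟩
    by_cases hy : y = 0
    · refine Eventually.of_forall fun x _ => ?_
      rw [deriv_deriv_kern, hy, weight_zero, zero_mul, norm_zero]
      positivity
    · have hz := contour_mem_doubleSector hG.angle hθ hy
      filter_upwards [((hG.mem _ hz).space_deriv t ht).ae_differentiableAt,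
        hG.bound_xx t ht _ hz] with x h1 h2 hx
      obtain ⟨hxK, hAB⟩ := hb x hx
      rw [one_mul]
      exact ((hbd ε θ t x hθ ht (hcd hx) hxK haK le_rfl (hAB 0).1 (hAB 0).2).2.1
        (hAB 1).1 (hAB 1).2).2 (hAB 2).1 (hAB 2).2 y (h1 (hcd hx)) (h2 (hcd hx))
  have hsubl : Iio (0 : ℝ) ⊆ dotReal := fun x hx => ne_of_lt hx
  have hsubr : Ioi (0 : ℝ) ⊆ dotReal := fun x hx => ne_of_gt hx
  obtain ⟨hl, hl'⟩ := key _ isOpen_Iio ordConnected_Iio hsubl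
    fun y => (hG.isACDot_deriv_kern ε hθ ht y).1
  obtain ⟨hr, hr'⟩ := key _ isOpen_Ioi ordConnected_Ioi hsubr
    fun y => (hG.isACDot_deriv_kern ε hθ ht y).2
  refine ⟨⟨hl.congr fun x hx => (hd x (hsubl hx)).2.deriv.symm,
    hr.congr fun x hx => (hd x (hsubr hx)).2.deriv.symm⟩, ?_⟩
  filter_upwards [hl', hr'] with x h1 h2 hx
  have he : (deriv fun ξ => ∫ y, kern Gext F ε θ t ξ y) =ᶠ[𝓝 x]
      fun x => ∫ y, deriv (fun ξ => kern Gext F ε θ t ξ y) x := by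
    filter_upwards [isOpen_dotReal.mem_nhds hx] with ξ hξ using (hd ξ hξ).2.deriv
  rw [he.deriv_eq]
  rcases lt_or_gt_of_ne (show x ≠ 0 from hx) with h | h
  · exact ⟨(h1 h).1, (h1 h).2.deriv⟩
  · exact ⟨(h2 h).1, (h2 h).2.deriv⟩

/-- The integral is absolutely continuous in time, and can be differentiated almost everywhere under
the integral sign. -/
theorem GreenAssumption.isAC_integral_time
    (hG : GreenAssumption T V M N G α Gext a Gt p A B)
    (hq : q ∈ Ioo (0 : ℝ) 2) (hAF : 0 ≤ AF) (hBF : 0 ≤ BF) (hF : Continuous F)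
    (hFb : ∀ z, ‖F z‖ ≤ AF * Real.exp (BF * ‖z‖ ^ q)) {θ x : ℝ} (hθ : θ ∈ Icc 0 α)
    (hsin : 0 < Real.sin (2 * θ)) (hx : x ∈ dotReal) :
    IsAC (fun t => ∫ y, kern Gext F 0 θ t x y) (timeInterval T) ∧
      ∀ᵐ t : ℝ, t ∈ timeInterval T →
      Integrable (fun y => deriv (fun τ => kern Gext F 0 θ τ x y) t) ∧
      deriv (fun τ => ∫ y, kern Gext F 0 θ τ x y) t
        = ∫ y, deriv (fun τ => kern Gext F 0 θ τ x y) t := by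
  have hI := isOpen_timeInterval T
  have hI' := ordConnected_timeInterval T
  have key := isAC_integral hI hI' (f := fun y τ => kern Gext F 0 θ τ x y)
      (fun s hs => hG.measurable_kern hF 0 hθ hs hx)
      (fun y => hG.isAC_kern_time 0 hθ hx y)
      (fun s hs => hG.integrable_kern hq hAF hBF hF hFb hθ hs hx
        (by rw [zero_mul, zero_add]; exact mul_pos (hG.a_pos s hs) hsin)) ?_
  · refine ⟨key.1, ?_⟩
    filter_upwards [key.2] with t h ht using ⟨(h ht).1, (h ht).2.deriv⟩
  intro c hc d hd hcd
  have hsub : Icc c d ⊆ timeInterval T := hI'.out hc hd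
  obtain ⟨K, hK, hxK, hb⟩ := hG.exists_bound_time hx isCompact_Icc hsub
  -- The Gaussian rate `a(t) sin 2θ` varies with time; its minimum over the compact interval gives
  -- one integrable majorant in `y`.
  obtain ⟨t₀, ht₀, hmin⟩ := isCompact_Icc.exists_isMinOn (nonempty_Icc.2 hcd.le)
    (hG.continuousOn_a.mono hsub)
  have hγ : 0 < a t₀ * Real.sin (2 * θ) := mul_pos (hG.a_pos t₀ (hsub ht₀)) hsin
  obtain ⟨C, hC, hbd⟩ := hG.exists_kern_bounds hq hAF hBF hFb hγ hK
  -- Differentiating the phase in time produces `a'`, which is only locally integrable. This is why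
  -- the domination has the product form of a function of time and a function of `y`.
  refine ⟨fun t => 1 + |deriv a t|, _, ?_,
    (integrable_exp_neg_mul_sq (half_pos hγ)).const_mul C, fun y => ?_⟩
  · refine (integrableOn_const (by simp)).add ?_
    exact ((hG.a_ac.locallyIntegrableOn_deriv hI hI').integrableOn_compact_subset hsub
      isCompact_Icc).norm
  · by_cases hy : y = 0
    · refine Eventually.of_forall fun t _ => ?_
      rw [deriv_time_kern, hy, weight_zero, zero_mul, norm_zero]
      positivity
    · have hz := contour_mem_doubleSector hG.angle hθ hy
      filter_upwards [((hG.mem _ hz).time x hx).ae_differentiableAt hI hI',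
        hG.a_ac.ae_differentiableAt hI hI', hG.bound_t x hx _ hz] with t h1 h2 h3 ht
      obtain ⟨haK, hAB⟩ := hb t ht
      have htI := hsub ht
      refine (hbd 0 θ t x hθ htI hx hxK haK ?_ (hAB 0).1 (hAB 0).2).2.2 (hAB 2).1 (hAB 2).2 y
        (h1 htI) (h2 htI) (h3 htI)
      rw [zero_mul, zero_add]
      exact mul_le_mul_of_nonneg_right (hmin ht) hsin.le

theorem GreenAssumption.memAC12_integral
    (hG : GreenAssumption T V M N G α Gext a Gt p A B)
    (hq : q ∈ Ioo (0 : ℝ) 2) (hAF : 0 ≤ AF) (hBF : 0 ≤ BF) (hF : Continuous F)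
    (hFb : ∀ z, ‖F z‖ ≤ AF * Real.exp (BF * ‖z‖ ^ q)) {θ : ℝ} (hθ : θ ∈ Icc 0 α)
    (hsin : 0 < Real.sin (2 * θ)) :
    MemAC12 T fun t x => ∫ y, kern Gext F 0 θ t x y := by
  have hγ : ∀ t ∈ timeInterval T, 0 < 0 * Real.cos (2 * θ) + a t * Real.sin (2 * θ) :=
    fun t ht => by rw [zero_mul, zero_add]; exact mul_pos (hG.a_pos t ht) hsin
  have hdiff : ∀ t ∈ timeInterval T, ∀ x ∈ dotReal,
      DifferentiableAt ℝ (fun x => ∫ y, kern Gext F 0 θ t x y) x := fun t ht x hx =>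
    (hG.hasDerivAt_integral_kern hq hAF hBF hF hFb hθ ht hx (hγ t ht)).2.differentiableAt
  have hderiv := fun t (ht : t ∈ timeInterval T) =>
    (hG.isACDot_deriv_integral hq hAF hBF hF hFb hθ ht (hγ t ht)).1
  refine ⟨fun x hx => (hG.isAC_integral_time hq hAF hBF hF hFb hθ hsin hx).1, fun t ht => ?_,
    hdiff, hderiv⟩
  -- The space derivative is itself absolutely continuous, hence continuous, so the fundamental
  -- theorem of calculus applies.
  have key : ∀ I : Set ℝ, IsOpen I → I.OrdConnected → I ⊆ dotReal →
      IsAC (fun x => ∫ y, kern Gext F 0 θ t x y) I := by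
    intro I hI hI' hsub
    have hc : ContinuousOn (deriv fun x => ∫ y, kern Gext F 0 θ t x y) I :=
      (hderiv t ht).continuousOn.mono hsub
    refine ⟨_, hc.locallyIntegrableOn hI.measurableSet, fun x hx y hy => ?_⟩
    have hu := hI'.uIcc_subset hx hy
    rw [intervalIntegral.integral_eq_sub_of_hasDerivAt
      (fun s hs => (hdiff t ht s (hsub (hu hs))).hasDerivAt) (hc.mono hu).intervalIntegrable]
  exact ⟨key _ isOpen_Iio ordConnected_Iio fun x hx => ne_of_lt hx,
    key _ isOpen_Ioi ordConnected_Ioi fun x hx => ne_of_gt hx⟩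

end KernelIntegrals

/-! ### Joint measurability and exchange of null sets -/

section JointMeasurability

variable {Q : Type*} [MeasurableSpace Q] {k : Q → ℝ → ℝ → ℂ} {U W : Set ℝ}

/-- Joint measurability of a separately continuous function, and of its derivatives, in two real
variables and a parameter. -/
theorem measurable_indicator_prod (hU : IsOpen U) (hW : IsOpen W)
    (hm : ∀ t ∈ U, ∀ x ∈ W, Measurable fun s => k s t x)
    (ht : ∀ s, ∀ x ∈ W, ContinuousOn (fun t => k s t x) U)
    (hx : ∀ s, ∀ t ∈ U, ContinuousOn (k s t) W) :
    Measurable (fun r : Q × ℝ × ℝ => (U ×ˢ W).indicator (fun P => k r.1 P.1 P.2) r.2) ∧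
    Measurable (fun r : Q × ℝ × ℝ =>
      (U ×ˢ W).indicator (fun P => deriv (fun t => k r.1 t P.2) P.1) r.2) ∧
    ((∀ s, ∀ t ∈ U, ContinuousOn (deriv (k s t)) W) → Measurable (fun r : Q × ℝ × ℝ =>
      (U ×ˢ W).indicator (fun P => deriv (deriv (k r.1 P.1)) P.2) r.2)) := by
  classical
  -- first cut off in time, with `(s, t)` as parameter
  let f : Q × ℝ → ℝ → ℂ := fun r x => U.indicator (fun t => k r.1 t x) r.2
  have hf_of_mem : ∀ r : Q × ℝ, r.2 ∈ U → f r = k r.1 r.2 := fun r hr =>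
    funext fun x => indicator_of_mem hr _
  have hf_of_notMem : ∀ r : Q × ℝ, r.2 ∉ U → f r = fun _ => 0 := fun r hr =>
    funext fun x => indicator_of_notMem hr _
  have hfm : ∀ x ∈ W, Measurable fun r => f r x := fun x hxW =>
    measurable_indicator_of_continuousOn (f := fun s t => k s t x) hU
      (fun t htU => hm t htU x hxW) fun s => ht s x hxW
  have hfc : ∀ r, ContinuousOn (f r) W := fun r => by
    by_cases hr : r.2 ∈ U
    · rw [hf_of_mem r hr]; exact hx r.1 r.2 hr
    · rw [hf_of_notMem r hr]; exact continuousOn_const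
  -- then cut off in space, with `(s, x)` as parameter
  let g : Q × ℝ → ℝ → ℂ := fun r t => W.indicator (fun x => k r.1 t x) r.2
  have hgm : ∀ t ∈ U, Measurable fun r => g r t := fun t htU =>
    measurable_indicator_of_continuousOn (f := fun s x => k s t x) hW
      (fun x hxW => hm t htU x hxW) fun s => hx s t htU
  have hgc : ∀ r, ContinuousOn (g r) U := fun r => by
    by_cases hr : r.2 ∈ W
    · have : g r = fun t => k r.1 t r.2 := funext fun t => indicator_of_mem hr _
      rw [this]; exact ht r.1 r.2 hr
    · have : g r = fun _ => 0 := funext fun t => indicator_of_notMem hr _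
      rw [this]; exact continuousOn_const
  have hφ : Measurable fun r : Q × ℝ × ℝ => ((r.1, r.2.1), r.2.2) := by fun_prop
  have hψ : Measurable fun r : Q × ℝ × ℝ => ((r.1, r.2.2), r.2.1) := by fun_prop
  refine ⟨?_, ?_, fun hxx => ?_⟩
  · convert (measurable_indicator_of_continuousOn hW hfm hfc).comp hφ using 1
    funext r
    by_cases h1 : r.2.1 ∈ U <;> by_cases h2 : r.2.2 ∈ W <;>
      simp [f, indicator, h1, h2]
  · convert (measurable_indicator_deriv hU hgm hgc).comp hψ using 1
    funext r
    by_cases h2 : r.2.2 ∈ W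
    · have : g (r.1, r.2.2) = fun t => k r.1 t r.2.2 := funext fun t => indicator_of_mem h2 _
      by_cases h1 : r.2.1 ∈ U <;> simp [indicator, h1, h2, this]
    · have : g (r.1, r.2.2) = fun _ => 0 := funext fun t => indicator_of_notMem h2 _
      simp [indicator, h2, this]
  · have hf'm : ∀ x ∈ W, Measurable fun r => deriv (f r) x := fun x hxW =>
      measurable_deriv_of_measurable_left hW hfm hfc hxW
    have hf'c : ∀ r, ContinuousOn (deriv (f r)) W := fun r => by
      by_cases hr : r.2 ∈ U
      · rw [hf_of_mem r hr]; exact hxx r.1 r.2 hr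
      · rw [hf_of_notMem r hr, deriv_const']; exact continuousOn_const
    convert (measurable_indicator_deriv hW hf'm hf'c).comp hφ using 1
    funext r
    by_cases h1 : r.2.1 ∈ U
    · have := hf_of_mem (r.1, r.2.1) h1
      by_cases h2 : r.2.2 ∈ W <;> simp [indicator, h1, h2, this]
    · have := hf_of_notMem (r.1, r.2.1) h1
      simp [indicator, h1, this]

/-- Exchange of null sets in an identity with a possibly non-measurable multiplier `v`. -/
theorem ae_ae_eq_mul_of_forall_ae {H K : ℝ × ℝ × ℝ → ℂ} (hH : Measurable H) (hK : Measurable K)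
    {v : ℝ × ℝ → ℂ} (h : ∀ y : ℝ, ∀ᵐ P : ℝ × ℝ, H (y, P) = v P * K (y, P))
    (hc : ∀ P, ContinuousOn (fun y => K (y, P)) {0}ᶜ) (h0 : ∀ P, K (0, P) = 0) :
    ∀ᵐ P : ℝ × ℝ, ∀ᵐ y : ℝ, H (y, P) = v P * K (y, P) := by
  have hr : ∀ᵐ P : ℝ × ℝ, ∀ r : ℚ, H ((r : ℝ), P) = v P * K ((r : ℝ), P) :=
    ae_all_iff.2 fun r => h r
  -- Fubini cannot be applied to the identity itself because `v` may be non-measurable. Comparing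
  -- `y` with rational points and cross-multiplying eliminates `v` and leaves a measurable set.
  have hmeas : MeasurableSet {r : ℝ × ℝ × ℝ |
      (∀ s : ℚ, H (r.1, r.2) * K ((s : ℝ), r.2) = H ((s : ℝ), r.2) * K (r.1, r.2)) ∧
      (K (r.1, r.2) = 0 → H (r.1, r.2) = 0)} := by
    have : {r : ℝ × ℝ × ℝ |
        (∀ s : ℚ, H (r.1, r.2) * K ((s : ℝ), r.2) = H ((s : ℝ), r.2) * K (r.1, r.2)) ∧
        (K (r.1, r.2) = 0 → H (r.1, r.2) = 0)}
        = (⋂ s : ℚ, {r | H r * K ((s : ℝ), r.2) = H ((s : ℝ), r.2) * K r}) ∩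
          ({r | K r = 0}ᶜ ∪ {r | H r = 0}) := by
      ext r; simp [imp_iff_not_or]
    rw [this]
    refine (MeasurableSet.iInter fun s => measurableSet_eq_fun ?_ ?_).inter
      ((measurableSet_eq_fun hK measurable_const).compl.union
        (measurableSet_eq_fun hH measurable_const))
    · exact hH.mul (hK.comp (measurable_const.prodMk measurable_snd))
    · exact (hH.comp (measurable_const.prodMk measurable_snd)).mul hK
  have hswap := (Measure.ae_ae_comm (μ := (volume : Measure ℝ)) (ν := (volume : Measure (ℝ × ℝ)))
    (p := fun y P => (∀ s : ℚ, H (y, P) * K ((s : ℝ), P) = H ((s : ℝ), P) * K (y, P)) ∧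
      (K (y, P) = 0 → H (y, P) = 0)) hmeas).1 (Eventually.of_forall fun y => by
        filter_upwards [hr, h y] with P h1 h2
        refine ⟨fun s => by rw [h1 s, h2]; ring, fun h3 => by rw [h2, h3, mul_zero]⟩)
  filter_upwards [hr, hswap] with P h1 h2
  -- A rational point with `K ≠ 0` determines `v P`, and cancelling recovers the identity. Otherwise
  -- `K` vanishes at all rationals, hence everywhere by continuity off `0`, and the second condition
  -- gives `H = 0`.
  by_cases hex : ∃ s : ℚ, K ((s : ℝ), P) ≠ 0
  · obtain ⟨s, hs⟩ := hex
    filter_upwards [h2] with y hy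
    have := hy.1 s
    rw [h1 s] at this
    exact mul_right_cancel₀ hs (by rw [this]; ring)
  · push Not at hex
    filter_upwards [h2] with y hy
    have hKy : K (y, P) = 0 := by
      by_cases hy0 : y = 0
      · rw [hy0, h0]
      · have hcl : y ∈ closure ({0}ᶜ ∩ range ((↑) : ℚ → ℝ)) :=
          Rat.denseRange_cast.open_subset_closure_inter isOpen_compl_singleton hy0
        have h3 := ((hc P y hy0).mono
          (inter_subset_left (t := range ((↑) : ℚ → ℝ)))).mem_closure_image hcl
        have hsub : (fun y => K (y, P)) '' ({0}ᶜ ∩ range ((↑) : ℚ → ℝ)) ⊆ {0} := by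
          rintro _ ⟨_, ⟨_, s, rfl⟩, rfl⟩
          exact hex s
        exact closure_minimal hsub isClosed_singleton h3
    rw [hy.2 hKy, hKy, mul_zero]

/-- Measurability of this set allows null sets known on every horizontal or every vertical line to
be combined into a planar null set. -/
theorem measurableSet_integrable_and_eq {D : ℝ × ℝ × ℝ → ℂ} {φ : ℝ × ℝ → ℂ} (hD : Measurable D)
    (hφ : Measurable φ) :
    MeasurableSet {P : ℝ × ℝ | Integrable (fun y : ℝ => D (y, P)) ∧ φ P = ∫ y : ℝ, D (y, P)} := by
  have hs : StronglyMeasurable (Function.uncurry fun (P : ℝ × ℝ) (y : ℝ) => D (y, P)) :=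
    (hD.comp measurable_swap).stronglyMeasurable
  exact (measurableSet_integrable hs).inter
    (measurableSet_eq_fun hφ hs.integral_prod_right.measurable)

theorem ae_prod_integrable_and_eq_of_snd {D : ℝ × ℝ × ℝ → ℂ} {φ : ℝ × ℝ → ℂ} (hD : Measurable D)
    (hφ : Measurable φ) (h : ∀ t : ℝ, ∀ᵐ x : ℝ, Integrable (fun y : ℝ => D (y, t, x)) ∧
      φ (t, x) = ∫ y : ℝ, D (y, t, x)) :
    ∀ᵐ P : ℝ × ℝ, Integrable (fun y : ℝ => D (y, P)) ∧ φ P = ∫ y : ℝ, D (y, P) :=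
  (Measure.ae_prod_mem_iff_ae_ae_mem (measurableSet_integrable_and_eq hD hφ)).2
    (Eventually.of_forall h)

theorem ae_mem_of_forall_ae_fst {S : Set (ℝ × ℝ)} (hS : MeasurableSet S)
    (h : ∀ x : ℝ, ∀ᵐ t : ℝ, (t, x) ∈ S) : ∀ᵐ P : ℝ × ℝ, P ∈ S := by
  refine (Measure.ae_prod_mem_iff_ae_ae_mem hS).2 ?_
  exact (Measure.ae_ae_comm (p := fun t x => (t, x) ∈ S) hS).2 (Eventually.of_forall h)

theorem ae_prod_integrable_and_eq_of_fst {D : ℝ × ℝ × ℝ → ℂ} {φ : ℝ × ℝ → ℂ} (hD : Measurable D)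
    (hφ : Measurable φ) (h : ∀ x : ℝ, ∀ᵐ t : ℝ, Integrable (fun y : ℝ => D (y, t, x)) ∧
      φ (t, x) = ∫ y : ℝ, D (y, t, x)) :
    ∀ᵐ P : ℝ × ℝ, Integrable (fun y : ℝ => D (y, P)) ∧ φ P = ∫ y : ℝ, D (y, P) :=
  ae_mem_of_forall_ae_fst (measurableSet_integrable_and_eq hD hφ) h

end JointMeasurability

/-! ### The Schroedinger equation for the integral -/

section Schroedinger

variable {T : EReal} {V : ℝ → ℝ → ℂ} {M N : Matrix (Fin 2) (Fin 2) ℂ} {G : ℝ → ℝ → ℝ → ℂ}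
  {α : ℝ} {Gext : ℝ → ℝ → ℂ → ℂ} {a : ℝ → ℝ} {Gt : ℝ → ℝ → ℂ → ℂ} {p : ℝ}
  {A B : Fin 3 → ℝ → ℝ → ℝ} {F : ℂ → ℂ} {q AF BF : ℝ}

theorem GreenAssumption.ae_schroedinger_kern (hG : GreenAssumption T V M N G α Gext a Gt p A B)
    (ε : ℝ) {θ : ℝ} (hθ : θ ∈ Icc 0 α) (y : ℝ) :
    ∀ᵐ P : ℝ × ℝ, P ∈ timeInterval T ×ˢ dotReal →
      Complex.I * deriv (fun τ => kern Gext F ε θ τ P.2 y) P.1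
        + deriv (deriv fun ξ => kern Gext F ε θ P.1 ξ y) P.2
      = V P.1 P.2 * kern Gext F ε θ P.1 P.2 y := by
  by_cases hy : y = 0
  · refine Eventually.of_forall fun P _ => ?_
    rw [deriv_time_kern, deriv_deriv_kern, kern, hy, weight_zero]
    simp
  · filter_upwards [hG.schroedinger _ (contour_mem_doubleSector hG.angle hθ hy)] with P hP hPm
    rw [deriv_time_kern, deriv_deriv_kern, kern]
    linear_combination (weight F ε θ y) * hP hPm.1 hPm.2

/-- The Schroedinger equation for the integral over the rotated line. -/
theorem GreenAssumption.schroedinger_integral (hG : GreenAssumption T V M N G α Gext a Gt p A B)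
    (hq : q ∈ Ioo (0 : ℝ) 2) (hAF : 0 ≤ AF) (hBF : 0 ≤ BF) (hF : Continuous F)
    (hFb : ∀ z, ‖F z‖ ≤ AF * Real.exp (BF * ‖z‖ ^ q)) {θ : ℝ} (hθ : θ ∈ Icc 0 α)
    (hsin : 0 < Real.sin (2 * θ)) :
    SatisfiesSchroedinger T V fun t x => ∫ y, kern Gext F 0 θ t x y := by
  classical
  set Ω : Set (ℝ × ℝ) := timeInterval T ×ˢ dotReal with hΩ
  have hI := isOpen_timeInterval T
  have hI' := ordConnected_timeInterval T
  have hmem := hG.memAC12_integral hq hAF hBF hF hFb hθ hsin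
  obtain ⟨mK, mDt, mDxx⟩ := measurable_indicator_prod (k := fun y t x => kern Gext F 0 θ t x y)
    hI isOpen_dotReal (fun t ht x hx => hG.measurable_kern hF 0 hθ ht hx)
    (fun y x hx => (hG.isAC_kern_time 0 hθ hx y).continuousOn hI hI')
    (fun y t ht => hG.continuousOn_kern_space 0 hθ ht y)
  replace mDxx := mDxx fun y t ht => (hG.isACDot_deriv_kern 0 hθ ht y).continuousOn
  -- The integral carries no parameter any more, so the parameter space is a point.
  obtain ⟨-, nDt, nDxx⟩ := measurable_indicator_prod (Q := Unit)
    (k := fun _ t x => ∫ y, kern Gext F 0 θ t x y)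
    hI isOpen_dotReal (fun t ht x hx => measurable_const)
    (fun _ x hx => (hmem.time x hx).continuousOn hI hI')
    (fun _ t ht => (hmem.space t ht).continuousOn)
  replace nDxx := nDxx fun _ t ht => (hmem.space_deriv t ht).continuousOn
  set K : ℝ × ℝ × ℝ → ℂ := fun r => Ω.indicator (fun P => kern Gext F 0 θ P.1 P.2 r.1) r.2 with hK
  set Dt : ℝ × ℝ × ℝ → ℂ := fun r =>
    Ω.indicator (fun P => deriv (fun t => kern Gext F 0 θ t P.2 r.1) P.1) r.2 with hDt
  set Dxx : ℝ × ℝ × ℝ → ℂ := fun r =>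
    Ω.indicator (fun P => deriv (deriv fun x => kern Gext F 0 θ P.1 x r.1) P.2) r.2 with hDxx
  set Φt : ℝ × ℝ → ℂ :=
    Ω.indicator fun P => deriv (fun t => ∫ y, kern Gext F 0 θ t P.2 y) P.1 with hΦt
  set Φxx : ℝ × ℝ → ℂ :=
    Ω.indicator fun P => deriv (deriv fun x => ∫ y, kern Gext F 0 θ P.1 x y) P.2 with hΦxx
  have nDt' : Measurable Φt := nDt.comp (measurable_prodMk_left (x := ()))
  have nDxx' : Measurable Φxx := nDxx.comp (measurable_prodMk_left (x := ()))
  -- The hypothesis gives a null set of `P` for each `y`; integrating the equation in `y` needs a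
  -- null set of `y` for almost each `P`.
  have hpde : ∀ᵐ P : ℝ × ℝ, ∀ᵐ y : ℝ,
      Complex.I * Dt (y, P) + Dxx (y, P) = V P.1 P.2 * K (y, P) := by
    refine ae_ae_eq_mul_of_forall_ae (H := fun r => Complex.I * Dt r + Dxx r)
      (v := fun P => V P.1 P.2) ((mDt.const_mul _).add mDxx) mK (fun y => ?_) (fun P => ?_)
      fun P => ?_
    · filter_upwards [hG.ae_schroedinger_kern (F := F) 0 hθ y] with P hP
      by_cases hPm : P ∈ Ω
      · simp only [hK, hDt, hDxx, indicator_of_mem hPm]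
        exact hP hPm
      · simp only [hK, hDt, hDxx, indicator_of_notMem hPm]
        simp
    · by_cases hPm : P ∈ Ω
      · simp only [hK, indicator_of_mem hPm]
        exact hG.continuousOn_kern hF 0 hθ hPm.1 hPm.2
      · simp only [hK, indicator_of_notMem hPm]
        exact continuousOn_const
    · simp only [hK, kern_zero, indicator_zero]
  -- The time derivative is under control for each `x` and almost every `t`, the second space
  -- derivative below for each `t` and almost every `x`.
  have ht_ae : ∀ᵐ P : ℝ × ℝ, Integrable (fun y => Dt (y, P)) ∧ Φt P = ∫ y, Dt (y, P) := by
    refine ae_prod_integrable_and_eq_of_fst mDt nDt' fun x => ?_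
    by_cases hx : x ∈ dotReal
    · filter_upwards [(hG.isAC_integral_time hq hAF hBF hF hFb hθ hsin hx).2] with t h
      by_cases ht : t ∈ timeInterval T
      · simp only [hDt, hΦt, indicator_of_mem (show (t, x) ∈ Ω from ⟨ht, hx⟩)]
        exact h ht
      · simp only [hDt, hΦt, indicator_of_notMem (show (t, x) ∉ Ω from fun h => ht h.1)]
        simp
    · refine Eventually.of_forall fun t => ?_
      simp only [hDt, hΦt, indicator_of_notMem (show (t, x) ∉ Ω from fun h => hx h.2)]
      simp
  have hxx_ae : ∀ᵐ P : ℝ × ℝ, Integrable (fun y => Dxx (y, P)) ∧ Φxx P = ∫ y, Dxx (y, P) := by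
    refine ae_prod_integrable_and_eq_of_snd mDxx nDxx' fun t => ?_
    by_cases ht : t ∈ timeInterval T
    · have hγ : 0 < 0 * Real.cos (2 * θ) + a t * Real.sin (2 * θ) := by
        rw [zero_mul, zero_add]; exact mul_pos (hG.a_pos t ht) hsin
      filter_upwards [(hG.isACDot_deriv_integral hq hAF hBF hF hFb hθ ht hγ).2] with x h
      by_cases hx : x ∈ dotReal
      · simp only [hDxx, hΦxx, indicator_of_mem (show (t, x) ∈ Ω from ⟨ht, hx⟩)]
        exact h hx
      · simp only [hDxx, hΦxx,
          indicator_of_notMem (show (t, x) ∉ Ω from fun h => hx h.2)]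
        simp
    · refine Eventually.of_forall fun x => ?_
      simp only [hDxx, hΦxx, indicator_of_notMem (show (t, x) ∉ Ω from fun h => ht h.1)]
      simp
  filter_upwards [hpde, ht_ae, hxx_ae] with P h1 h2 h3 hP1 hP2
  have hPm : P ∈ Ω := ⟨hP1, hP2⟩
  have e1 : ∫ y, (Complex.I * Dt (y, P) + Dxx (y, P)) = ∫ y, V P.1 P.2 * K (y, P) :=
    integral_congr_ae h1
  rw [integral_add (h2.1.const_mul _) h3.1, integral_const_mul, integral_const_mul, ← h2.2,
    ← h3.2] at e1
  simp only [hΦt, hΦxx, hK, indicator_of_mem hPm] at e1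
  linear_combination e1

end Schroedinger

/-! ### The wave function as an integral over a rotated line -/

section Representation

variable {T : EReal} {V : ℝ → ℝ → ℂ} {M N : Matrix (Fin 2) (Fin 2) ℂ} {G : ℝ → ℝ → ℝ → ℂ}
  {α : ℝ} {Gext : ℝ → ℝ → ℂ → ℂ} {a : ℝ → ℝ} {Gt : ℝ → ℝ → ℂ → ℂ} {p : ℝ}
  {A B : Fin 3 → ℝ → ℝ → ℝ} {F : ℂ → ℂ} {q AF BF : ℝ}

theorem integral_eq_interval_add_tails {f : ℝ → ℂ} (hf : Integrable f) (s : ℝ) :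
    ∫ y, f y = (∫ y in (-s)..s, f y) + (∫ r in Ioi (0 : ℝ), f (s + r))
      + ∫ r in Ioi (0 : ℝ), f (-(s + r)) := by
  have hshift : ∀ g : ℝ → ℂ, ∫ y in Ioi s, g y = ∫ r in Ioi (0 : ℝ), g (s + r) := fun g => by
    have := (measurePreserving_add_left (volume : Measure ℝ) s).setIntegral_preimage_emb
      (measurableEmbedding_addLeft s) g (Ioi s)
    rw [← this]
    congr 2
    ext r
    simp
  rw [← hshift f, ← hshift fun y => f (-y), integral_comp_neg_Ioi,
    intervalIntegral.integral_interval_add_Ioi hf.integrableOn hf.integrableOn, add_comm,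
    intervalIntegral.integral_Iic_add_Ioi hf.integrableOn hf.integrableOn]

theorem GreenAssumption.sectorGaussian_right
    (hG : GreenAssumption T V M N G α Gext a Gt p A B) (hF : Differentiable ℂ F)
    (hFb : ∀ z, ‖F z‖ ≤ AF * Real.exp (BF * ‖z‖ ^ q)) {t x : ℝ}
    (ht : t ∈ timeInterval T) (hx : x ∈ dotReal) :
    SectorGaussian α (fun z => Gext t x z * F z) (a t) x (A 0 t x * AF) (B 0 t x) p BF q := by
  refine ⟨ContinuousOn.mul ?_ hF.continuous.continuousOn, DifferentiableOn.mul ?_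
    hF.differentiableOn, fun z hz => ?_⟩
  · exact (hG.continuousOn t ht x hx).mono fun z hz =>
      (mem_doubleSector_of_mem_sectorCone hG.angle hz).1
  · exact (hG.holomorphic t ht x hx).mono fun z hz =>
      (mem_interior_of_mem_openSectorCone hG.angle hz).1
  · have hz' := (mem_doubleSector_of_mem_sectorCone hG.angle hz).1
    have h1 := hG.bound t ht x hx z hz'
    have h2 := hFb z
    rw [hG.decomposition t ht x hx z hz', norm_mul, norm_mul, norm_exp_I_mul_sq]
    calc _ ≤ Real.exp (-a t * ((z - x) ^ 2).im) * (A 0 t x * Real.exp (B 0 t x * ‖z‖ ^ p))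
          * (AF * Real.exp (BF * ‖z‖ ^ q)) := by
          refine mul_le_mul (mul_le_mul_of_nonneg_left h1 (Real.exp_pos _).le) h2 (norm_nonneg _) ?_
          exact mul_nonneg (Real.exp_pos _).le ((norm_nonneg _).trans h1)
      _ = _ := by rw [Real.exp_add, Real.exp_add]; ring

/-- Reflection `z ↦ -z` carries the left half of the double sector to the right half and the centre
`x` to `-x`, so only right-hand rays need to be treated. -/
theorem GreenAssumption.sectorGaussian_left
    (hG : GreenAssumption T V M N G α Gext a Gt p A B) (hF : Differentiable ℂ F)
    (hFb : ∀ z, ‖F z‖ ≤ AF * Real.exp (BF * ‖z‖ ^ q)) {t x : ℝ}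
    (ht : t ∈ timeInterval T) (hx : x ∈ dotReal) :
    SectorGaussian α (fun z => Gext t x (-z) * F (-z)) (a t) (-x) (A 0 t x * AF) (B 0 t x) p BF
      q := by
  refine ⟨ContinuousOn.mul ?_ (hF.continuous.comp continuous_neg).continuousOn,
    DifferentiableOn.mul ?_ (hF.comp differentiable_neg).differentiableOn, fun z hz => ?_⟩
  · exact (hG.continuousOn t ht x hx).comp continuous_neg.continuousOn fun z hz =>
      (mem_doubleSector_of_mem_sectorCone hG.angle hz).2
  · exact (hG.holomorphic t ht x hx).comp differentiable_neg.differentiableOn fun z hz =>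
      (mem_interior_of_mem_openSectorCone hG.angle hz).2
  · have hz' := (mem_doubleSector_of_mem_sectorCone hG.angle hz).2
    have h1 := hG.bound t ht x hx _ hz'
    have h2 := hFb (-z)
    have h3 : (-z - (x : ℂ)) ^ 2 = (z - ((-x : ℝ) : ℂ)) ^ 2 := by push_cast; ring
    rw [norm_neg] at h1 h2
    rw [hG.decomposition t ht x hx _ hz', norm_mul, norm_mul, norm_exp_I_mul_sq, h3]
    calc _ ≤ Real.exp (-a t * ((z - ((-x : ℝ) : ℂ)) ^ 2).im)
          * (A 0 t x * Real.exp (B 0 t x * ‖z‖ ^ p)) * (AF * Real.exp (BF * ‖z‖ ^ q)) := by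
          refine mul_le_mul (mul_le_mul_of_nonneg_left h1 (Real.exp_pos _).le) h2 (norm_nonneg _) ?_
          exact mul_nonneg (Real.exp_pos _).le ((norm_nonneg _).trans h1)
      _ = _ := by rw [Real.exp_add, Real.exp_add]; ring

theorem contour_zero_left (y : ℝ) : contour 0 y = y := by simp [contour]

theorem weight_zero_left (F : ℂ → ℂ) (ε : ℝ) {y : ℝ} (hy : y ≠ 0) :
    weight F ε 0 y = Complex.exp (-(ε : ℂ) * (y : ℂ) ^ 2) * F y := by
  rw [weight, if_neg hy, contour_zero_left]
  simp

theorem kern_zero_left (Gext : ℝ → ℝ → ℂ → ℂ) (F : ℂ → ℂ) (ε t x : ℝ) {y : ℝ} (hy : y ≠ 0) :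
    kern Gext F ε 0 t x y = Complex.exp (-(ε : ℂ) * (y : ℂ) ^ 2) * (Gext t x y * F y) := by
  rw [kern, weight_zero_left F ε hy, contour_zero_left]
  ring

theorem pos_coefficient {α : ℝ} (hα : α ∈ Ioo 0 (Real.pi / 2)) {ε b θ : ℝ} (hε : 0 < ε)
    (hb : 0 ≤ b) (hθ : θ ∈ Icc 0 (α / 2)) :
    0 < ε * Real.cos (2 * θ) + b * Real.sin (2 * θ) := by
  have hcos : 0 < Real.cos (2 * θ) := Real.cos_pos_of_mem_Ioo
    ⟨by linarith [hθ.1, Real.pi_pos], by linarith [hθ.2, hα.2]⟩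
  have hsin : 0 ≤ Real.sin (2 * θ) := Real.sin_nonneg_of_nonneg_of_le_pi (by linarith [hθ.1])
    (by linarith [hα.2, Real.pi_pos, hθ.2])
  positivity

theorem half_mem_Icc {α : ℝ} (hα : α ∈ Ioo 0 (Real.pi / 2)) : α / 2 ∈ Icc 0 α :=
  ⟨by linarith [hα.1], by linarith [hα.1]⟩

theorem sin_two_mul_half_pos {α : ℝ} (hα : α ∈ Ioo 0 (Real.pi / 2)) :
    0 < Real.sin (2 * (α / 2)) := by
  rw [mul_div_cancel₀ _ two_ne_zero]
  exact Real.sin_pos_of_pos_of_lt_pi hα.1 (by linarith [hα.2, Real.pi_pos])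

theorem GreenAssumption.regIntegrand_eq (hG : GreenAssumption T V M N G α Gext a Gt p A B)
    (F : ℂ → ℂ) {ε t x y : ℝ} (ht : t ∈ timeInterval T) (hx : x ∈ dotReal) (hy : y ≠ 0) :
    regIntegrand G F t x ε y = kern Gext F ε 0 t x y := by
  rw [kern_zero_left _ _ _ _ _ hy, regIntegrand, hG.extends_G t ht x hx y hy]
  push_cast
  ring

theorem GreenAssumption.regIntegrand_ae_eq (hG : GreenAssumption T V M N G α Gext a Gt p A B)
    (F : ℂ → ℂ) {ε t x : ℝ} (ht : t ∈ timeInterval T) (hx : x ∈ dotReal) :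
    regIntegrand G F t x ε =ᵐ[volume] kern Gext F ε 0 t x := by
  filter_upwards [Measure.ae_ne volume (0 : ℝ)] with y hy using hG.regIntegrand_eq F ht hx hy

/-- The regularised integral over the real line, split at the points `±s`. -/
theorem GreenAssumption.integral_kern_real (hG : GreenAssumption T V M N G α Gext a Gt p A B)
    (hq : q ∈ Ioo (0 : ℝ) 2) (hAF : 0 ≤ AF) (hBF : 0 ≤ BF) (hF : Differentiable ℂ F)
    (hFb : ∀ z, ‖F z‖ ≤ AF * Real.exp (BF * ‖z‖ ^ q)) {ε t x s : ℝ} (hs : 0 ≤ s)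
    (ht : t ∈ timeInterval T) (hx : x ∈ dotReal) (hε : 0 < ε) :
    ∫ y, kern Gext F ε 0 t x y = (∫ y in (-s)..s, kern Gext F ε 0 t x y)
      + (∫ r in Ioi (0 : ℝ), Complex.exp (-(ε : ℂ) * ((s : ℂ) + r) ^ 2) *
          (Gext t x ((s : ℂ) + r) * F ((s : ℂ) + r)))
      + ∫ r in Ioi (0 : ℝ), Complex.exp (-(ε : ℂ) * ((s : ℂ) + r) ^ 2) *
          (Gext t x (-((s : ℂ) + r)) * F (-((s : ℂ) + r))) := by
  have hα := hG.angle
  rw [integral_eq_interval_add_tails (hG.integrable_kern hq hAF hBF hF.continuous hFb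
    ⟨le_rfl, hα.1.le⟩ ht hx (pos_coefficient hα hε (hG.a_pos t ht).le
      ⟨le_rfl, (half_pos hα.1).le⟩)) s]
  congr 1
  · congr 1
    refine setIntegral_congr_fun measurableSet_Ioi fun r hr => ?_
    have hr' : (0 : ℝ) < r := hr
    simp only [kern_zero_left Gext F ε t x (show s + r ≠ 0 by positivity)]
    push_cast
    rfl
  · refine setIntegral_congr_fun measurableSet_Ioi fun r hr => ?_
    have hr' : (0 : ℝ) < r := hr
    simp only [kern_zero_left Gext F ε t x (show -(s + r) ≠ 0 from neg_ne_zero.2 (by positivity))]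
    push_cast
    rw [neg_sq]

theorem GreenAssumption.integral_kern_contour (hG : GreenAssumption T V M N G α Gext a Gt p A B)
    (hq : q ∈ Ioo (0 : ℝ) 2) (hAF : 0 ≤ AF) (hBF : 0 ≤ BF) (hF : Differentiable ℂ F)
    (hFb : ∀ z, ‖F z‖ ≤ AF * Real.exp (BF * ‖z‖ ^ q)) {ε θ t x : ℝ} (hθ : θ ∈ Icc 0 α)
    (ht : t ∈ timeInterval T) (hx : x ∈ dotReal)
    (hγ : 0 < ε * Real.cos (2 * θ) + a t * Real.sin (2 * θ)) :
    ∫ y, kern Gext F ε θ t x y =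
      (∫ r in Ioi (0 : ℝ), Complex.exp (θ * Complex.I) *
        (Complex.exp (-(ε : ℂ) * contour θ r ^ 2) * (Gext t x (contour θ r) * F (contour θ r))))
      + ∫ r in Ioi (0 : ℝ), Complex.exp (θ * Complex.I) * (Complex.exp (-(ε : ℂ) * contour θ r ^ 2)
        * (Gext t x (-contour θ r) * F (-contour θ r))) := by
  rw [integral_eq_interval_add_tails (hG.integrable_kern hq hAF hBF hF.continuous hFb
    hθ ht hx hγ) 0, neg_zero, intervalIntegral.integral_same, zero_add]
  congr 1
  · refine setIntegral_congr_fun measurableSet_Ioi fun r hr => ?_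
    have hr' : r ≠ 0 := ne_of_gt hr
    simp only [zero_add, kern, weight, if_neg hr']
    ring
  · refine setIntegral_congr_fun measurableSet_Ioi fun r hr => ?_
    have hr' : -r ≠ 0 := neg_ne_zero.2 (ne_of_gt hr)
    simp only [zero_add, kern, weight, if_neg hr', contour_neg, neg_sq]
    ring

/-- Both half-lines from the origin are rotated by `α/2`, the negative one after reflection. -/
theorem GreenAssumption.integral_kern_rotate (hG : GreenAssumption T V M N G α Gext a Gt p A B)
    (hq : q ∈ Ioo (0 : ℝ) 2) (hAF : 0 ≤ AF) (hBF : 0 ≤ BF) (hF : Differentiable ℂ F)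
    (hFb : ∀ z, ‖F z‖ ≤ AF * Real.exp (BF * ‖z‖ ^ q)) {ε t x : ℝ}
    (ht : t ∈ timeInterval T) (hx : x ∈ dotReal) (hε : 0 < ε) :
    ∫ y, kern Gext F ε 0 t x y = ∫ y, kern Gext F ε (α / 2) t x y := by
  have hα := hG.angle
  have ha := (hG.a_pos t ht).le
  have hA : 0 ≤ A 0 t x * AF := mul_nonneg (hG.A_nonneg 0 t ht x hx) hAF
  have hB := hG.B_nonneg 0 t ht x hx
  have h1 := (hG.sectorGaussian_right hF hFb ht hx).integral_eq hα ha hB hBF hA hG.order hq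
    le_rfl hε
  have h2 := (hG.sectorGaussian_left hF hFb ht hx).integral_eq hα ha hB hBF hA hG.order hq
    le_rfl hε
  rw [hG.integral_kern_real hq hAF hBF hF hFb le_rfl ht hx hε, h1, h2,
    hG.integral_kern_contour hq hAF hBF hF hFb (half_mem_Icc hα) ht hx
      (pos_coefficient hα hε ha ⟨(half_pos hα.1).le, le_rfl⟩)]
  simp only [neg_zero, intervalIntegral.integral_same, zero_add, Complex.ofReal_zero, contour]

/-- The regularised integrals converge, and the limit is an integral over the real interval
`[-s, s]` and two rotated rays. -/
theorem GreenAssumption.tendsto_integral_kern_split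
    (hG : GreenAssumption T V M N G α Gext a Gt p A B)
    (hq : q ∈ Ioo (0 : ℝ) 2) (hAF : 0 ≤ AF) (hBF : 0 ≤ BF) (hF : Differentiable ℂ F)
    (hFb : ∀ z, ‖F z‖ ≤ AF * Real.exp (BF * ‖z‖ ^ q)) {t x s : ℝ} (hs : 0 ≤ s)
    (ht : t ∈ timeInterval T) (hx : x ∈ dotReal) :
    Tendsto (fun ε => ∫ y, kern Gext F ε 0 t x y) (𝓝[>] 0)
      (𝓝 ((∫ y in (-s)..s, G t x y * F y)
      + (∫ r in Ioi (0 : ℝ), Complex.exp ((α / 2 : ℝ) * Complex.I) *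
          (Gext t x ((s : ℂ) + r * Complex.exp ((α / 2 : ℝ) * Complex.I))
            * F ((s : ℂ) + r * Complex.exp ((α / 2 : ℝ) * Complex.I))))
      + ∫ r in Ioi (0 : ℝ), Complex.exp ((α / 2 : ℝ) * Complex.I) *
          (Gext t x (-((s : ℂ) + r * Complex.exp ((α / 2 : ℝ) * Complex.I)))
            * F (-((s : ℂ) + r * Complex.exp ((α / 2 : ℝ) * Complex.I)))))) := by
  have hα := hG.angle
  have ha := hG.a_pos t ht
  have hA : 0 ≤ A 0 t x * AF := mul_nonneg (hG.A_nonneg 0 t ht x hx) hAF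
  have hB := hG.B_nonneg 0 t ht x hx
  have hp := hG.order
  have h1 := (hG.sectorGaussian_right hF hFb ht hx).tendsto_integral hα ha hB hBF hA hp hq hs
  have h2 := (hG.sectorGaussian_left hF hFb ht hx).tendsto_integral hα ha hB hBF hA hp hq hs
  have hev : ∀ᶠ ε : ℝ in 𝓝[>] 0, 0 < ε := self_mem_nhdsWithin
  refine (tendsto_congr' (hev.mono fun ε hε =>
    hG.integral_kern_real hq hAF hBF hF hFb hs ht hx hε)).2 (Tendsto.add (Tendsto.add ?_ h1) h2)
  -- On the real interval the phase has modulus one and the regularisation at most one, so a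
  -- constant dominates.
  refine intervalIntegral.tendsto_integral_filter_of_dominated_convergence
    (fun _ => A 0 t x * Real.exp (B 0 t x * s ^ p) * (AF * Real.exp (BF * s ^ q))) ?_ ?_ ?_ ?_
  · exact Eventually.of_forall fun ε => (hG.measurable_kern hF.continuous ε
      ⟨le_rfl, hα.1.le⟩ ht hx).aestronglyMeasurable
  · filter_upwards [hev] with ε hε
    refine Eventually.of_forall fun y hy => ?_
    rw [uIoc_of_le (by linarith)] at hy
    have hys : |y| ≤ s := abs_le.2 ⟨hy.1.le, hy.2⟩
    have hA0 := hG.A_nonneg 0 t ht x hx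
    by_cases hy0 : y = 0
    · rw [hy0, kern_zero, norm_zero]
      positivity
    · have hz := contour_mem_doubleSector hα (θ := 0) ⟨le_rfl, hα.1.le⟩ hy0
      have hb := hG.bound t ht x hx _ hz
      have hFz := hFb (contour 0 y)
      rw [norm_contour] at hb hFz
      rw [contour_zero_left] at hz hb hFz
      have hr : ((y : ℂ) ^ 2).re = y ^ 2 := by rw [← Complex.ofReal_pow, Complex.ofReal_re]
      have hi : (((y : ℂ) - x) ^ 2).im = 0 := by
        rw [← Complex.ofReal_sub, ← Complex.ofReal_pow, Complex.ofReal_im]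
      rw [kern_zero_left _ _ _ _ _ hy0, hG.decomposition t ht x hx _ hz, norm_mul, norm_mul,
        norm_mul, norm_exp_neg_mul_sq, norm_exp_I_mul_sq, hr, hi, mul_zero, Real.exp_zero, one_mul]
      have hle1 : Real.exp (-ε * y ^ 2) ≤ 1 := by
        rw [Real.exp_le_one_iff, neg_mul, neg_nonpos]; positivity
      have hb' : ‖Gt t x y‖ ≤ A 0 t x * Real.exp (B 0 t x * s ^ p) := hb.trans (by
        have := hp.1.le; gcongr)
      have hF' : ‖F y‖ ≤ AF * Real.exp (BF * s ^ q) := hFz.trans (by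
        have := hq.1.le; gcongr)
      calc _ ≤ 1 * (‖Gt t x y‖ * ‖F y‖) := by gcongr
        _ ≤ _ := by rw [one_mul]; gcongr
  · exact intervalIntegrable_const
  · filter_upwards [Measure.ae_ne volume (0 : ℝ)] with y hy _
    have h3 : Tendsto (fun ε : ℝ => Complex.exp (-(ε : ℂ) * (y : ℂ) ^ 2)) (𝓝[>] 0) (𝓝 1) := by
      have : Continuous fun ε : ℝ => Complex.exp (-(ε : ℂ) * (y : ℂ) ^ 2) := by fun_prop
      simpa using (this.tendsto 0).mono_left nhdsWithin_le_nhds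
    simp only [kern_zero_left _ _ _ _ _ hy, hG.extends_G t ht x hx y hy]
    simpa using h3.mul_const (G t x y * F y)

/-- For `s = 0` the middle interval degenerates and the two rays form the full rotated line. -/
theorem GreenAssumption.tendsto_integral_kern (hG : GreenAssumption T V M N G α Gext a Gt p A B)
    (hq : q ∈ Ioo (0 : ℝ) 2) (hAF : 0 ≤ AF) (hBF : 0 ≤ BF) (hF : Differentiable ℂ F)
    (hFb : ∀ z, ‖F z‖ ≤ AF * Real.exp (BF * ‖z‖ ^ q)) {t x : ℝ}
    (ht : t ∈ timeInterval T) (hx : x ∈ dotReal) :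
    Tendsto (fun ε => ∫ y, kern Gext F ε 0 t x y) (𝓝[>] 0)
      (𝓝 (∫ y, kern Gext F 0 (α / 2) t x y)) := by
  have hα := hG.angle
  have h := hG.tendsto_integral_kern_split hq hAF hBF hF hFb le_rfl ht hx
  convert h using 2
  rw [hG.integral_kern_contour hq hAF hBF hF hFb (half_mem_Icc hα) ht hx (by
    rw [zero_mul, zero_add]; exact mul_pos (hG.a_pos t ht) (sin_two_mul_half_pos hα))]
  simp only [neg_zero, intervalIntegral.integral_same, zero_add, Complex.ofReal_zero, contour,
    zero_mul, Complex.exp_zero, one_mul]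

end Representation

/-! ### Exchange of limits -/

section Limits

/-- Exchange of limits: if `g ε → f` uniformly near `l` as `ε → 0⁺` and every `g ε` has a limit
`L ε` along `l`, then `f` has a limit along `l`, which is the limit of `L`. -/
theorem exists_tendsto_of_uniform {l : Filter ℝ} [l.NeBot] {f : ℝ → ℂ} {g : ℝ → ℝ → ℂ}
    {L : ℝ → ℂ} {δ : ℝ → ℝ} (hδ : Tendsto δ (𝓝[>] 0) (𝓝 0))
    (hu : ∀ ε, 0 < ε → ∀ᶠ x in l, ‖g ε x - f x‖ ≤ δ ε)
    (hg : ∀ ε, 0 < ε → Tendsto (g ε) l (𝓝 (L ε))) :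
    ∃ c, Tendsto f l (𝓝 c) ∧ Tendsto L (𝓝[>] 0) (𝓝 c) := by
  have hev : ∀ᶠ ε : ℝ in 𝓝[>] 0, 0 < ε := self_mem_nhdsWithin
  -- The limit of `f` is not known in advance. Choosing `ε` with `δ ε < e / 4` puts `f` eventually
  -- within `e / 2` of `L ε`, which gives the Cauchy property.
  have hcauchy : Cauchy (map f l) := by
    rw [Metric.cauchy_iff]
    refine ⟨inferInstance, fun e he => ?_⟩
    obtain ⟨ε, hε, hεδ⟩ := (hev.and (hδ.eventually (gt_mem_nhds (show 0 < e / 4 by positivity)))).exists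
    refine ⟨Metric.ball (L ε) (e / 2), ?_, fun x hx y hy => ?_⟩
    · rw [mem_map]
      filter_upwards [hu ε hε, Metric.tendsto_nhds.1 (hg ε hε) (e / 4) (by positivity)] with x h1 h2
      rw [mem_preimage, Metric.mem_ball]
      have h3 : dist (f x) (g ε x) ≤ δ ε := by rwa [dist_comm, dist_eq_norm]
      linarith [dist_triangle (f x) (g ε x) (L ε)]
    · rw [Metric.mem_ball] at hx hy
      linarith [dist_triangle_right x y (L ε)]
  obtain ⟨c, hc⟩ := cauchy_map_iff_exists_tendsto.1 hcauchy
  refine ⟨c, hc, ?_⟩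
  rw [tendsto_iff_norm_sub_tendsto_zero]
  refine squeeze_zero' (Eventually.of_forall fun _ => norm_nonneg _) ?_ hδ
  filter_upwards [hev] with ε hε
  exact le_of_tendsto ((hg ε hε).sub hc).norm (hu ε hε)

/-- Dominated convergence, with integrability of the limit. -/
theorem integrable_and_tendsto_of_dominated {l : Filter ℝ} [l.NeBot] [l.IsCountablyGenerated]
    {h : ℝ → ℝ → ℂ} {h₀ : ℝ → ℂ} {b : ℝ → ℝ} (hm : ∀ᶠ x in l, Measurable (h x))
    (hb : ∀ᶠ x in l, ∀ y, ‖h x y‖ ≤ b y) (hbi : Integrable b)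
    (hl : ∀ y, Tendsto (fun x => h x y) l (𝓝 (h₀ y))) :
    Integrable h₀ ∧ Tendsto (fun x => ∫ y, h x y) l (𝓝 (∫ y, h₀ y)) := by
  classical
  refine ⟨hbi.mono' (Measurable.aestronglyMeasurable ?_) (Eventually.of_forall fun y => ?_),
    tendsto_integral_filter_of_dominated_convergence b
      (hm.mono fun x hx => hx.aestronglyMeasurable)
      (hb.mono fun x hx => Eventually.of_forall hx) hbi (Eventually.of_forall hl)⟩
  -- Only eventually are the functions measurable; replacing the others by zero does not change the
  -- limit.
  · refine measurable_of_tendsto_metrizable' l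
      (f := fun x => if Measurable (h x) then h x else 0) (fun x => ?_) ?_
    · split_ifs with hx
      exacts [hx, measurable_const]
    · rw [tendsto_pi_nhds]
      refine fun y => (hl y).congr' ?_
      filter_upwards [hm] with x hx
      rw [if_pos hx]
  · exact le_of_tendsto (hl y).norm (hb.mono fun x hx => hx y)

end Limits

/-! ### The transmission condition -/

section Transmission

variable {T : EReal} {V : ℝ → ℝ → ℂ} {M N : Matrix (Fin 2) (Fin 2) ℂ} {G : ℝ → ℝ → ℝ → ℂ}
  {α : ℝ} {Gext : ℝ → ℝ → ℂ → ℂ} {a : ℝ → ℝ} {Gt : ℝ → ℝ → ℂ → ℂ} {p : ℝ}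
  {A B : Fin 3 → ℝ → ℝ → ℝ} {F : ℂ → ℂ} {q AF BF : ℝ}

theorem weight_eq_exp_mul (F : ℂ → ℂ) (ε θ y : ℝ) :
    weight F ε θ y = Complex.exp (-(ε : ℂ) * contour θ y ^ 2) * weight F 0 θ y := by
  unfold weight
  split_ifs with hy
  · rw [mul_zero]
  · simp only [Complex.ofReal_zero, neg_zero, zero_mul, Complex.exp_zero, one_mul]
    ring

/-- The error made by the Gaussian regularisation of a function with Gaussian decay. -/
noncomputable def regError (θ C c ε : ℝ) : ℝ :=
  ∫ y : ℝ, ‖Complex.exp (-(ε : ℂ) * contour θ y ^ 2) - 1‖ * (C * Real.exp (-c * y ^ 2))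

theorem norm_exp_contour_le_one {θ ε : ℝ} (hε : 0 ≤ ε) (hθ : 0 ≤ Real.cos (2 * θ)) (y : ℝ) :
    ‖Complex.exp (-(ε : ℂ) * contour θ y ^ 2)‖ ≤ 1 := by
  rw [norm_exp_neg_mul_sq, sq_contour_re, Real.exp_le_one_iff, neg_mul, neg_nonpos]
  positivity

theorem norm_exp_contour_sub_one_le {θ ε : ℝ} (hε : 0 ≤ ε) (hθ : 0 ≤ Real.cos (2 * θ)) (y : ℝ) :
    ‖Complex.exp (-(ε : ℂ) * contour θ y ^ 2) - 1‖ ≤ 2 := by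
  refine (norm_sub_le _ _).trans ?_
  rw [norm_one]
  linarith [norm_exp_contour_le_one hε hθ y]

theorem continuous_exp_contour (θ ε : ℝ) :
    Continuous fun y => Complex.exp (-(ε : ℂ) * contour θ y ^ 2) := by
  have := continuous_contour θ
  fun_prop

theorem tendsto_regError {θ C c : ℝ} (hC : 0 ≤ C) (hc : 0 < c) (hθ : 0 ≤ Real.cos (2 * θ)) :
    Tendsto (regError θ C c) (𝓝[>] 0) (𝓝 0) := by
  have hev : ∀ᶠ ε : ℝ in 𝓝[>] 0, 0 < ε := self_mem_nhdsWithin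
  suffices h : Tendsto (regError θ C c) (𝓝[>] 0) (𝓝 (∫ _ : ℝ, (0 : ℝ))) by simpa using h
  refine tendsto_integral_filter_of_dominated_convergence
    (fun y => 2 * (C * Real.exp (-c * y ^ 2))) ?_ ?_
    (((integrable_exp_neg_mul_sq hc).const_mul C).const_mul 2) ?_
  · refine Eventually.of_forall fun ε => Continuous.aestronglyMeasurable ?_
    have := continuous_exp_contour θ ε
    fun_prop
  · filter_upwards [hev] with ε hε
    refine Eventually.of_forall fun y => ?_
    rw [Real.norm_of_nonneg (by positivity)]
    have := norm_exp_contour_sub_one_le hε.le hθ y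
    gcongr
  · refine Eventually.of_forall fun y => ?_
    have h1 : Continuous fun ε : ℝ => ‖Complex.exp (-(ε : ℂ) * contour θ y ^ 2) - 1‖ *
        (C * Real.exp (-c * y ^ 2)) := by fun_prop
    simpa using (h1.tendsto 0).mono_left nhdsWithin_le_nhds

/-- The error depends on the integrand only through its Gaussian majorant, hence is uniform in `x`
wherever that majorant is. -/
theorem norm_integral_exp_mul_sub_le {θ C c ε : ℝ} (hC : 0 ≤ C) (hc : 0 < c) (hε : 0 ≤ ε)
    (hθ : 0 ≤ Real.cos (2 * θ)) {h : ℝ → ℂ} (hh : Integrable h)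
    (hb : ∀ y, ‖h y‖ ≤ C * Real.exp (-c * y ^ 2)) :
    ‖(∫ y, Complex.exp (-(ε : ℂ) * contour θ y ^ 2) * h y) - ∫ y, h y‖ ≤ regError θ C c ε := by
  have hcont := continuous_exp_contour θ ε
  have h1 : Integrable fun y => Complex.exp (-(ε : ℂ) * contour θ y ^ 2) * h y :=
    hh.bdd_mul hcont.aestronglyMeasurable (c := 1)
      (Eventually.of_forall fun y => norm_exp_contour_le_one hε hθ y)
  rw [← integral_sub h1 hh]
  refine norm_integral_le_of_norm_le ?_ (Eventually.of_forall fun y => ?_)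
  · refine (((integrable_exp_neg_mul_sq hc).const_mul C).const_mul 2).mono'
      (Continuous.aestronglyMeasurable (by fun_prop)) (Eventually.of_forall fun y => ?_)
    rw [Real.norm_of_nonneg (by positivity)]
    have := norm_exp_contour_sub_one_le hε hθ y
    gcongr
  · rw [← sub_one_mul, norm_mul]
    have := hb y
    gcongr

/-- The condition is linear, so it survives integration against a weight. It is needed only where
`w` does not vanish, which excludes `y = 0`. -/
theorem mulVec_integral_eq {w up um dp dm : ℝ → ℂ}
    (hup : Integrable fun y => w y * up y) (hum : Integrable fun y => w y * um y)
    (hdp : Integrable fun y => w y * dp y) (hdm : Integrable fun y => w y * dm y)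
    (h : ∀ y, w y ≠ 0 → M.mulVec ![up y, um y] = N.mulVec ![dp y, -dm y]) :
    M.mulVec ![∫ y, w y * up y, ∫ y, w y * um y]
      = N.mulVec ![∫ y, w y * dp y, -∫ y, w y * dm y] := by
  funext i
  simp only [Matrix.mulVec, dotProduct, Fin.sum_univ_two, Matrix.cons_val_zero,
    Matrix.cons_val_one]
  rw [mul_neg, ← integral_const_mul, ← integral_const_mul, ← integral_const_mul,
    ← integral_const_mul, ← sub_eq_add_neg, ← integral_add (hup.const_mul _) (hum.const_mul _),
    ← integral_sub (hdp.const_mul _) (hdm.const_mul _)]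
  congr 1
  funext y
  by_cases hw : w y = 0
  · simp [hw]
  · have := congrFun (h y hw) i
    simp only [Matrix.mulVec, dotProduct, Fin.sum_univ_two, Matrix.cons_val_zero,
      Matrix.cons_val_one] at this
    linear_combination (w y) * this

/-- The one-sided limits at the origin of the integral over the rotated line and of its derivative,
as limits of integrals over the real line. -/
theorem GreenAssumption.exists_limits (hG : GreenAssumption T V M N G α Gext a Gt p A B)
    (hq : q ∈ Ioo (0 : ℝ) 2) (hAF : 0 ≤ AF) (hBF : 0 ≤ BF) (hF : Differentiable ℂ F)
    (hFb : ∀ z, ‖F z‖ ≤ AF * Real.exp (BF * ‖z‖ ^ q)) {t : ℝ} (ht : t ∈ timeInterval T)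
    {l : Filter ℝ} [l.NeBot] [l.IsCountablyGenerated] (hl : l ≤ 𝓝[≠] 0)
    (hM : M ≠ 0 ∨ N ≠ 0) {u : ℝ → ℂ}
    (hu : ∀ y ∈ dotReal, Tendsto (fun x => G t x y) l (𝓝 (u y))) :
    (∀ ε, 0 < ε → Integrable fun y => weight F ε 0 y * u y) ∧
    (∃ c, Tendsto (fun x => ∫ y, kern Gext F 0 (α / 2) t x y) l (𝓝 c) ∧
      Tendsto (fun ε => ∫ y, weight F ε 0 y * u y) (𝓝[>] 0) (𝓝 c)) ∧
    (N ≠ 0 → ∀ u' : ℝ → ℂ,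
      (∀ y ∈ dotReal, Tendsto (deriv fun x => G t x y) l (𝓝 (u' y))) →
      (∀ ε, 0 < ε → Integrable fun y => weight F ε 0 y * u' y) ∧
      ∃ c, Tendsto (deriv fun x => ∫ y, kern Gext F 0 (α / 2) t x y) l (𝓝 c) ∧
        Tendsto (fun ε => ∫ y, weight F ε 0 y * u' y) (𝓝[>] 0) (𝓝 c)) := by
  have hα := hG.angle
  have ha := hG.a_pos t ht
  have hFc := hF.continuous
  have hdot : ∀ᶠ x in l, x ∈ dotReal := hl self_mem_nhdsWithin
  have habs : ∀ᶠ x in l, |x| ≤ 1 := by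
    have : ∀ᶠ x : ℝ in 𝓝 0, |x| < 1 := by
      filter_upwards [Metric.ball_mem_nhds (0 : ℝ) one_pos] with x hx
      simpa using hx
    have h' : ∀ᶠ x in l, |x| < 1 := hl.trans nhdsWithin_le_nhds this
    exact h'.mono fun x hx => le_of_lt hx
  have h0mem : (0 : ℝ) ∈ Icc 0 α := ⟨le_rfl, hα.1.le⟩
  have hhalf := half_mem_Icc hα
  have hsin := sin_two_mul_half_pos hα
  have hcos : 0 ≤ Real.cos (2 * (α / 2)) := by
    rw [mul_div_cancel₀ _ two_ne_zero]
    exact Real.cos_nonneg_of_mem_Icc ⟨by linarith [hα.1, Real.pi_pos], hα.2.le⟩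
  have hc : 0 < a t * Real.sin (2 * (α / 2)) := mul_pos ha hsin
  have hγ : 0 < 0 * Real.cos (2 * (α / 2)) + a t * Real.sin (2 * (α / 2)) := by
    rwa [zero_mul, zero_add]
  have hγ0 : ∀ ε : ℝ, 0 < ε → 0 < ε * Real.cos (2 * 0) + a t * Real.sin (2 * 0) := by
    intro ε hε; simpa using hε
  obtain ⟨⟨K₀, hK₀⟩, K₁, hK₁⟩ := hG.bounded_zero hM t ht
  rw [eventually_map] at hK₀ hK₁
  -- values
  have hGe : ∀ y ∈ dotReal, Tendsto (fun x => Gext t x (contour 0 y)) l (𝓝 (u y)) := by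
    intro y hy
    refine (hu y hy).congr' ?_
    filter_upwards [hdot] with x hx
    rw [contour_zero_left, hG.extends_G t ht x hx y hy]
  have hkl : ∀ ε y, Tendsto (fun x => kern Gext F ε 0 t x y) l (𝓝 (weight F ε 0 y * u y)) := by
    intro ε y
    by_cases hy : y = 0
    · simp only [hy, kern_zero, weight_zero, zero_mul]
      exact tendsto_const_nhds
    · exact (hGe y hy).const_mul _
  set K : ℝ := |K₀| + |K₁| + a t + 1 with hK
  have hKnn : 0 ≤ K := by positivity
  have haK : a t ≤ K := by linarith [abs_nonneg K₀, abs_nonneg K₁]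
  have hbase : ∀ᶠ x in l, x ∈ dotReal ∧ |x| ≤ K ∧ A 0 t x ≤ K ∧ B 0 t x ≤ K := by
    filter_upwards [hdot, habs, hl hK₀, hl hK₁] with x h1 h2 h3 h4
    have h3' : A 0 t x ≤ K₀ := h3
    have h4' : B 0 t x ≤ K₁ := h4
    refine ⟨h1, ?_, ?_, ?_⟩ <;>
      linarith [abs_nonneg K₀, abs_nonneg K₁, le_abs_self K₀, le_abs_self K₁]
  -- For fixed `ε` the real line has Gaussian rate `ε`, and boundedness of `A_0` and `B_0` near the
  -- origin makes the majorant uniform in `x`.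
  have hreal : ∀ ε, 0 < ε → (Integrable fun y => weight F ε 0 y * u y) ∧
      Tendsto (fun x => ∫ y, kern Gext F ε 0 t x y) l (𝓝 (∫ y, weight F ε 0 y * u y)) := by
    intro ε hε
    obtain ⟨C, hC, hbd⟩ := hG.exists_kern_bounds hq hAF hBF hFb (hγ0 ε hε) hKnn
    refine integrable_and_tendsto_of_dominated ?_ ?_
      ((integrable_exp_neg_mul_sq (half_pos (hγ0 ε hε))).const_mul C) (hkl ε)
    · exact hdot.mono fun x hx => hG.measurable_kern hFc ε h0mem ht hx
    · filter_upwards [hbase] with x hx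
      exact (hbd ε 0 t x h0mem ht hx.1 hx.2.1 haK le_rfl hx.2.2.1 hx.2.2.2).1
  refine ⟨fun ε hε => (hreal ε hε).1, ?_, fun hN u' hu' => ?_⟩
  · obtain ⟨C, hC, hbd⟩ := hG.exists_kern_bounds hq hAF hBF hFb hc hKnn
    refine exists_tendsto_of_uniform
      (tendsto_regError (θ := α / 2) hC (half_pos hc) hcos) (fun ε hε => ?_)
      fun ε hε => (hreal ε hε).2
    filter_upwards [hbase] with x hx
    -- The comparison with `ε = 0` takes place on the rotated line, where the unregularised integral
    -- converges absolutely.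
    rw [hG.integral_kern_rotate hq hAF hBF hF hFb ht hx.1 hε]
    have := norm_integral_exp_mul_sub_le (θ := α / 2) hC (half_pos hc) hε.le hcos
      (hG.integrable_kern hq hAF hBF hFc hFb hhalf ht hx.1 hγ)
      (hbd 0 (α / 2) t x hhalf ht hx.1 hx.2.1 haK (by rw [zero_mul, zero_add])
        hx.2.2.1 hx.2.2.2).1
    convert this using 4
    funext y
    rw [kern, weight_eq_exp_mul, kern, mul_assoc]
  -- derivatives
  obtain ⟨⟨K₂, hK₂⟩, K₃, hK₃⟩ := hG.bounded_zero_x hN t ht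
  rw [eventually_map] at hK₂ hK₃
  have hGe' : ∀ y ∈ dotReal,
      Tendsto (fun x => deriv (fun ξ => Gext t ξ (contour 0 y)) x) l (𝓝 (u' y)) := by
    intro y hy
    refine (hu' y hy).congr' ?_
    filter_upwards [hdot] with x hx
    refine EventuallyEq.deriv_eq ?_
    filter_upwards [isOpen_dotReal.mem_nhds hx] with ξ hξ
    rw [contour_zero_left, hG.extends_G t ht ξ hξ y hy]
  have hkl' : ∀ ε y, Tendsto (fun x => deriv (fun ξ => kern Gext F ε 0 t ξ y) x) l
      (𝓝 (weight F ε 0 y * u' y)) := by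
    intro ε y
    simp only [deriv_kern]
    by_cases hy : y = 0
    · simp only [hy, weight_zero, zero_mul]
      exact tendsto_const_nhds
    · exact (hGe' y hy).const_mul _
  set K' : ℝ := K + |K₂| + |K₃| with hK'
  have hK'nn : 0 ≤ K' := by positivity
  have haK' : a t ≤ K' := by linarith [abs_nonneg K₂, abs_nonneg K₃]
  have hbase' : ∀ᶠ x in l, x ∈ dotReal ∧ |x| ≤ K' ∧ A 0 t x ≤ K' ∧ B 0 t x ≤ K' ∧
      A 1 t x ≤ K' ∧ B 1 t x ≤ K' := by
    filter_upwards [hbase, hl hK₂, hl hK₃] with x h1 h3 h4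
    have h3' : A 1 t x ≤ K₂ := h3
    have h4' : B 1 t x ≤ K₃ := h4
    obtain ⟨e1, e2, e3, e4⟩ := h1
    refine ⟨e1, ?_, ?_, ?_, ?_, ?_⟩ <;>
      linarith [abs_nonneg K₂, abs_nonneg K₃, le_abs_self K₂, le_abs_self K₃]
  have hderiv : ∀ ε, 0 < ε → ∀ x ∈ dotReal,
      deriv (fun x => ∫ y, kern Gext F ε 0 t x y) x
        = ∫ y, deriv (fun ξ => kern Gext F ε 0 t ξ y) x := fun ε hε x hx =>
    (hG.hasDerivAt_integral_kern hq hAF hBF hFc hFb h0mem ht hx (hγ0 ε hε)).2.deriv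
  have hreal' : ∀ ε, 0 < ε → (Integrable fun y => weight F ε 0 y * u' y) ∧
      Tendsto (fun x => ∫ y, deriv (fun ξ => kern Gext F ε 0 t ξ y) x) l
        (𝓝 (∫ y, weight F ε 0 y * u' y)) := by
    intro ε hε
    obtain ⟨C, hC, hbd⟩ := hG.exists_kern_bounds hq hAF hBF hFb (hγ0 ε hε) hK'nn
    refine integrable_and_tendsto_of_dominated
      (h := fun x y => deriv (fun ξ => kern Gext F ε 0 t ξ y) x) ?_ ?_
      ((integrable_exp_neg_mul_sq (half_pos (hγ0 ε hε))).const_mul C) (hkl' ε)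
    · exact hdot.mono fun x hx => hG.measurable_deriv_kern hFc ε h0mem ht hx
    · filter_upwards [hbase'] with x hx
      obtain ⟨e1, e2, e3, e4, e5, e6⟩ := hx
      exact ((hbd ε 0 t x h0mem ht e1 e2 haK' le_rfl e3 e4).2.1 e5 e6).1
  refine ⟨fun ε hε => (hreal' ε hε).1, ?_⟩
  obtain ⟨C, hC, hbd⟩ := hG.exists_kern_bounds hq hAF hBF hFb hc hK'nn
  refine exists_tendsto_of_uniform
    (tendsto_regError (θ := α / 2) hC (half_pos hc) hcos) (fun ε hε => ?_)
    fun ε hε => (hreal' ε hε).2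
  filter_upwards [hbase'] with x hx
  obtain ⟨e1, e2, e3, e4, e5, e6⟩ := hx
  -- The rotated identity is differentiated in `x`. Rotating `G_x` directly would require its
  -- holomorphy in `z`, which is not assumed.
  have hrot : ∫ y, deriv (fun ξ => kern Gext F ε 0 t ξ y) x
      = ∫ y, deriv (fun ξ => kern Gext F ε (α / 2) t ξ y) x := by
    have h1 := (hG.hasDerivAt_integral_kern hq hAF hBF hFc hFb hhalf ht e1
      (pos_coefficient hα hε ha.le ⟨(half_pos hα.1).le, le_rfl⟩)).2
    rw [← hderiv ε hε x e1, ← h1.deriv]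
    refine EventuallyEq.deriv_eq ?_
    filter_upwards [isOpen_dotReal.mem_nhds e1] with ξ hξ
    exact hG.integral_kern_rotate hq hAF hBF hF hFb ht hξ hε
  obtain ⟨hInt, hd⟩ := hG.hasDerivAt_integral_kern hq hAF hBF hFc hFb hhalf ht e1 hγ
  rw [hrot, hd.deriv]
  have := norm_integral_exp_mul_sub_le (θ := α / 2) hC (half_pos hc) hε.le hcos hInt
    ((hbd 0 (α / 2) t x hhalf ht e1 e2 haK' (by rw [zero_mul, zero_add]) e3 e4).2.1 e5 e6).1
  convert this using 4
  funext y
  rw [deriv_kern, weight_eq_exp_mul, deriv_kern, mul_assoc]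

theorem tendsto_mulVec {M : Matrix (Fin 2) (Fin 2) ℂ} {l : Filter ℝ} {f g : ℝ → ℂ} {c d : ℂ}
    (hf : Tendsto f l (𝓝 c)) (hg : Tendsto g l (𝓝 d)) :
    Tendsto (fun ε => M.mulVec ![f ε, g ε]) l (𝓝 (M.mulVec ![c, d])) := by
  rw [tendsto_pi_nhds]
  intro i
  simp only [Matrix.mulVec, dotProduct, Fin.sum_univ_two, Matrix.cons_val_zero,
    Matrix.cons_val_one]
  exact (hf.const_mul _).add (hg.const_mul _)

/-- The transmission condition for the integral over the rotated line. -/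
theorem GreenAssumption.transmission_integral (hG : GreenAssumption T V M N G α Gext a Gt p A B)
    (hq : q ∈ Ioo (0 : ℝ) 2) (hAF : 0 ≤ AF) (hBF : 0 ≤ BF) (hF : Differentiable ℂ F)
    (hFb : ∀ z, ‖F z‖ ≤ AF * Real.exp (BF * ‖z‖ ^ q)) {t : ℝ} (ht : t ∈ timeInterval T) :
    SatisfiesTransmission M N fun x => ∫ y, kern Gext F 0 (α / 2) t x y := by
  by_cases hM : M ≠ 0 ∨ N ≠ 0
  swap
  · push Not at hM
    -- For `M = N = 0` the condition is empty and no bounds near the origin are assumed, so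
    -- arbitrary values serve as the limits.
    refine ⟨0, 0, 0, 0, fun h => ?_, fun h => absurd hM.2 h, by simp [hM.1, hM.2]⟩
    rcases h with h | h
    exacts [absurd hM.1 h, absurd hM.2 h]
  have htr := fun y (hy : y ∈ dotReal) => hG.transmission y hy t ht
  choose! up um dp dm h1 h2 h3 using htr
  have hr : 𝓝[>] (0 : ℝ) ≤ 𝓝[≠] 0 := nhdsWithin_mono _ fun x hx => ne_of_gt hx
  have hl : 𝓝[<] (0 : ℝ) ≤ 𝓝[≠] 0 := nhdsWithin_mono _ fun x hx => ne_of_lt hx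
  obtain ⟨ip, ⟨cp, hcp, hcp'⟩, hdp⟩ := hG.exists_limits hq hAF hBF hF hFb ht hr hM
    fun y hy => (h1 y hy hM).1
  obtain ⟨im, ⟨cm, hcm, hcm'⟩, hdm⟩ := hG.exists_limits hq hAF hBF hF hFb ht hl hM
    fun y hy => (h1 y hy hM).2
  have hw : ∀ {ε y : ℝ}, weight F ε 0 y ≠ 0 → y ∈ dotReal := fun {ε y} h hy => by
    rw [mem_singleton_iff] at hy
    rw [hy, weight_zero] at h
    exact h rfl
  have hev : ∀ᶠ ε : ℝ in 𝓝[>] 0, 0 < ε := self_mem_nhdsWithin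
  by_cases hN : N = 0
  -- With `N = 0` the limits of the derivative need not exist; zeros stand in for them.
  · refine ⟨cp, cm, 0, 0, fun _ => ⟨hcp, hcm⟩, fun h => absurd hN h, ?_⟩
    rw [hN, Matrix.zero_mulVec]
    refine tendsto_nhds_unique (tendsto_mulVec hcp' hcm') (tendsto_const_nhds.congr' ?_)
    filter_upwards [hev] with ε hε
    have := mulVec_integral_eq (M := M) (N := N) (w := weight F ε 0) (dp := 0) (dm := 0)
      (ip ε hε) (im ε hε) (by simp) (by simp) fun y hy => by
        rw [h3 y (hw hy), hN, Matrix.zero_mulVec, Matrix.zero_mulVec]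
    rw [this, hN, Matrix.zero_mulVec]
  · obtain ⟨jp, kp, hkp, hkp'⟩ := hdp hN dp fun y hy => (h2 y hy hN).1
    obtain ⟨jm, km, hkm, hkm'⟩ := hdm hN dm fun y hy => (h2 y hy hN).2
    refine ⟨cp, cm, kp, km, fun _ => ⟨hcp, hcm⟩, fun _ => ⟨hkp, hkm⟩, ?_⟩
    refine tendsto_nhds_unique (tendsto_mulVec hcp' hcm')
      ((tendsto_mulVec hkp' hkm'.neg).congr' ?_)
    filter_upwards [hev] with ε hε
    exact (mulVec_integral_eq (ip ε hε) (im ε hε) (jp ε hε) (jm ε hε)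
      fun y hy => h3 y (hw hy)).symm

end Transmission

/-! ### The initial condition -/

section InitialCondition

/-- The integral over a rotated ray starting at distance at least `d` to the right of the centre of
the Gaussian factor is of order `A / a`. -/
theorem exists_norm_ray_integral_le {α p q s d B₀ B' : ℝ} (hα : α ∈ Ioo 0 (Real.pi / 2))
    (hp : p ∈ Ioo (0 : ℝ) 2) (hq : q ∈ Ioo (0 : ℝ) 2) (hs : 0 ≤ s) (hd : 0 < d) (hB₀ : 0 ≤ B₀)
    (hB' : 0 ≤ B') :
    ∃ C : ℝ, 0 ≤ C ∧ ∀ (f : ℂ → ℂ) (a ξ A B : ℝ), SectorGaussian α f a ξ A B p B' q → 1 ≤ a →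
      0 ≤ A → B ≤ B₀ → d ≤ s - ξ →
      ‖∫ r in Ioi (0 : ℝ), Complex.exp ((α / 2 : ℝ) * Complex.I) *
        f ((s : ℂ) + r * Complex.exp ((α / 2 : ℝ) * Complex.I))‖ ≤ C * (A / a) := by
  have hsinα := sin_two_mul_half_pos hα
  have hsin : 0 < Real.sin (α / 2) := Real.sin_pos_of_pos_of_lt_pi (half_pos hα.1)
    (by linarith [hα.2, Real.pi_pos])
  obtain ⟨C, hC, hbd⟩ := exists_exp_le_gaussian (L := 0) (s := s) hp hq hsinα hB₀ hB'
  -- Since the ray starts at distance at least `d` from the centre, the cross term of the phase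
  -- gives `exp(-a k r)`, whose integral is `1 / (a k)`. The quadratic term, used with `a ≥ 1`,
  -- absorbs the exponentials independently of `a`.
  set k : ℝ := 2 * d * Real.sin (α / 2) with hk
  have hkpos : 0 < k := by positivity
  refine ⟨C / k, by positivity, fun f a ξ A B hf ha hA hB hdξ => ?_⟩
  have ha0 : 0 < a := by linarith
  have hpt : ∀ r ∈ Ioi (0 : ℝ), ‖Complex.exp ((α / 2 : ℝ) * Complex.I) *
      f ((s : ℂ) + r * Complex.exp ((α / 2 : ℝ) * Complex.I))‖
        ≤ A * C * Real.exp (-(a * k) * r) := by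
    intro r hr
    have hr0 : (0 : ℝ) < r := hr
    have hz := ray_mem_sectorCone hα hs hr0.le (Or.inr hr0) (half_mem_Icc hα)
    rw [norm_mul, Complex.norm_exp_ofReal_mul_I, one_mul]
    refine (hf.bound _ hz).trans ?_
    rw [mul_assoc]
    refine mul_le_mul_of_nonneg_left ?_ hA
    have hn := norm_ray_le (θ := α / 2) hs hr0.le
    have h1 : B * ‖(s : ℂ) + r * Complex.exp ((α / 2 : ℝ) * Complex.I)‖ ^ p ≤ B₀ * (s + r) ^ p :=
      mul_le_mul hB (Real.rpow_le_rpow (norm_nonneg _) hn hp.1.le) (by positivity) hB₀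
    have h2 : B' * ‖(s : ℂ) + r * Complex.exp ((α / 2 : ℝ) * Complex.I)‖ ^ q ≤ B' * (s + r) ^ q :=
      mul_le_mul_of_nonneg_left (Real.rpow_le_rpow (norm_nonneg _) hn hq.1.le) hB'
    have h3 : a * k * r + Real.sin (2 * (α / 2)) * r ^ 2
        ≤ a * (2 * (s - ξ) * r * Real.sin (α / 2) + r ^ 2 * Real.sin (2 * (α / 2))) := by
      have e1 : k * r ≤ 2 * (s - ξ) * r * Real.sin (α / 2) := by
        have : 2 * d * Real.sin (α / 2) * r ≤ 2 * (s - ξ) * Real.sin (α / 2) * r := by gcongr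
        linarith
      have e2 : Real.sin (2 * (α / 2)) * r ^ 2 ≤ a * (Real.sin (2 * (α / 2)) * r ^ 2) :=
        le_mul_of_one_le_left (by positivity) ha
      nlinarith [mul_le_mul_of_nonneg_left e1 ha0.le]
    have h4 := hbd r hr0.le (by positivity)
    have h5 : Real.exp (-(Real.sin (2 * (α / 2)) / 2) * r ^ 2) ≤ 1 := by
      rw [Real.exp_le_one_iff, neg_mul, neg_nonpos]; positivity
    have h6 := h4.trans (mul_le_of_le_one_right hC.le h5)
    calc _ ≤ Real.exp ((-Real.sin (2 * (α / 2)) * r ^ 2 + 0 * r + B₀ * (s + r) ^ p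
          + B' * (s + r) ^ q) + -(a * k) * r) := by
          rw [Real.exp_le_exp, sq_ray_sub_im]
          linarith
      _ ≤ _ := by
          rw [Real.exp_add]
          exact mul_le_mul_of_nonneg_right h6 (Real.exp_pos _).le
  have hak : 0 < a * k := by positivity
  refine (norm_integral_le_of_norm_le
    ((exp_neg_integrableOn_Ioi 0 hak).const_mul (A * C))
    ((ae_restrict_iff' measurableSet_Ioi).2 (Eventually.of_forall hpt))).trans (le_of_eq ?_)
  rw [integral_const_mul, integral_exp_mul_Ioi (neg_lt_zero.2 hak), mul_zero, Real.exp_zero]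
  field_simp

variable {T : EReal} {V : ℝ → ℝ → ℂ} {M N : Matrix (Fin 2) (Fin 2) ℂ} {G : ℝ → ℝ → ℝ → ℂ}
  {α : ℝ} {Gext : ℝ → ℝ → ℂ → ℂ} {a : ℝ → ℝ} {Gt : ℝ → ℝ → ℂ → ℂ} {p : ℝ}
  {A B : Fin 3 → ℝ → ℝ → ℝ} {F : ℂ → ℂ} {q AF BF : ℝ}

theorem eventually_mem_timeInterval (hT : 0 < T) : ∀ᶠ t : ℝ in 𝓝[>] 0, t ∈ timeInterval T := by
  have h1 : ∀ᶠ t : ℝ in 𝓝 0, (t : EReal) < T :=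
    (isOpen_lt continuous_coe_real_ereal continuous_const).mem_nhds (by simpa using hT)
  filter_upwards [self_mem_nhdsWithin, nhdsWithin_le_nhds h1] with t h2 h3 using ⟨h2, h3⟩

/-- The initial condition for the integral over the rotated line. -/
theorem GreenAssumption.initial_integral (hG : GreenAssumption T V M N G α Gext a Gt p A B)
    (hT : 0 < T) (hq : q ∈ Ioo (0 : ℝ) 2) (hAF : 0 ≤ AF) (hBF : 0 ≤ BF) (hF : Differentiable ℂ F)
    (hFb : ∀ z, ‖F z‖ ≤ AF * Real.exp (BF * ‖z‖ ^ q)) {x : ℝ} (hx : x ∈ dotReal) :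
    Tendsto (fun t => ∫ y, kern Gext F 0 (α / 2) t x y) (𝓝[>] 0) (𝓝 (F x)) := by
  have hα := hG.angle
  obtain ⟨s, hxs, hinit⟩ := hG.initial x hx
  have hs : 0 ≤ s := (abs_nonneg x).trans hxs.le
  have hFr : ContDiff ℝ ∞ fun y : ℝ => F y :=
    (hF.contDiff.restrict_scalars ℝ).comp Complex.ofRealCLM.contDiff
  have h1 := hinit (fun y => F y) hFr.contDiffOn
  obtain ⟨K, hK⟩ := hG.A_bounded_time x hx
  obtain ⟨K', hK'⟩ := hG.B_bounded_time x hx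
  rw [eventually_map] at hK hK'
  -- The distance `s - |x|` works for both rays, whose centres are `x` and, after reflection, `-x`.
  obtain ⟨C, hC, hbd⟩ := exists_norm_ray_integral_le (B₀ := max K' 0) hα hG.order hq hs
    (sub_pos.2 hxs) (le_max_right _ _) hBF
  have hIev := eventually_mem_timeInterval hT
  have ha1 : ∀ᶠ t in 𝓝[>] (0 : ℝ), 1 ≤ a t := hG.a_lim.eventually_ge_atTop 1
  have hsqrt : Tendsto (fun t => C * (K * AF * (√(a t))⁻¹)) (𝓝[>] 0) (𝓝 0) := by
    have h2 : Tendsto (fun t => (√(a t))⁻¹) (𝓝[>] 0) (𝓝 0) :=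
      tendsto_inv_atTop_zero.comp (Real.tendsto_sqrt_atTop.comp hG.a_lim)
    simpa using (h2.const_mul (K * AF)).const_mul C
  -- One factor `√a` is spent on the bound for `A_0 / √a`; the other remains and tends to infinity.
  have hAa : ∀ᶠ t in 𝓝[>] (0 : ℝ), A 0 t x * AF / a t ≤ K * AF * (√(a t))⁻¹ := by
    filter_upwards [hIev, hK] with t ht hKt
    have ha := hG.a_pos t ht
    have hsq := Real.sqrt_pos.2 ha
    have e : A 0 t x * AF / a t = A 0 t x / √(a t) * AF * (√(a t))⁻¹ := by
      nth_rewrite 1 [← Real.mul_self_sqrt ha.le]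
      field_simp
    rw [e]
    have hKt' : A 0 t x / √(a t) ≤ K := hKt
    gcongr
  have hBK : ∀ᶠ t in 𝓝[>] (0 : ℝ), B 0 t x ≤ max K' 0 :=
    hK'.mono fun t h => le_trans h (le_max_left _ _)
  have hright : Tendsto (fun t => ∫ r in Ioi (0 : ℝ), Complex.exp ((α / 2 : ℝ) * Complex.I) *
      (Gext t x ((s : ℂ) + r * Complex.exp ((α / 2 : ℝ) * Complex.I))
        * F ((s : ℂ) + r * Complex.exp ((α / 2 : ℝ) * Complex.I)))) (𝓝[>] 0) (𝓝 0) := by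
    refine squeeze_zero_norm' ?_ hsqrt
    filter_upwards [hIev, ha1, hAa, hBK] with t ht h2 h3 h4
    refine (hbd _ _ _ _ _ (hG.sectorGaussian_right hF hFb ht hx) h2
      (mul_nonneg (hG.A_nonneg 0 t ht x hx) hAF) h4 (by linarith [le_abs_self x])).trans ?_
    gcongr
  have hleft : Tendsto (fun t => ∫ r in Ioi (0 : ℝ), Complex.exp ((α / 2 : ℝ) * Complex.I) *
      (Gext t x (-((s : ℂ) + r * Complex.exp ((α / 2 : ℝ) * Complex.I)))
        * F (-((s : ℂ) + r * Complex.exp ((α / 2 : ℝ) * Complex.I))))) (𝓝[>] 0) (𝓝 0) := by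
    refine squeeze_zero_norm' ?_ hsqrt
    filter_upwards [hIev, ha1, hAa, hBK] with t ht h2 h3 h4
    refine (hbd _ _ _ _ _ (hG.sectorGaussian_left hF hFb ht hx) h2
      (mul_nonneg (hG.A_nonneg 0 t ht x hx) hAF) h4 (by linarith [neg_abs_le x])).trans ?_
    gcongr
  have h2 := (h1.add hright).add hleft
  rw [add_zero, add_zero] at h2
  refine h2.congr' ?_
  filter_upwards [hIev] with t ht
  exact tendsto_nhds_unique (hG.tendsto_integral_kern_split hq hAF hBF hF hFb hs ht hx)
    (hG.tendsto_integral_kern hq hAF hBF hF hFb ht hx)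

end InitialCondition

/-! ### The wave function: solution property and continuous dependence -/

section WaveFunction

variable {T : EReal} {V : ℝ → ℝ → ℂ} {M N : Matrix (Fin 2) (Fin 2) ℂ} {G : ℝ → ℝ → ℝ → ℂ}
  {α : ℝ} {Gext : ℝ → ℝ → ℂ → ℂ} {a : ℝ → ℝ} {Gt : ℝ → ℝ → ℂ → ℂ} {p : ℝ}
  {A B : Fin 3 → ℝ → ℝ → ℝ} {F : ℂ → ℂ} {q AF BF : ℝ}

theorem GreenAssumption.tendsto_integral_regIntegrand
    (hG : GreenAssumption T V M N G α Gext a Gt p A B) (hq : q ∈ Ioo (0 : ℝ) 2)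
    (hF : F ∈ expGrowth q) {t x : ℝ} (ht : t ∈ timeInterval T) (hx : x ∈ dotReal) :
    Tendsto (fun ε : ℝ => ∫ y : ℝ, regIntegrand G F t x ε y) (𝓝[>] 0)
      (𝓝 (∫ y, kern Gext F 0 (α / 2) t x y)) := by
  obtain ⟨hFd, AF, BF, hAF, hBF, hFb⟩ := hF
  refine (hG.tendsto_integral_kern hq hAF hBF hFd hFb ht hx).congr fun ε => ?_
  exact (integral_congr_ae (hG.regIntegrand_ae_eq F ht hx)).symm

/-- The wave function is given by the absolutely convergent integral over the rotated line. -/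
theorem GreenAssumption.waveFunction_eq
    (hG : GreenAssumption T V M N G α Gext a Gt p A B) (hq : q ∈ Ioo (0 : ℝ) 2)
    (hF : F ∈ expGrowth q) {t x : ℝ} (ht : t ∈ timeInterval T) (hx : x ∈ dotReal) :
    waveFunction G F t x = ∫ y, kern Gext F 0 (α / 2) t x y :=
  (hG.tendsto_integral_regIntegrand hq hF ht hx).limUnder_eq

theorem GreenAssumption.integrable_regIntegrand
    (hG : GreenAssumption T V M N G α Gext a Gt p A B) (hq : q ∈ Ioo (0 : ℝ) 2)
    (hF : F ∈ expGrowth q) {t x ε : ℝ} (ht : t ∈ timeInterval T) (hx : x ∈ dotReal)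
    (hε : 0 < ε) : Integrable (regIntegrand G F t x ε) := by
  obtain ⟨hFd, AF, BF, hAF, hBF, hFb⟩ := hF
  have hα := hG.angle
  exact (hG.integrable_kern hq hAF hBF hFd.continuous hFb ⟨le_rfl, hα.1.le⟩ ht hx
    (pos_coefficient hα hε (hG.a_pos t ht).le ⟨le_rfl, (half_pos hα.1).le⟩)).congr
    (hG.regIntegrand_ae_eq F ht hx).symm

/-- Being a solution depends only on the values on `(0, T) × (ℝ \ {0})`. -/
theorem IsCauchySolution.congr {f : ℝ → ℂ} {Φ Ψ : ℝ → ℝ → ℂ} (hT : 0 < T)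
    (h : IsCauchySolution T V M N f Φ)
    (he : ∀ t ∈ timeInterval T, ∀ x ∈ dotReal, Φ t x = Ψ t x) :
    IsCauchySolution T V M N f Ψ := by
  have hl : Iio (0 : ℝ) ⊆ dotReal := fun x hx => ne_of_lt hx
  have hr : Ioi (0 : ℝ) ⊆ dotReal := fun x hx => ne_of_gt hx
  have hex : ∀ t ∈ timeInterval T, ∀ x ∈ dotReal, Φ t =ᶠ[𝓝 x] Ψ t := fun t ht x hx => by
    filter_upwards [isOpen_dotReal.mem_nhds hx] with ξ hξ using he t ht ξ hξ
  have hd : ∀ t ∈ timeInterval T, ∀ x ∈ dotReal, deriv (Φ t) x = deriv (Ψ t) x :=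
    fun t ht x hx => (hex t ht x hx).deriv_eq
  refine ⟨⟨fun x hx => (h.mem.time x hx).congr fun t ht => he t ht x hx, fun t ht =>
    ⟨(h.mem.space t ht).1.congr fun x hx => he t ht x (hl hx),
      (h.mem.space t ht).2.congr fun x hx => he t ht x (hr hx)⟩, fun t ht x hx =>
    (h.mem.differentiable t ht x hx).congr_of_eventuallyEq (hex t ht x hx).symm, fun t ht =>
    ⟨(h.mem.space_deriv t ht).1.congr fun x hx => hd t ht x (hl hx),
      (h.mem.space_deriv t ht).2.congr fun x hx => hd t ht x (hr hx)⟩⟩, ?_, fun t ht => ?_,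
    fun x hx => ?_⟩
  · filter_upwards [h.schroedinger] with P hP h1 h2
    have e1 : (fun t => Φ t P.2) =ᶠ[𝓝 P.1] fun t => Ψ t P.2 := by
      filter_upwards [(isOpen_timeInterval T).mem_nhds h1] with t ht using he t ht P.2 h2
    have e2 : deriv (Φ P.1) =ᶠ[𝓝 P.2] deriv (Ψ P.1) := by
      filter_upwards [isOpen_dotReal.mem_nhds h2] with ξ hξ using hd P.1 h1 ξ hξ
    rw [← e1.deriv_eq, ← e2.deriv_eq, ← he P.1 h1 P.2 h2]
    exact hP h1 h2
  · obtain ⟨up, um, dp, dm, h1, h2, h3⟩ := h.transmission t ht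
    have hpos : ∀ᶠ x : ℝ in 𝓝[>] 0, x ∈ dotReal := by
      filter_upwards [self_mem_nhdsWithin] with x hx using hr hx
    have hneg : ∀ᶠ x : ℝ in 𝓝[<] 0, x ∈ dotReal := by
      filter_upwards [self_mem_nhdsWithin] with x hx using hl hx
    exact ⟨up, um, dp, dm, fun h' => ⟨(h1 h').1.congr' (hpos.mono fun x hx => he t ht x hx),
      (h1 h').2.congr' (hneg.mono fun x hx => he t ht x hx)⟩, fun h' =>
      ⟨(h2 h').1.congr' (hpos.mono fun x hx => hd t ht x hx),
      (h2 h').2.congr' (hneg.mono fun x hx => hd t ht x hx)⟩, h3⟩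
  · refine (h.initial x hx).congr' ?_
    filter_upwards [eventually_mem_timeInterval hT] with t ht using he t ht x hx

theorem GreenAssumption.isCauchySolution_waveFunction
    (hG : GreenAssumption T V M N G α Gext a Gt p A B) (hT : 0 < T) (hq : q ∈ Ioo (0 : ℝ) 2)
    (hF : F ∈ expGrowth q) :
    IsCauchySolution T V M N (fun x : ℝ => F x) (waveFunction G F) := by
  have heq := fun t (ht : t ∈ timeInterval T) x (hx : x ∈ dotReal) =>
    (hG.waveFunction_eq hq hF ht hx).symm
  obtain ⟨hFd, AF, BF, hAF, hBF, hFb⟩ := hF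
  have hhalf := half_mem_Icc hG.angle
  have hsin := sin_two_mul_half_pos hG.angle
  have hFc := hFd.continuous
  exact IsCauchySolution.congr hT
    ⟨hG.memAC12_integral hq hAF hBF hFc hFb hhalf hsin,
      hG.schroedinger_integral hq hAF hBF hFc hFb hhalf hsin,
      fun t ht => hG.transmission_integral hq hAF hBF hFd hFb ht,
      fun x hx => hG.initial_integral hT hq hAF hBF hFd hFb hx⟩ heq

/-- Dividing the difference by `δ` normalises it, so that one kernel bound serves all `n` and the
factor `δ` measures smallness. -/
theorem weight_sub_eq (F₁ F₂ : ℂ → ℂ) {δ : ℝ} (hδ : δ ≠ 0) (ε θ y : ℝ) :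
    weight F₁ ε θ y - weight F₂ ε θ y
      = δ * weight (fun z => (δ : ℂ)⁻¹ * (F₁ z - F₂ z)) ε θ y := by
  have : (δ : ℂ) ≠ 0 := Complex.ofReal_ne_zero.2 hδ
  unfold weight
  split_ifs with hy
  · simp
  · field_simp

/-- Continuous dependence of the wave function on the initial condition. -/
theorem GreenAssumption.tendstoUniformlyOn_waveFunction
    (hG : GreenAssumption T V M N G α Gext a Gt p A B) (hq : q ∈ Ioo (0 : ℝ) 2)
    (hF : F ∈ expGrowth q) {Fn : ℕ → ℂ → ℂ} (hFn : ∀ n, Fn n ∈ expGrowth q)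
    (hconv : ConvergesExpGrowth q Fn F) {t : ℝ} (ht : t ∈ timeInterval T) {S : Set ℝ}
    (hS : IsCompact S) (hSd : S ⊆ dotReal) :
    TendstoUniformlyOn (fun n x => waveFunction G (Fn n) t x) (waveFunction G F t) atTop S := by
  obtain ⟨b, hb, hlim⟩ := hconv
  have hα := hG.angle
  have hhalf := half_mem_Icc hα
  have hc : 0 < a t * Real.sin (2 * (α / 2)) :=
    mul_pos (hG.a_pos t ht) (sin_two_mul_half_pos hα)
  have hγ : 0 < 0 * Real.cos (2 * (α / 2)) + a t * Real.sin (2 * (α / 2)) := by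
    rwa [zero_mul, zero_add]
  obtain ⟨K, hK, haK, hbK⟩ := hG.exists_bound_space ht hS hSd
  -- The constant `C` is fixed before `n` is chosen and applies to all functions with `|F| ≤ exp(b
  -- |z|^q)`, in particular to the normalised differences.
  obtain ⟨C, hC, hbd⟩ := hG.exists_kern_bounds_uniform hq zero_le_one hb hc hK
  have hInt : ∀ F : ℂ → ℂ, F ∈ expGrowth q → ∀ x ∈ dotReal,
      Integrable (kern Gext F 0 (α / 2) t x) := by
    rintro F ⟨hFd, AF, BF, hAF, hBF, hFb⟩ x hx
    exact hG.integrable_kern hq hAF hBF hFd.continuous hFb hhalf ht hx hγ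
  set J : ℝ := ∫ y : ℝ, C * Real.exp (-(a t * Real.sin (2 * (α / 2)) / 2) * y ^ 2) with hJ
  have hJ0 : 0 ≤ J := integral_nonneg fun y => by positivity
  rw [Metric.tendstoUniformlyOn_iff]
  intro e he
  -- This gives `δ * J < e`; the shift `J + 1` avoids division by zero.
  set δ : ℝ := e / (2 * (J + 1)) with hδ
  have hδ0 : 0 < δ := by positivity
  have hev := hlim.eventually (gt_mem_nhds (ENNReal.ofReal_pos.2 hδ0))
  filter_upwards [hev] with n hn x hx
  have hxd := hSd hx
  obtain ⟨hxK, hAB⟩ := hbK x hx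
  have hDb : ∀ z, ‖(δ : ℂ)⁻¹ * (Fn n z - F z)‖ ≤ 1 * Real.exp (b * ‖z‖ ^ q) := by
    intro z
    have h1 : ENNReal.ofReal (‖Fn n z - F z‖ * Real.exp (-b * ‖z‖ ^ q)) < ENNReal.ofReal δ :=
      lt_of_le_of_lt (le_iSup
        (fun z => ENNReal.ofReal (‖Fn n z - F z‖ * Real.exp (-b * ‖z‖ ^ q))) z) hn
    have h2 := (ENNReal.ofReal_lt_ofReal_iff hδ0).1 h1
    rw [neg_mul, Real.exp_neg, ← div_eq_mul_inv, div_lt_iff₀ (Real.exp_pos _)] at h2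
    rw [norm_mul, norm_inv, Complex.norm_real, Real.norm_of_nonneg hδ0.le, one_mul,
      inv_mul_le_iff₀ hδ0]
    exact h2.le
  rw [dist_comm, dist_eq_norm, hG.waveFunction_eq hq (hFn n) ht hxd,
    hG.waveFunction_eq hq hF ht hxd, ← integral_sub (hInt _ (hFn n) x hxd) (hInt _ hF x hxd)]
  have hk : ∀ y, kern Gext (Fn n) 0 (α / 2) t x y - kern Gext F 0 (α / 2) t x y
      = δ * kern Gext (fun z => (δ : ℂ)⁻¹ * (Fn n z - F z)) 0 (α / 2) t x y := fun y => by
    rw [kern, kern, ← sub_mul, weight_sub_eq _ _ hδ0.ne', kern, mul_assoc]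
  simp only [hk]
  rw [integral_const_mul, norm_mul, Complex.norm_real, Real.norm_of_nonneg hδ0.le]
  have hle := norm_integral_le_of_norm_le
    ((integrable_exp_neg_mul_sq (half_pos hc)).const_mul C)
    (Eventually.of_forall (hbd _ hDb 0 (α / 2) t x hhalf ht hxd hxK haK
      (by rw [zero_mul, zero_add]) (hAB 0).1 (hAB 0).2).1)
  calc _ ≤ δ * J := by gcongr
    _ < e := by
      rw [hδ, div_mul_eq_mul_div, div_lt_iff₀ (by positivity)]
      nlinarith

end WaveFunction

end GreenSchroedinger

/-! ### The main theorem -/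

theorem theorem3p3 (T : EReal) (hT : 0 < T) (V : ℝ → ℝ → ℂ) (M N : Matrix (Fin 2) (Fin 2) ℂ)
    (G : ℝ → ℝ → ℝ → ℂ) (α : ℝ) (Gext : ℝ → ℝ → ℂ → ℂ) (a : ℝ → ℝ) (Gt : ℝ → ℝ → ℂ → ℂ)
    (p : ℝ) (A B : Fin 3 → ℝ → ℝ → ℝ)
    (hG : GreenSchroedinger.GreenAssumption T V M N G α Gext a Gt p A B)
    (q : ℝ) (hq : q ∈ Set.Ioo (0 : ℝ) 2) (F : ℂ → ℂ) (hF : F ∈ GreenSchroedinger.expGrowth q) :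
    (∀ t ∈ GreenSchroedinger.timeInterval T, ∀ x ∈ GreenSchroedinger.dotReal,
      (∀ ε : ℝ, 0 < ε → Integrable (GreenSchroedinger.regIntegrand G F t x ε)) ∧
      Tendsto (fun ε : ℝ => ∫ y : ℝ, GreenSchroedinger.regIntegrand G F t x ε y)
        (𝓝[>] 0) (𝓝 (GreenSchroedinger.waveFunction G F t x))) ∧
    GreenSchroedinger.IsCauchySolution T V M N (fun x : ℝ => F (x : ℂ))
      (GreenSchroedinger.waveFunction G F) ∧
    (∀ Fn : ℕ → ℂ → ℂ, (∀ n, Fn n ∈ GreenSchroedinger.expGrowth q) →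
      GreenSchroedinger.ConvergesExpGrowth q Fn F →
      ∀ t ∈ GreenSchroedinger.timeInterval T, ∀ K : Set ℝ, IsCompact K →
        K ⊆ GreenSchroedinger.dotReal →
        TendstoUniformlyOn (fun n x => GreenSchroedinger.waveFunction G (Fn n) t x)
          (GreenSchroedinger.waveFunction G F t) atTop K) := by
  refine ⟨fun t ht x hx => ⟨fun ε hε => hG.integrable_regIntegrand hq hF ht hx hε, ?_⟩,
    hG.isCauchySolution_waveFunction hT hq hF, fun Fn hFn hconv t ht K hK hKd =>
    hG.tendstoUniformlyOn_waveFunction hq hF hFn hconv ht hK hKd⟩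
  rw [hG.waveFunction_eq hq hF ht hx]
  exact hG.tendsto_integral_regIntegrand hq hF ht hx
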